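/- Let $G$ be a connected finite-dimensional real Lie group with Lie algebra $\mathfrak g$, basis $J_a$ of $\mathfrak g$, dual basis $P^a$ of $\mathfrak g^*$ and structure constants $[J_a,J_b]=f_{ab}{}^cJ_c$. Put $\langle \mathrm{Ad}^*(u)j,\xi\rangle=\langle j,\mathrm{Ad}(u)\xi\rangle$, $J^R_\xi F(u)=\frac{d}{dt}|_0F(ue^{t\xi})$, $J^L_\xi F(u)=\frac{d}{dt}|_0F(e^{-t\xi}u)$. Let $H=G\ltimes\mathfrak g^*$ with $(u_1,a_1)(u_2,a_2)=(u_1u_2,a_1+\mathrm{Ad}^*(u_1^{-1})a_2)$, parametrised by $G\times\mathfrak g^*$ through $(u,j)\mapsto(u,-\mathrm{Ad}^*(u^{-1})j)$. Let $n,g\ge 0$ and write points of $H^{n+2g}$ as $(u_X,j^X)$, $X\in\{M_1,\dots,M_n,A_1,B_1,\dots,A_g,B_g\}$, with the order $M_1<\dots<M_n<A_1,B_1<\dots<A_g,B_g$ ($A_i,B_i$ not compared). Write $j^X_\xi=\langle j^X,\xi\rangle$. The flower algebra $\mathcal F=S(\bigoplus_{k=1}^{n+2g}\mathfrak g)\otimes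 C^\infty(G^{n+2g})$ is the algebra of functions on $H^{n+2g}$ generated by the $j^X_\xi$ and by $C^\infty(G^{n+2g})$. Its bracket, extended to $C^\infty(H^{n+2g})$ as an antisymmetric biderivation, is given by $\{F,F'\}=0$ for $F,F'\in C^\infty(G^{n+2g})$ and $$\{j^X_\xi,j^X_\eta\}=-j^X_{[\xi,\eta]},\qquad \{j^X_\xi,j^Y_\eta\}=-j^Y_{[(1-\mathrm{Ad}(u_X))\xi,\eta]}\ (X<Y),\qquad \{j^{A_i}_\xi,j^{B_i}_\eta\}=-j^{B_i}_{[\xi,\eta]},$$ and, with $D^Y_\eta=J_\eta^{R_Y}+J_\eta^{L_Y}$ and $T^X_\xi=\sum_{Y>X}D^Y_{(1-\mathrm{Ad}(u_X))\xi}$, $$\{j^{M_i}_\xi,F\}=-D^{M_i}_\xi F-T^{M_i}_\xi F,\qquad \{j^{B_i}_\xi,F\}=-J^{L_{A_i}}_\xi F-D^{B_i}_\xi F-T^{B_i}_\xi F,$$ $$\{j^{A_i}_\xi,F\}=-D^{A_i}_\xi F-D^{B_i}_\xi F-J^{R_{B_i}}_{\mathrm{Ad}(u_{B_i}^{-1}u_{A_i})\xi}F-T^{A_i}_\xi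 F.$$ The decoupling transformation $K:\mathcal F\to\mathcal F$ is the pull-back by the map $\kappa:(u_X,j^X)\mapsto(u_X,j^{X'})$ of $H^{n+2g}$, where, with $u_{K_i}=u_{B_i}u_{A_i}^{-1}u_{B_i}^{-1}u_{A_i}$ and $j^{H_i}=(1-\mathrm{Ad}^*(u_{A_i}^{-1}u_{B_i}^{-1}u_{A_i}))j^{A_i}+(\mathrm{Ad}^*(u_{A_i}^{-1}u_{B_i}^{-1}u_{A_i})-\mathrm{Ad}^*(u_{B_i}^{-1}u_{A_i}))j^{B_i}$, $$j^{M_i'}=j^{M_i}-(1-\mathrm{Ad}^*(u_{M_i}))\Big(\sum_{k>i}\mathrm{Ad}^*(u_{M_{k-1}}\cdots u_{M_{i+1}})j^{M_k}+\sum_{k=1}^g\mathrm{Ad}^*(u_{K_{k-1}}\cdots u_{K_1}u_{M_n}\cdots u_{M_{i+1}})j^{H_k}\Big),$$ $$j^{X'}=j^{X}+\mathrm{Ad}^*(u_{A_i}^{-1})(j^{A_i}-j^{B_i})+(\mathrm{Ad}^*(u_{X})-\mathrm{Ad}^*(u_{B_i}u_{A_i}^{-1}))\sum_{k>i}\mathrm{Ad}^*(u_{K_{k-1}}\cdots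 u_{K_{i+1}})j^{H_k}\quad(X=A_i,B_i).$$ Let $L$ be the map of $H^{n+2g}$ that is the identity on the puncture factors and sends $(u_{A_i},u_{B_i},j^{A_i'},j^{B_i'})$ to $(w_{1,i},w_{2,i},k^{1,i},k^{2,i})=(u_{A_i},\,u_{B_i}^{-1}u_{A_i},\,j^{A_i'}-j^{B_i'},\,j^{B_i'})$. Let $H^*$ be $H$ with the bivector $\frac12(\tilde P^a_L\wedge\tilde J^L_a+\tilde P^a_R\wedge\tilde J^R_a)+\tilde P^a_R\wedge\tilde J^L_a$, where the subscript or superscript $R$ denotes $\frac{d}{dt}|_0\varphi(h\cdot e^{tZ})$ and $L$ denotes $\frac{d}{dt}|_0\varphi(e^{-tZ}\cdot h)$, for $Z=P^a$ or $Z=J_a$ in the Lie algebra of $H$, and $X\wedge Y=X\otimes Y-Y\otimes X$. The cotangent bundle $T^*G\cong G\times\mathfrak g^*$ carries the bracket $\{k_a,k_b\}=-f_{ab}{}^ck_c$, $\{F,F'\}=0$, with $\{k_a,F\}(w)=-\frac{d}{dt}|_0F(we^{tJ_a})$ for the copies $(w_{1,i},k^{1,i})$ and $\{k_a,F\}(w)=-\frac{d}{dt}|_0F(e^{-tJ_a}w)$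 for the copies $(w_{2,i},k^{2,i})$. Then: 1. The pull-back $(L\circ\kappa)^*=K\circ L^*$ is a bijection of $\mathcal F$ onto $\mathcal F$, elements of $\mathcal F$ are smooth, and for all smooth $f,h$ on $H^{n+2g}$ (in particular all $f,h\in\mathcal F$), $\{f\circ L\circ\kappa,\,h\circ L\circ\kappa\}=\{f,h\}_{\oplus}\circ L\circ\kappa$, where the left-hand bracket is that of the flower algebra and $\{\,,\}_\oplus$ is the direct sum of $n$ copies of the bracket of $H^*$ and $2g$ copies of that of $T^*G$. 2. The symplectic leaves of $(H^*)^n\times(T^*G)^{2g}$ (the sets of points that can be joined to a given point by finitely many trajectories of Hamiltonian vector fields $X_f=\{f,\cdot\}_\oplus$, $f$ smooth) are exactly the sets $\mathcal C_1\times\dots\times\mathcal C_n\times H^{2g}$ with $\mathcal C_i$ conjugacy classes of $H$. 3. There is a well-defined non-degenerate form $\omega$ (the symplectic structure) on the tangent spaces of the leaves with $\omega(X_f,\cdot)=df$, i.e. $\omega(X_f,X_h)=\{h,f\}_\oplus$. For all $g_{\mu_i}\in G$, $s_i\in\mathfrak g^*$, let $\mathcal C_{\mu_is_i}$ be the conjugacy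 class of $(g_{\mu_i},-s_i)$ and $\mathrm{conj}_{\mu_is_i}(v,x)=(v,x)(g_{\mu_i},-s_i)(v,x)^{-1}$. The map $\Phi=\mathrm{conj}_{\mu_1s_1}\times\dots\times\mathrm{conj}_{\mu_ns_n}\times\mathrm{id}^{2g}$ on $H^{n+2g}$ is smooth, its image is $\mathcal C_{\mu_1s_1}\times\dots\times\mathcal C_{\mu_ns_n}\times H^{2g}$, its differential at each point maps onto the tangent space of the leaf (the space of Hamiltonian vectors), and $\Phi^*\omega=d\Theta$ with $$\Theta=-\sum_{i=1}^n\langle dv_{M_i}v_{M_i}^{-1},\,j^{M_i'}\rangle+\sum_{i=1}^g\Big(\langle w_{1,i}^{-1}dw_{1,i},\,k^{1,i}\rangle-\langle dw_{2,i}w_{2,i}^{-1},\,k^{2,i}\rangle\Big),$$ where $j^{M_i'}\in\mathfrak g^*$ is the parameter of $\mathrm{conj}_{\mu_is_i}(v_{M_i},x_{M_i})=(u,-\mathrm{Ad}^*(u^{-1})j^{M_i'})$. -/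

import Mathlib

open Set
open scoped Manifold ContDiff

noncomputable section

namespace Flower

/-! ### Poisson geometry on a manifold with a bracket of functions -/

section General

variable {EM : Type*} [NormedAddCommGroup EM] [NormedSpace ℝ EM]
  {HM : Type*} [TopologicalSpace HM] (I : ModelWithCorners ℝ EM HM)
  {M : Type*} [TopologicalSpace M] [ChartedSpace HM M]

/-- `X` is the value at `p` of the Hamiltonian vector field `X_f = {f, ·}`. -/
def IsHamiltonianAt (br : (M → ℝ) → (M → ℝ) → M → ℝ) (f : M → ℝ) (p : M)
    (X : TangentSpace I p) : Prop :=
  ∀ h : M → ℝ, ContMDiff I 𝓘(ℝ, ℝ) ∞ h → (mfderiv I 𝓘(ℝ, ℝ) h p X : ℝ) = br f h p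

/-- `q` is reached from `p` along a trajectory of the Hamiltonian vector field of a smooth
function. -/
def HamiltonianStep (br : (M → ℝ) → (M → ℝ) → M → ℝ) (p q : M) : Prop :=
  ∃ f : M → ℝ, ContMDiff I 𝓘(ℝ, ℝ) ∞ f ∧
    ∃ V : (x : M) → TangentSpace I x, (∀ x, IsHamiltonianAt I br f x (V x)) ∧
      ∃ (γ : ℝ → M) (T : ℝ), 0 ≤ T ∧ IsMIntegralCurveOn (I := I) γ V (Icc 0 T) ∧
        γ 0 = p ∧ γ T = q

/-- A symplectic leaf: all points that can be joined to a given point by a piecewise smooth curve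
each segment of which is a trajectory of a Hamiltonian vector field. -/
def IsSymplecticLeaf (br : (M → ℝ) → (M → ℝ) → M → ℝ) (S : Set M) : Prop :=
  ∃ p : M, S = {q | Relation.ReflTransGen (HamiltonianStep I br) p q}

/-- The tangent space at `q` of the symplectic leaf through `q`: the values at `q` of the
Hamiltonian vector fields. -/
def leafTangent (br : (M → ℝ) → (M → ℝ) → M → ℝ) (q : M) : Set (TangentSpace I q) :=
  {X | ∃ f : M → ℝ, ContMDiff I 𝓘(ℝ, ℝ) ∞ f ∧ IsHamiltonianAt I br f q X}

/-- `σ` is the symplectic structure of the leaves: on Hamiltonian vectors,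
`σ(X_f, ·) = df`, that is `σ(X_f, X_h) = X_h f = {h, f}`, and it is non-degenerate. -/
def IsLeafwiseSymplecticForm (br : (M → ℝ) → (M → ℝ) → M → ℝ)
    (σ : (q : M) → TangentSpace I q → TangentSpace I q → ℝ) : Prop :=
  (∀ (q : M) (f h : M → ℝ), ContMDiff I 𝓘(ℝ, ℝ) ∞ f → ContMDiff I 𝓘(ℝ, ℝ) ∞ h →
    ∀ X Y : TangentSpace I q, IsHamiltonianAt I br f q X → IsHamiltonianAt I br h q Y →
      σ q X Y = br h f q) ∧
  ∀ (q : M), ∀ X ∈ leafTangent I br q, (∀ Y ∈ leafTangent I br q, σ q X Y = 0) → X = 0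

/-- The exterior derivative of a one-form on a manifold without boundary, computed in the
preferred chart at `p`: `(dΘ)_p(v, w)`. -/
def extDerivOneForm (Θ : (p : M) → (TangentSpace I p →L[ℝ] ℝ)) (p : M)
    (v w : TangentSpace I p) : ℝ :=
  extDeriv (𝕜 := ℝ) (E := EM) (F := ℝ) (n := 1)
    (fun y : EM =>
      ContinuousAlternatingMap.ofSubsingleton ℝ EM ℝ (0 : Fin 1)
        ((Θ ((extChartAt I p).symm y)).comp (mfderiv 𝓘(ℝ, EM) I (extChartAt I p).symm y)))
    (extChartAt I p p)
    ![mfderiv I 𝓘(ℝ, EM) (extChartAt I p) p v, mfderiv I 𝓘(ℝ, EM) (extChartAt I p) p w]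

end General

/-! ### The group `H = G ⋉ 𝔤*` -/

section Group

variable {E : Type*} [NormedAddCommGroup E] [NormedSpace ℝ E]
  {G : Type*} [TopologicalSpace G] [ChartedSpace E G] [Group G]

variable (G) in
/-- The bracket of the Lie algebra `𝔤 = T₁G`; its underlying vector space is `E`. -/
def lieBr (ξ η : E) : E :=
  let ξ' : GroupLieAlgebra 𝓘(ℝ, E) G := ξ
  let η' : GroupLieAlgebra 𝓘(ℝ, E) G := η
  (⁅ξ', η'⁆ : GroupLieAlgebra 𝓘(ℝ, E) G)

/-- `Ad(u)`, the derivative at `1` of `v ↦ u v u⁻¹`. -/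
def Ad (u : G) : E →L[ℝ] E :=
  (mfderiv 𝓘(ℝ, E) 𝓘(ℝ, E) (fun v : G => u * v * u⁻¹) 1 :)

/-- `Ad*(u)`, the algebraic dual of `Ad(u)`: `⟨Ad*(u) j, ξ⟩ = ⟨j, Ad(u) ξ⟩`. -/
def coAd (u : G) (j : E →L[ℝ] ℝ) : E →L[ℝ] ℝ := j.comp (Ad u)

lemma coAd_add (u : G) (j k : E →L[ℝ] ℝ) : coAd u (j + k) = coAd u j + coAd u k := by
  simp [coAd, ContinuousLinearMap.add_comp]

lemma Ad_one : Ad (1 : G) = ContinuousLinearMap.id ℝ E := by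
  unfold Ad
  have h : (fun v : G => (1 : G) * v * 1⁻¹) = id := by ext; simp
  rw [h]
  exact mfderiv_id

lemma coAd_one (j : E →L[ℝ] ℝ) : coAd (1 : G) j = j := by
  simp only [coAd, Ad_one]; rfl

variable [LieGroup 𝓘(ℝ, E) ∞ G]

lemma Ad_mul (u v : G) : Ad (u * v) = (Ad u).comp (Ad v : E →L[ℝ] E) := by
  have hd : ∀ (a x : G), MDifferentiableAt 𝓘(ℝ, E) 𝓘(ℝ, E) (fun v : G => a * v * a⁻¹) x := by
    intro a x
    have : ContMDiff 𝓘(ℝ, E) 𝓘(ℝ, E) ∞ (fun v : G => a * v * a⁻¹) :=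
      (contMDiff_const.mul contMDiff_id).mul contMDiff_const
    exact this.mdifferentiableAt (by simp)
  have hc : (fun x : G => u * v * x * (u * v)⁻¹)
      = (fun x : G => u * x * u⁻¹) ∘ (fun x : G => v * x * v⁻¹) := by
    ext x; simp [mul_assoc]
  have h1 : v * 1 * v⁻¹ = (1 : G) := by simp
  have := mfderiv_comp (I := 𝓘(ℝ, E)) (I' := 𝓘(ℝ, E)) (I'' := 𝓘(ℝ, E)) (1 : G)
    (g := fun x : G => u * x * u⁻¹) (f := fun x : G => v * x * v⁻¹) (hd u _) (hd v 1)
  have key : ∀ y : G, y = 1 →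
      (mfderiv 𝓘(ℝ, E) 𝓘(ℝ, E) (fun x : G => u * x * u⁻¹) y : E →L[ℝ] E)
        = (mfderiv 𝓘(ℝ, E) 𝓘(ℝ, E) (fun x : G => u * x * u⁻¹) 1 : E →L[ℝ] E) := by
    rintro y rfl; rfl
  unfold Ad
  rw [hc]
  refine this.trans ?_
  exact congrArg (fun A : E →L[ℝ] E =>
    A.comp (mfderiv 𝓘(ℝ, E) 𝓘(ℝ, E) (fun x : G => v * x * v⁻¹) 1 : E →L[ℝ] E)) (key _ h1)

lemma coAd_mul (u v : G) (j : E →L[ℝ] ℝ) : coAd (u * v) j = coAd v (coAd u j) := by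
  simp only [coAd, Ad_mul]; rfl

variable (E G) in
/-- The action of `G` on the abelian group `𝔤*` by `u ↦ Ad*(u⁻¹)`. -/
def coadjointAction : G →* MulAut (Multiplicative (E →L[ℝ] ℝ)) where
  toFun u := AddEquiv.toMultiplicative
    { toFun := fun j => coAd u⁻¹ j
      invFun := fun j => coAd u j
      left_inv := fun j => by simp only [← coAd_mul]; simp [coAd_one]
      right_inv := fun j => by simp only [← coAd_mul]; simp [coAd_one]
      map_add' := fun j k => coAd_add _ j k }
  map_one' := MulEquiv.ext fun j => Multiplicative.toAdd.injective (by
    change coAd (1 : G)⁻¹ (Multiplicative.toAdd j) = Multiplicative.toAdd j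
    rw [inv_one, coAd_one])
  map_mul' u v := MulEquiv.ext fun j => Multiplicative.toAdd.injective (by
    change coAd (u * v)⁻¹ (Multiplicative.toAdd j) = coAd u⁻¹ (coAd v⁻¹ (Multiplicative.toAdd j))
    rw [mul_inv_rev, coAd_mul])

variable (E G) in
/-- The group `H = G ⋉ 𝔤*`, with
`(u₁, a₁) (u₂, a₂) = (u₁ u₂, a₁ + Ad*(u₁⁻¹) a₂)`. -/
abbrev SemiH : Type _ :=
  SemidirectProduct (Multiplicative (E →L[ℝ] ℝ)) G (coadjointAction E G)

/-- The element `(u, a)` of `H`. -/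
def mkH (u : G) (a : E →L[ℝ] ℝ) : SemiH E G := ⟨Multiplicative.ofAdd a, u⟩

/-- The parametrisation `(u, j) ↦ (u, -Ad*(u⁻¹) j)` of `H` by `G × 𝔤*`. -/
def toH (z : G × (E →L[ℝ] ℝ)) : SemiH E G := mkH z.1 (-coAd z.1⁻¹ z.2)

/-- The inverse of the parametrisation `toH`: `(u, a) ↦ (u, -Ad*(u) a)`. -/
def ofH (h : SemiH E G) : G × (E →L[ℝ] ℝ) :=
  (h.right, -coAd h.right (Multiplicative.toAdd h.left))

end Group

/-! ### Derivatives of functions on `G × 𝔤*`, and the Poisson structures of `H*` and `T*G` -/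

section Factor

variable {E : Type*} [NormedAddCommGroup E] [NormedSpace ℝ E] [FiniteDimensional ℝ E]
  {G : Type*} [TopologicalSpace G] [ChartedSpace E G] [Group G]
  {ι : Type*} [Fintype ι] (J : Module.Basis ι ℝ E)

/-- The dual basis `P^a` of `𝔤*`. -/
def dualP (a : ι) : E →L[ℝ] ℝ := LinearMap.toContinuousLinearMap (J.coord a)

/-- `J^R_ξ φ (u, j) = d/dt φ(u e^{tξ}, j)` at `t = 0`. -/
def rightD (ξ : E) (φ : G × (E →L[ℝ] ℝ) → ℝ) (z : G × (E →L[ℝ] ℝ)) : ℝ :=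
  (mfderiv 𝓘(ℝ, E) 𝓘(ℝ, ℝ) (fun v : G => φ (z.1 * v, z.2)) 1 : E →L[ℝ] ℝ) ξ

/-- `J^L_ξ φ (u, j) = d/dt φ(e^{-tξ} u, j)` at `t = 0`. -/
def leftD (ξ : E) (φ : G × (E →L[ℝ] ℝ) → ℝ) (z : G × (E →L[ℝ] ℝ)) : ℝ :=
  (mfderiv 𝓘(ℝ, E) 𝓘(ℝ, ℝ) (fun v : G => φ (v⁻¹ * z.1, z.2)) 1 : E →L[ℝ] ℝ) ξ

/-- The fibre gradient `∑ₐ (∂φ/∂jₐ) Jₐ`, an element of `𝔤`. -/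
def fibGrad (φ : G × (E →L[ℝ] ℝ) → ℝ) (z : G × (E →L[ℝ] ℝ)) : E :=
  ∑ a, (fderiv ℝ (fun j : E →L[ℝ] ℝ => φ (z.1, j)) z.2 (dualP J a)) • J a

/-- The bracket of `T*G`, trivialised by right multiplication:
`{kₐ, k_b} = -f_{ab}^c k_c`, `{kₐ, F}(w) = -d/dt F(w e^{tJₐ})`, `{F, F'} = 0`. -/
def cotangentBracketR (φ ψ : G × (E →L[ℝ] ℝ) → ℝ) (z : G × (E →L[ℝ] ℝ)) : ℝ :=
  -z.2 (lieBr G (fibGrad J φ z) (fibGrad J ψ z))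
    - rightD (fibGrad J φ z) ψ z + rightD (fibGrad J ψ z) φ z

/-- The bracket of `T*G`, trivialised by left multiplication:
`{kₐ, k_b} = -f_{ab}^c k_c`, `{kₐ, F}(w) = -d/dt F(e^{-tJₐ} w)`, `{F, F'} = 0`. -/
def cotangentBracketL (φ ψ : G × (E →L[ℝ] ℝ) → ℝ) (z : G × (E →L[ℝ] ℝ)) : ℝ :=
  -z.2 (lieBr G (fibGrad J φ z) (fibGrad J ψ z))
    - leftD (fibGrad J φ z) ψ z + leftD (fibGrad J ψ z) φ z

variable [LieGroup 𝓘(ℝ, E) ∞ G]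

/-- The vector field of `α ∈ 𝔤*` on `H` generated by right multiplication:
`d/dt φ(h · tα)`, in the parametrisation `toH`. -/
def vecPR (α : E →L[ℝ] ℝ) (φ : G × (E →L[ℝ] ℝ) → ℝ) (z : G × (E →L[ℝ] ℝ)) : ℝ :=
  deriv (fun t : ℝ => φ (ofH (toH z * mkH 1 (t • α)))) 0

/-- `d/dt φ(-tα · h)`. -/
def vecPL (α : E →L[ℝ] ℝ) (φ : G × (E →L[ℝ] ℝ) → ℝ) (z : G × (E →L[ℝ] ℝ)) : ℝ :=
  deriv (fun t : ℝ => φ (ofH (mkH 1 (-(t • α)) * toH z))) 0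

/-- `d/dt φ(h · e^{tξ})`. -/
def vecJR (ξ : E) (φ : G × (E →L[ℝ] ℝ) → ℝ) (z : G × (E →L[ℝ] ℝ)) : ℝ :=
  (mfderiv 𝓘(ℝ, E) 𝓘(ℝ, ℝ) (fun v : G => φ (ofH (toH z * mkH v 0))) 1 : E →L[ℝ] ℝ) ξ

/-- `d/dt φ(e^{-tξ} · h)`. -/
def vecJL (ξ : E) (φ : G × (E →L[ℝ] ℝ) → ℝ) (z : G × (E →L[ℝ] ℝ)) : ℝ :=
  (mfderiv 𝓘(ℝ, E) 𝓘(ℝ, ℝ) (fun v : G => φ (ofH (mkH v⁻¹ 0 * toH z))) 1 : E →L[ℝ] ℝ) ξ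

/-- The bracket of the dual Poisson-Lie group `H*`, on `H` in the parametrisation `toH`, given by
the bivector `½ (P_L^a ∧ J^L_a + P_R^a ∧ J^R_a) + P_R^a ∧ J^L_a`. -/
def dualBracket (φ ψ : G × (E →L[ℝ] ℝ) → ℝ) (z : G × (E →L[ℝ] ℝ)) : ℝ :=
  ∑ a, ((1 / 2 : ℝ) *
      ((vecPL (dualP J a) φ z * vecJL (J a) ψ z - vecJL (J a) φ z * vecPL (dualP J a) ψ z)
        + (vecPR (dualP J a) φ z * vecJR (J a) ψ z - vecJR (J a) φ z * vecPR (dualP J a) ψ z))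
    + (vecPR (dualP J a) φ z * vecJL (J a) ψ z - vecJL (J a) φ z * vecPR (dualP J a) ψ z))

end Factor

/-! ### The phase space `H^{n+2g}` and the flower algebra -/

/-- The labels `M₁, …, M_n, A₁, …, A_g, B₁, …, B_g`. -/
abbrev Loop (n g : ℕ) : Type := Fin n ⊕ (Fin g ⊕ Fin g)

/-- The label `M_i`. -/
abbrev lM {n g : ℕ} (i : Fin n) : Loop n g := Sum.inl i

/-- The label `A_i`; after the full decoupling it labels the first copy of `T*G` of a handle. -/
abbrev lA {n g : ℕ} (i : Fin g) : Loop n g := Sum.inr (Sum.inl i)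

/-- The label `B_i`; after the full decoupling it labels the second copy of `T*G` of a handle. -/
abbrev lB {n g : ℕ} (i : Fin g) : Loop n g := Sum.inr (Sum.inr i)

/-- `M₁ < … < M_n < A₁, B₁ < … < A_g, B_g` is comparison of ranks. -/
def rank {n g : ℕ} : Loop n g → ℕ
  | Sum.inl i => i.val
  | Sum.inr (Sum.inl i) => n + i.val
  | Sum.inr (Sum.inr i) => n + i.val

/-- `H^{n+2g}`, each factor parametrised by `(u, j) ∈ G × 𝔤*`. -/
abbrev Phase (E G : Type*) [NormedAddCommGroup E] [NormedSpace ℝ E] (n g : ℕ) : Type _ :=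
  Loop n g → G × (E →L[ℝ] ℝ)

/-- The model with corners of `H^{n+2g}`. -/
abbrev phaseModel (E : Type*) [NormedAddCommGroup E] [NormedSpace ℝ E] (n g : ℕ) :=
  ModelWithCorners.pi (fun _ : Loop n g => (𝓘(ℝ, E)).prod 𝓘(ℝ, E →L[ℝ] ℝ))

section PhaseSpace

variable {E : Type*} [NormedAddCommGroup E] [NormedSpace ℝ E] [FiniteDimensional ℝ E]
  {G : Type*} [TopologicalSpace G] [ChartedSpace E G] [Group G]
  {ι : Type*} [Fintype ι] (J : Module.Basis ι ℝ E) {n g : ℕ}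

variable (E G n g) in
/-- The flower algebra `S(⊕ 𝔤) ⊗ C^∞(G^{n+2g})` as an algebra of functions on `H^{n+2g}`: it is
generated by the maps `j_ξ^X` and by the smooth functions of the `G`-components. -/
def flowerAlgebra : Subalgebra ℝ (Phase E G n g → ℝ) :=
  Algebra.adjoin ℝ
    ({f | ∃ (X : Loop n g) (ξ : E), f = fun p => (p X).2 ξ} ∪
     {f | ∃ F : (Loop n g → G) → ℝ,
        ContMDiff (ModelWithCorners.pi fun _ : Loop n g => 𝓘(ℝ, E)) 𝓘(ℝ, ℝ) ∞ F ∧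
        f = fun p => F (fun X => (p X).1)})

/-- `f` as a function of the factor `X`, the other factors being those of `p`. -/
def slice (f : Phase E G n g → ℝ) (p : Phase E G n g) (X : Loop n g) :
    G × (E →L[ℝ] ℝ) → ℝ :=
  fun z => f (Function.update p X z)

/-- The fibre gradient of `f` in the factor `X`. -/
def gradAt (f : Phase E G n g → ℝ) (p : Phase E G n g) (X : Loop n g) : E :=
  fibGrad J (slice f p X) (p X)

/-- `J_ξ^{R_X} f` at `p`, acting on the `G`-component of the factor `X`. -/
def rightDAt (X : Loop n g) (ξ : E) (f : Phase E G n g → ℝ) (p : Phase E G n g) : ℝ :=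
  rightD ξ (slice f p X) (p X)

/-- `J_ξ^{L_X} f` at `p`. -/
def leftDAt (X : Loop n g) (ξ : E) (f : Phase E G n g → ℝ) (p : Phase E G n g) : ℝ :=
  leftD ξ (slice f p X) (p X)

/-- `∑_{Y > X} (J_η^{R_Y} + J_η^{L_Y}) F` with `η = (1 - Ad(u_X)) ξ`. -/
def tailD (X : Loop n g) (ξ : E) (F : Phase E G n g → ℝ) (p : Phase E G n g) : ℝ :=
  ∑ Y : Loop n g, if rank X < rank Y then
    rightDAt Y (ξ - Ad (p X).1 ξ) F p + leftDAt Y (ξ - Ad (p X).1 ξ) F p else 0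

/-- The bracket `{j_ξ^X ⊗ 1, 1 ⊗ F}` of the flower algebra. -/
def flowerAction : Loop n g → E → (Phase E G n g → ℝ) → Phase E G n g → ℝ
  | Sum.inl i, ξ, F, p =>
      -(rightDAt (lM i) ξ F p + leftDAt (lM i) ξ F p) - tailD (lM i) ξ F p
  | Sum.inr (Sum.inl i), ξ, F, p =>
      -(rightDAt (lA i) ξ F p + leftDAt (lA i) ξ F p)
        - (rightDAt (lB i) ξ F p + leftDAt (lB i) ξ F p)
        - rightDAt (lB i) (Ad ((p (lB i)).1⁻¹ * (p (lA i)).1) ξ) F p - tailD (lA i) ξ F p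
  | Sum.inr (Sum.inr i), ξ, F, p =>
      -leftDAt (lA i) ξ F p - (rightDAt (lB i) ξ F p + leftDAt (lB i) ξ F p)
        - tailD (lB i) ξ F p

/-- The bracket `{j_ξ^X ⊗ 1, j_η^Y ⊗ 1}` for `X < Y`. -/
def flowerCross (X Y : Loop n g) (ξ η : E) (p : Phase E G n g) : ℝ :=
  -(p Y).2 (lieBr G (ξ - Ad (p X).1 ξ) η)

/-- The Poisson bracket of the flower algebra, extended as a biderivation to all smooth functions
on `H^{n+2g}`. On generators, with `j_ξ^X = ⟨j_X, ξ⟩`, it reads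
`{j_ξ^X, j_η^X} = -j_{[ξ,η]}^X`, `{j_ξ^X, j_η^Y} = -j^Y_{[(1 - Ad(u_X)) ξ, η]}` for `X < Y`,
`{j_ξ^{A_i}, j_η^{B_i}} = -j_{[ξ,η]}^{B_i}`, `{j_ξ^X, F} = flowerAction X ξ F`, `{F, F'} = 0`. -/
def flowerBracket (f h : Phase E G n g → ℝ) (p : Phase E G n g) : ℝ :=
  (∑ X : Loop n g, -(p X).2 (lieBr G (gradAt J f p X) (gradAt J h p X)))
  + (∑ X : Loop n g, ∑ Y : Loop n g, if rank X < rank Y then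
      flowerCross X Y (gradAt J f p X) (gradAt J h p Y) p
        - flowerCross X Y (gradAt J h p X) (gradAt J f p Y) p else 0)
  + (∑ i : Fin g,
      (-(p (lB i)).2 (lieBr G (gradAt J f p (lA i)) (gradAt J h p (lB i)))
        + (p (lB i)).2 (lieBr G (gradAt J h p (lA i)) (gradAt J f p (lB i)))))
  + (∑ X : Loop n g,
      (flowerAction X (gradAt J f p X) h p - flowerAction X (gradAt J h p X) f p))

/-! ### The decoupling transformations -/

/-- The product `u_{hi-1} ⋯ u_{lo+1} u_{lo}`, in decreasing order of the (0-based) indices. -/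
def descProd {m : ℕ} (u : Fin m → G) (lo hi : ℕ) : G :=
  ((((List.finRange m).filter fun k => decide (lo ≤ k.val ∧ k.val < hi)).reverse).map u).prod

/-- `u_{M_i}`. -/
def uM (p : Phase E G n g) (i : Fin n) : G := (p (lM i)).1

/-- `u_{K_i} = u_{B_i} u_{A_i}⁻¹ u_{B_i}⁻¹ u_{A_i}`. -/
def uK (p : Phase E G n g) (i : Fin g) : G :=
  (p (lB i)).1 * (p (lA i)).1⁻¹ * (p (lB i)).1⁻¹ * (p (lA i)).1

/-- `j^{H_i} = (1 - Ad*(a⁻¹ b⁻¹ a)) j^{A_i} + (Ad*(a⁻¹ b⁻¹ a) - Ad*(b⁻¹ a)) j^{B_i}` with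
`a = u_{A_i}`, `b = u_{B_i}`. -/
def jH (p : Phase E G n g) (i : Fin g) : E →L[ℝ] ℝ :=
  let a := (p (lA i)).1
  let b := (p (lB i)).1
  ((p (lA i)).2 - coAd (a⁻¹ * b⁻¹ * a) (p (lA i)).2)
    + (coAd (a⁻¹ * b⁻¹ * a) (p (lB i)).2 - coAd (b⁻¹ * a) (p (lB i)).2)

/-- `∑_{k>i} Ad*(u_{M_{k-1}} ⋯ u_{M_{i+1}}) j^{M_k}
 + ∑_{k=1}^g Ad*(u_{K_{k-1}} ⋯ u_{K_1} u_{M_n} ⋯ u_{M_{i+1}}) j^{H_k}`. -/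
def tailM (p : Phase E G n g) (i : Fin n) : E →L[ℝ] ℝ :=
  (∑ k : Fin n, if i < k then coAd (descProd (uM p) (i.val + 1) k.val) (p (lM k)).2 else 0)
    + ∑ k : Fin g, coAd (descProd (uK p) 0 k.val * descProd (uM p) (i.val + 1) n) (jH p k)

/-- `∑_{k>i} Ad*(u_{K_{k-1}} ⋯ u_{K_{i+1}}) j^{H_k}`. -/
def tailK (p : Phase E G n g) (i : Fin g) : E →L[ℝ] ℝ :=
  ∑ k : Fin g, if i < k then coAd (descProd (uK p) (i.val + 1) k.val) (jH p k) else 0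

/-- The map `H^{n+2g} → H^{n+2g}`, `(u_X, j^X) ↦ (u_X, j^{X'})`, whose pull-back is the decoupling
transformation `K`. -/
def decouplingMap (p : Phase E G n g) : Phase E G n g
  | Sum.inl i =>
      ((p (lM i)).1, (p (lM i)).2 - (tailM p i - coAd (p (lM i)).1 (tailM p i)))
  | Sum.inr (Sum.inl i) =>
      let a := (p (lA i)).1
      let b := (p (lB i)).1
      (a, (p (lA i)).2 + coAd a⁻¹ ((p (lA i)).2 - (p (lB i)).2)
        + (coAd a (tailK p i) - coAd (b * a⁻¹) (tailK p i)))
  | Sum.inr (Sum.inr i) =>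
      let a := (p (lA i)).1
      let b := (p (lB i)).1
      (b, (p (lB i)).2 + coAd a⁻¹ ((p (lA i)).2 - (p (lB i)).2)
        + (coAd b (tailK p i) - coAd (b * a⁻¹) (tailK p i)))

/-- The map `L : H^{n+2g} → H^{n+2g}`: on each handle
`(w₁, w₂) = (u_A, u_B⁻¹ u_A)`, `(k₁, k₂) = (j_A - j_B, j_B)`, and the identity on the
punctures. -/
def handleMap (p : Phase E G n g) : Phase E G n g
  | Sum.inl i => p (lM i)
  | Sum.inr (Sum.inl i) => ((p (lA i)).1, (p (lA i)).2 - (p (lB i)).2)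
  | Sum.inr (Sum.inr i) => ((p (lB i)).1⁻¹ * (p (lA i)).1, (p (lB i)).2)

/-! ### The decoupled Poisson structure and its leaves -/

variable [LieGroup 𝓘(ℝ, E) ∞ G]

/-- The direct sum of `n` copies of `H*` and `2g` copies of `T*G`. -/
def decoupledBracket (f h : Phase E G n g → ℝ) (p : Phase E G n g) : ℝ :=
  (∑ i : Fin n, dualBracket J (slice f p (lM i)) (slice h p (lM i)) (p (lM i)))
  + (∑ i : Fin g, (cotangentBracketR J (slice f p (lA i)) (slice h p (lA i)) (p (lA i))
      + cotangentBracketL J (slice f p (lB i)) (slice h p (lB i)) (p (lB i))))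

/-- `C₁ × … × C_n × H^{2g}`. -/
def conjProduct (C : Fin n → ConjClasses (SemiH E G)) : Set (Phase E G n g) :=
  {q | ∀ i : Fin n, toH (q (lM i)) ∈ (C i).carrier}

/-- The map `conj_{μ₁ s₁} × … × conj_{μ_n s_n} × id^{2g}`, where
`conj_{μ s}(v, x) = (v, x) (g_μ, -s) (v, x)⁻¹`; the `i`-th puncture factor of the argument is the
element `(v, x)` of `H` itself. -/
def conjMap (gμ : Fin n → G) (s : Fin n → (E →L[ℝ] ℝ)) (p : Phase E G n g) : Phase E G n g
  | Sum.inl i =>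
      ofH (mkH (p (lM i)).1 (p (lM i)).2 * mkH (gμ i) (-s i)
        * (mkH (p (lM i)).1 (p (lM i)).2)⁻¹)
  | Sum.inr X => p (Sum.inr X)

/-- The one-form `dv v⁻¹` at `p`, with values in `𝔤`, for the `G`-component `v` of the
factor `X`. -/
def rightMC (X : Loop n g) (p : Phase E G n g) :
    TangentSpace (phaseModel E n g) p →L[ℝ] E :=
  (mfderiv (phaseModel E n g) 𝓘(ℝ, E) (fun q : Phase E G n g => (q X).1 * (p X).1⁻¹) p :)

/-- The one-form `v⁻¹ dv` at `p`. -/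
def leftMC (X : Loop n g) (p : Phase E G n g) :
    TangentSpace (phaseModel E n g) p →L[ℝ] E :=
  (mfderiv (phaseModel E n g) 𝓘(ℝ, E) (fun q : Phase E G n g => (p X).1⁻¹ * (q X).1) p :)

/-- The symplectic potential
`Θ = -∑ᵢ ⟨dv_{M_i} v_{M_i}⁻¹, j^{M_i'}⟩ + ∑ᵢ (⟨w₁⁻¹ dw₁, k₁⟩ - ⟨dw₂ w₂⁻¹, k₂⟩)`, where `j^{M_i'}`
is the `𝔤*`-component of `conj_{μ_i s_i}(v_{M_i}, x_{M_i})`. -/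
def symplecticPotential (gμ : Fin n → G) (s : Fin n → (E →L[ℝ] ℝ)) (p : Phase E G n g) :
    TangentSpace (phaseModel E n g) p →L[ℝ] ℝ :=
  -(∑ i : Fin n, ((conjMap gμ s p (lM i)).2).comp (rightMC (lM i) p))
    + ∑ i : Fin g, (((p (lA i)).2).comp (leftMC (lA i) p) - ((p (lB i)).2).comp (rightMC (lB i) p))

end PhaseSpace

end Flower

end

open Flower

section

open Filter

open scoped Topology

set_option linter.unusedSectionVars false
set_option linter.style.haveILetI false
set_option linter.unusedSimpArgs false

noncomputable section

/-! All geometry is trivialised by left translation: a tangent vector of `H^{n+2g}` is a family in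
`E × (E →L[ℝ] ℝ)`, a covector a family in the dual. Each bracket is then the pairing of one
differential with the contraction of the other by a bivector, `flowerSharp` for the flower algebra
(`flowerBracket_eq`) and `decSharp` for the direct sum (`decoupledBracket_eq`), so being a Poisson
map becomes pointwise linear algebra.

The flower bivector is block diagonal, with one block `locSharp` per puncture or handle, up to a
coupling over pairs X < Y: the vector `(1 - Ad(u_X)) γ_X` of the earlier factor is fed into the
infinitesimal action of `G` on the later factor. A handle, with holonomy `u_K` and momentum `j^H`,
behaves in this respect like a puncture (`exists_isBlock_handle`). The momenta of all blocks later
than X, transported by the holonomies and added, form a momentum map `mom` for the diagonal action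
on those blocks (`exists_isMom`, by induction on their number). Therefore subtracting `(1 -
Ad*(u_X)) mom` from `j^X` cancels the coupling exactly (`flowerSharp_untail_single`). What remains
on a handle is turned into two cotangent bundles by the explicit map `splitHandles`, and
`handleMap_decouplingMap` shows that `L ∘ κ` is `splitHandles ∘ untail`. Both maps are triangular,
with inverses of the same polynomial type, which gives the bijection of the flower algebra.

Leaves: the functions `j_ξ^X` move a factor by conjugation, or by right or left multiplication,
along curves with logarithmic derivative `ξ`; such curves fill a neighbourhood of `1`, hence
generate the connected group `G`. Functions of `u_X` shift the fibre. Together these moves sweep out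
a whole conjugacy class of `H` on a puncture and everything on a handle (`reach_of_sameLeaf`).
Conversely, along a Hamiltonian trajectory the `G`-component of a puncture becomes constant after
conjugation by the solution of a linear equation, and its momentum then moves inside the image of `1
- Ad*(u⁻¹)`, that is, by conjugations with elements of `𝔤*` (`isConj_of_twisted_curve`).

Symplectic form: it pairs the contractions of `a` and `b` to `⟨a, b♯⟩`, which is well defined by
antisymmetry. The differential of `conjMap` sends a vector to the contraction of the explicit
covector `leafCov`, and every covector arises this way. The form pulled back by `conjMap` is thus a
sum over factors, matched term by term with the differential of the potential; the latter comes from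
the Maurer-Cartan equation through `curl_clm_comp`. -/

namespace Flower

/-! ### The chart at the identity and the calculus of logarithmic derivatives. -/

section LieCalculus

variable {E : Type*} [NormedAddCommGroup E] [NormedSpace ℝ E]
  {G : Type*} [TopologicalSpace G] [ChartedSpace E G] [Group G]
  {N : Type*} [NormedAddCommGroup N] [NormedSpace ℝ N]
  {W : Type*} [NormedAddCommGroup W] [NormedSpace ℝ W]

/-! ### The chart at the identity -/

variable (G) in
/-- The inverse of the preferred chart at `1`, recentred so that `expC 0 = 1`. -/
def expC (x : E) : G := (extChartAt 𝓘(ℝ, E) (1 : G)).symm (extChartAt 𝓘(ℝ, E) (1 : G) 1 + x)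

/-- The preferred chart at `1`, recentred so that `logC 1 = 0`. -/
def logC (v : G) : E := extChartAt 𝓘(ℝ, E) (1 : G) v - extChartAt 𝓘(ℝ, E) (1 : G) 1

@[simp] lemma logC_one : logC (1 : G) = (0 : E) := by simp [logC]

@[simp] lemma expC_zero : expC G (0 : E) = 1 := by simp [expC]

lemma eventually_expC_logC : ∀ᶠ v in 𝓝 (1 : G), expC G (logC v : E) = v := by
  filter_upwards [extChartAt_source_mem_nhds (I := 𝓘(ℝ, E)) (1 : G)] with v hv
  simp only [expC, logC, add_sub_cancel]
  exact (extChartAt 𝓘(ℝ, E) (1 : G)).left_inv hv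

lemma tendsto_expC_base :
    Tendsto (fun x : E => extChartAt 𝓘(ℝ, E) (1 : G) 1 + x) (𝓝 0)
      (𝓝 (extChartAt 𝓘(ℝ, E) (1 : G) 1)) := by
  have : Continuous (fun x : E => extChartAt 𝓘(ℝ, E) (1 : G) 1 + x) := by fun_prop
  simpa using this.tendsto 0

lemma eventually_logC_expC : ∀ᶠ x in 𝓝 (0 : E), logC (expC G x) = x := by
  filter_upwards [tendsto_expC_base (G := G) (extChartAt_target_mem_nhds (I := 𝓘(ℝ, E)) (1 : G))]
    with x hx
  simp only [expC, logC]
  rw [(extChartAt 𝓘(ℝ, E) (1 : G)).right_inv hx, add_sub_cancel_left]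

lemma continuousAt_logC : ContinuousAt (logC : G → E) 1 :=
  (continuousAt_extChartAt (I := 𝓘(ℝ, E)) (1 : G)).sub continuousAt_const

lemma continuousAt_expC : ContinuousAt (expC G : E → G) 0 := by
  have h := continuousAt_extChartAt_symm (I := 𝓘(ℝ, E)) (1 : G)
  have h2 := h.tendsto.comp (tendsto_expC_base (G := G) (E := E))
  rw [ContinuousAt, expC_zero]
  rwa [extChartAt_to_inv] at h2

/-- The manifold derivative at `1` is defined through the very chart that `expC` inverts; the
recentring is only a translation. -/
lemma hasFDerivAt_comp_expC {f : G → W} (hf : MDifferentiableAt 𝓘(ℝ, E) 𝓘(ℝ, W) f 1) :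
    HasFDerivAt (fun x : E => f (expC G x)) (mfderiv 𝓘(ℝ, E) 𝓘(ℝ, W) f 1 : E →L[ℝ] W) 0 := by
  have h := hf.hasMFDerivAt.2
  simp only [writtenInExtChartAt, extChartAt_model_space_eq_id, PartialEquiv.refl_coe,
    Function.id_comp, modelWithCornersSelf_coe, range_id] at h
  have h2 : HasFDerivAt (fun x : E => extChartAt 𝓘(ℝ, E) (1 : G) 1 + x)
    (ContinuousLinearMap.id ℝ E) 0 := (hasFDerivAt_id _).const_add _
  have h3 := HasFDerivAt.comp (0 : E) (g := f ∘ (extChartAt 𝓘(ℝ, E) (1 : G)).symm)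
    (g' := (mfderiv 𝓘(ℝ, E) 𝓘(ℝ, W) f 1 : E →L[ℝ] W))
    (by rw [add_zero]; exact hasFDerivWithinAt_univ.1 h) h2
  exact h3

lemma hasFDerivAt_logC_comp_expC {f : G → G} (hf : MDifferentiableAt 𝓘(ℝ, E) 𝓘(ℝ, E) f 1)
    (h1 : f 1 = 1) :
    HasFDerivAt (fun x : E => (logC (f (expC G x)) : E))
      (mfderiv 𝓘(ℝ, E) 𝓘(ℝ, E) f 1 : E →L[ℝ] E) 0 := by
  have h := hf.hasMFDerivAt.2
  simp only [writtenInExtChartAt, h1,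
    modelWithCornersSelf_coe, range_id] at h
  have h2 : HasFDerivAt (fun x : E => extChartAt 𝓘(ℝ, E) (1 : G) 1 + x)
    (ContinuousLinearMap.id ℝ E) 0 := (hasFDerivAt_id _).const_add _
  have h3 := HasFDerivAt.comp (0 : E)
    (g := extChartAt 𝓘(ℝ, E) (1 : G) ∘ f ∘ (extChartAt 𝓘(ℝ, E) (1 : G)).symm)
    (g' := (mfderiv 𝓘(ℝ, E) 𝓘(ℝ, E) f 1 : E →L[ℝ] E))
    (by rw [add_zero]; exact hasFDerivWithinAt_univ.1 h) h2
  exact h3.sub_const _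

/-! ### Logarithmic derivatives -/

/-- `Φ` has logarithmic derivative `Φ⁻¹ dΦ = T` at `n₀`. -/
def HasLogDerivAt (Φ : N → G) (T : N →L[ℝ] E) (n₀ : N) : Prop :=
  ContinuousAt Φ n₀ ∧ HasFDerivAt (fun n => (logC ((Φ n₀)⁻¹ * Φ n) : E)) T n₀

lemma HasLogDerivAt.congr_fderiv {Φ : N → G} {T T' : N →L[ℝ] E} {n₀ : N}
    (h : HasLogDerivAt Φ T n₀) (hT : T = T') : HasLogDerivAt Φ T' n₀ := hT ▸ h

lemma hasLogDerivAt_const (u : G) (n₀ : N) :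
    HasLogDerivAt (fun _ => u) (0 : N →L[ℝ] E) n₀ :=
  ⟨continuousAt_const, by simpa using hasFDerivAt_const (0 : E) n₀⟩

lemma hasLogDerivAt_expC : HasLogDerivAt (expC G : E → G) (ContinuousLinearMap.id ℝ E) 0 := by
  refine ⟨continuousAt_expC, ?_⟩
  simp only [expC_zero, inv_one, one_mul]
  exact (hasFDerivAt_id (0 : E)).congr_of_eventuallyEq (eventually_logC_expC (G := G))

variable [LieGroup 𝓘(ℝ, E) ∞ G]

/-- This is what the continuity clause of `HasLogDerivAt` is for: `logC` is inverted by `expC` only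
near `1`, so `Φ n` has to be close to `Φ n₀` before its logarithm determines it. -/
lemma HasLogDerivAt.eventually_eq {Φ : N → G} {T : N →L[ℝ] E} {n₀ : N}
    (h : HasLogDerivAt Φ T n₀) :
    ∀ᶠ n in 𝓝 n₀, Φ n = Φ n₀ * expC G (logC ((Φ n₀)⁻¹ * Φ n) : E) := by
  haveI : IsTopologicalGroup G := topologicalGroup_of_lieGroup 𝓘(ℝ, E) ∞
  have hc : ContinuousAt (fun n => (Φ n₀)⁻¹ * Φ n) n₀ := continuousAt_const.mul h.1
  have hc' : Tendsto (fun n => (Φ n₀)⁻¹ * Φ n) (𝓝 n₀) (𝓝 1) := by simpa using hc.tendsto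
  filter_upwards [hc' (eventually_expC_logC (E := E) (G := G))] with n hn
  have hn' : expC G (logC ((Φ n₀)⁻¹ * Φ n) : E) = (Φ n₀)⁻¹ * Φ n := hn
  rw [hn']; group

lemma contMDiff_mul_left' (u : G) : ContMDiff 𝓘(ℝ, E) 𝓘(ℝ, E) ∞ (fun v : G => u * v) :=
  contMDiff_const.mul contMDiff_id

lemma HasLogDerivAt.comp_hasFDerivAt {Φ : N → G} {T : N →L[ℝ] E} {n₀ : N}
    (h : HasLogDerivAt Φ T n₀) {f : G → W} {f' : E →L[ℝ] W}
    (hf : HasFDerivAt (fun x => f (Φ n₀ * expC G x)) f' 0) :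
    HasFDerivAt (fun n => f (Φ n)) (f'.comp T) n₀ := by
  have h0 : (logC ((Φ n₀)⁻¹ * Φ n₀) : E) = 0 := by simp
  have := HasFDerivAt.comp n₀ (g := fun x => f (Φ n₀ * expC G x)) (g' := f') (by rwa [h0]) h.2
  refine this.congr_of_eventuallyEq ?_
  filter_upwards [h.eventually_eq] with n hn
  exact congrArg f hn

lemma contMDiff_conj (u : G) : ContMDiff 𝓘(ℝ, E) 𝓘(ℝ, E) ∞ (fun v : G => u * v * u⁻¹) :=
  (contMDiff_const.mul contMDiff_id).mul contMDiff_const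

lemma hasFDerivAt_logC_conj (u : G) :
    HasFDerivAt (fun x : E => (logC (u * expC G x * u⁻¹) : E)) (Ad u : E →L[ℝ] E) 0 :=
  hasFDerivAt_logC_comp_expC ((contMDiff_conj u).mdifferentiableAt (by simp)) (by simp)

lemma contMDiffAt_logC : ContMDiffAt 𝓘(ℝ, E) 𝓘(ℝ, E) ∞ (logC : G → E) 1 := by
  haveI : IsManifold 𝓘(ℝ, E) ∞ G := inferInstance
  exact contMDiffAt_extChartAt.sub contMDiffAt_const

lemma contMDiffAt_expC : ContMDiffAt 𝓘(ℝ, E) 𝓘(ℝ, E) ∞ (expC G : E → G) 0 := by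
  have h : ContMDiffAt 𝓘(ℝ, E) 𝓘(ℝ, E) ∞ (extChartAt 𝓘(ℝ, E) (1 : G)).symm
      (extChartAt 𝓘(ℝ, E) (1 : G) 1) :=
    (contMDiffOn_extChartAt_symm (I := 𝓘(ℝ, E)) (n := ∞) (1 : G)).contMDiffAt
      (extChartAt_target_mem_nhds (I := 𝓘(ℝ, E)) (1 : G))
  have h2 : ContMDiffAt 𝓘(ℝ, E) 𝓘(ℝ, E) ∞
      (fun x : E => extChartAt 𝓘(ℝ, E) (1 : G) 1 + x) 0 :=
    contMDiffAt_const.add contMDiffAt_id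
  exact ContMDiffAt.comp (0 : E) (by simpa using h) h2

/-- Multiplication and a conjugation read in the chart at `1`. -/
lemma contDiffAt_logC_conj_mul (u : G) :
    ContDiffAt ℝ ∞ (fun p : E × E => (logC (u * expC G p.1 * u⁻¹ * expC G p.2) : E)) 0 := by
  rw [← contMDiffAt_iff_contDiffAt]
  have h1 : ContMDiffAt 𝓘(ℝ, E × E) 𝓘(ℝ, E) ∞ (fun p : E × E => expC G p.1) 0 :=
    ContMDiffAt.comp (0 : E × E) (g := (expC G : E → G)) contMDiffAt_expC
      contDiff_fst.contMDiff.contMDiffAt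
  have h2 : ContMDiffAt 𝓘(ℝ, E × E) 𝓘(ℝ, E) ∞ (fun p : E × E => expC G p.2) 0 :=
    ContMDiffAt.comp (0 : E × E) (g := (expC G : E → G)) contMDiffAt_expC
      contDiff_snd.contMDiff.contMDiffAt
  have h3 : ContMDiffAt 𝓘(ℝ, E × E) 𝓘(ℝ, E) ∞
      (fun p : E × E => u * expC G p.1 * u⁻¹ * expC G p.2) 0 :=
    ((contMDiffAt_const.mul h1).mul contMDiffAt_const).mul h2
  refine ContMDiffAt.comp (0 : E × E) (g := (logC : G → E)) ?_ h3
  simpa using contMDiffAt_logC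

/-- Differentiability being known, the differential is determined by the restrictions to the two
axes: a conjugation on the first, the identity on the second. -/
lemma hasFDerivAt_logC_conj_mul (u : G) :
    HasFDerivAt (fun p : E × E => (logC (u * expC G p.1 * u⁻¹ * expC G p.2) : E))
      ((Ad u : E →L[ℝ] E).comp (ContinuousLinearMap.fst ℝ E E)
        + ContinuousLinearMap.snd ℝ E E) 0 := by
  have hd := (contDiffAt_logC_conj_mul (E := E) u).differentiableAt (by simp)
  have hD := hd.hasFDerivAt
  have e1 := (HasFDerivAt.comp (0 : E) (f := fun x : E => (x, (0 : E)))
    (f' := ContinuousLinearMap.inl ℝ E E) hD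
    (ContinuousLinearMap.inl ℝ E E).hasFDerivAt).unique
    ((hasFDerivAt_logC_conj (E := E) u).congr_of_eventuallyEq
      (Eventually.of_forall fun x => by simp))
  have e2 := (HasFDerivAt.comp (0 : E) (f := fun x : E => ((0 : E), x))
    (f' := ContinuousLinearMap.inr ℝ E E) hD
    (ContinuousLinearMap.inr ℝ E E).hasFDerivAt).unique
    ((hasFDerivAt_id (0 : E)).congr_of_eventuallyEq
      (by
        filter_upwards [eventually_logC_expC (E := E) (G := G)] with x hx
        simp [hx]))
  refine hD.congr_fderiv (ContinuousLinearMap.ext fun p => ?_)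
  have a1 := DFunLike.congr_fun e1 p.1
  have a2 := DFunLike.congr_fun e2 p.2
  simp only [ContinuousLinearMap.comp_apply, ContinuousLinearMap.inl_apply,
    ContinuousLinearMap.inr_apply, ContinuousLinearMap.id_apply] at a1 a2
  have hp : p = (p.1, 0) + (0, p.2) := by simp
  conv_lhs => rw [hp, map_add, a1, a2]
  simp

/-- Since `Φ₀ x Ψ₀ y = Φ₀ Ψ₀ (Ψ₀⁻¹ x Ψ₀) y`, moving the first increment past `Ψ₀` costs `Ad Ψ₀⁻¹`.
-/
lemma HasLogDerivAt.mul {Φ Ψ : N → G} {T S : N →L[ℝ] E} {n₀ : N}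
    (h : HasLogDerivAt Φ T n₀) (h' : HasLogDerivAt Ψ S n₀) :
    HasLogDerivAt (fun n => Φ n * Ψ n) ((Ad (Ψ n₀)⁻¹ : E →L[ℝ] E).comp T + S) n₀ := by
  haveI : IsTopologicalGroup G := topologicalGroup_of_lieGroup 𝓘(ℝ, E) ∞
  refine ⟨h.1.mul h'.1, ?_⟩
  have hp := h.2.prodMk h'.2
  have h0 : ((logC ((Φ n₀)⁻¹ * Φ n₀) : E), (logC ((Ψ n₀)⁻¹ * Ψ n₀) : E)) = 0 := by simp
  have := HasFDerivAt.comp n₀ (by rw [h0]; exact hasFDerivAt_logC_conj_mul (Ψ n₀)⁻¹) hp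
  refine (this.congr_of_eventuallyEq ?_).congr_fderiv ?_
  · filter_upwards [h.eventually_eq, h'.eventually_eq] with n hn hn'
    simp only [Function.comp_apply]
    conv_lhs => rw [hn, hn']
    congr 1
    group
  · ext x; simp

/-- The chain rule is used only for the existence of the derivative; its value is forced by the
product rule applied to `Φ Φ⁻¹ = 1`. -/
lemma HasLogDerivAt.inv {Φ : N → G} {T : N →L[ℝ] E} {n₀ : N}
    (h : HasLogDerivAt Φ T n₀) :
    HasLogDerivAt (fun n => (Φ n)⁻¹) (-(Ad (Φ n₀) : E →L[ℝ] E).comp T) n₀ := by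
  haveI : IsTopologicalGroup G := topologicalGroup_of_lieGroup 𝓘(ℝ, E) ∞
  have hI : MDifferentiableAt 𝓘(ℝ, E) 𝓘(ℝ, E) (fun v : G => Φ n₀ * v⁻¹ * (Φ n₀)⁻¹) 1 := by
    have : ContMDiff 𝓘(ℝ, E) 𝓘(ℝ, E) ∞ (fun v : G => Φ n₀ * v⁻¹ * (Φ n₀)⁻¹) :=
      (contMDiff_const.mul contMDiff_id.inv).mul contMDiff_const
    exact this.mdifferentiableAt (by simp)
  have hA := hasFDerivAt_logC_comp_expC hI (by simp)
  have h0 : (logC ((Φ n₀)⁻¹ * Φ n₀) : E) = 0 := by simp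
  have hB := HasFDerivAt.comp n₀ (by rw [h0]; exact hA) h.2
  have hC : HasLogDerivAt (fun n => (Φ n)⁻¹) _ n₀ := ⟨h.1.inv, hB.congr_of_eventuallyEq (by
    filter_upwards [h.eventually_eq] with n hn
    simp only [Function.comp_apply, inv_inv]
    conv_lhs => rw [hn]
    rw [mul_inv_rev, mul_assoc])⟩
  have hM := hC.mul h
  have hu : _ = _ := hM.2.unique ((hasLogDerivAt_const (E := E) (1 : G) n₀).2.congr_of_eventuallyEq
    (by simp))
  have hC2 := HasLogDerivAt.mul h hC
  have hu2 : _ = _ := hC2.2.unique ((hasLogDerivAt_const (E := E) (1 : G) n₀).2.congr_of_eventuallyEq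
    (by simp))
  rw [inv_inv] at hu2
  convert hC using 1
  rw [neg_eq_iff_add_eq_zero]
  exact hu2

end LieCalculus

/-! ### Derivatives depending on parameters. -/

section Parametric

variable {E₁ : Type*} [NormedAddCommGroup E₁] [NormedSpace ℝ E₁]
  {W : Type*} [NormedAddCommGroup W] [NormedSpace ℝ W]
  {EN : Type*} [NormedAddCommGroup EN] [NormedSpace ℝ EN]
  {HN : Type*} [TopologicalSpace HN] {IN : ModelWithCorners ℝ EN HN}
  {M : Type*} [TopologicalSpace M] [ChartedSpace HN M] [IsManifold IN 1 M]

/-- Smoothness of a derivative in parameters. -/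
lemma contMDiffAt_fderiv_param {F : M → E₁ → W} {n₀ : M} {x₀ : E₁}
    (hF : ContMDiffAt (IN.prod 𝓘(ℝ, E₁)) 𝓘(ℝ, W) ∞ (Function.uncurry F) (n₀, x₀)) :
    ContMDiffAt IN 𝓘(ℝ, E₁ →L[ℝ] W) ∞ (fun n => fderiv ℝ (F n) x₀) n₀ := by
  have h := ContMDiffAt.mfderiv (m := ∞) F (fun _ => x₀) hF contMDiffAt_const le_rfl
  simp only [inTangentCoordinates_model_space, mfderiv_eq_fderiv] at h
  exact h

end Parametric

/-! ### The adjoint action, the bracket and the Maurer-Cartan equation in the chart. -/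

section LieCalculus

variable {E : Type*} [NormedAddCommGroup E] [NormedSpace ℝ E]
  {G : Type*} [TopologicalSpace G] [ChartedSpace E G] [Group G]
  {N : Type*} [NormedAddCommGroup N] [NormedSpace ℝ N]
  {W : Type*} [NormedAddCommGroup W] [NormedSpace ℝ W]
  [LieGroup 𝓘(ℝ, E) ∞ G]

/-! ### Smoothness of the adjoint action and the bracket -/

/-- `Ad u` is the derivative at `0` of a map that is jointly smooth in `u` and in the chart
variable. -/
lemma contMDiff_Ad : ContMDiff 𝓘(ℝ, E) 𝓘(ℝ, E →L[ℝ] E) ∞ (fun u : G => (Ad u : E →L[ℝ] E)) := by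
  intro u₀
  have h : ContMDiffAt ((𝓘(ℝ, E)).prod 𝓘(ℝ, E)) 𝓘(ℝ, E) ∞
      (Function.uncurry fun (u : G) (x : E) => (logC (u * expC G x * u⁻¹) : E)) (u₀, 0) := by
    have h2 : ContMDiffAt ((𝓘(ℝ, E)).prod 𝓘(ℝ, E)) 𝓘(ℝ, E) ∞
        (fun p : G × E => p.1 * expC G p.2 * p.1⁻¹) (u₀, 0) :=
      (contMDiffAt_fst.mul (ContMDiffAt.comp (u₀, (0 : E)) (g := (expC G : E → G))
        contMDiffAt_expC contMDiffAt_snd)).mul contMDiffAt_fst.inv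
    refine ContMDiffAt.comp (u₀, (0 : E)) (g := (logC : G → E)) ?_ h2
    simpa using contMDiffAt_logC
  refine (contMDiffAt_fderiv_param h).congr_of_eventuallyEq (Eventually.of_forall fun u => ?_)
  exact (hasFDerivAt_logC_conj u).fderiv.symm

variable (G) in
/-- The differential of `Ad` at `1`. -/
def ad : E →L[ℝ] E →L[ℝ] E := fderiv ℝ (fun x : E => (Ad (expC G x) : E →L[ℝ] E)) 0

lemma hasFDerivAt_Ad_expC :
    HasFDerivAt (fun x : E => (Ad (expC G x) : E →L[ℝ] E)) (ad G) 0 := by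
  have h : ContMDiffAt 𝓘(ℝ, E) 𝓘(ℝ, E →L[ℝ] E) ∞ (fun x : E => (Ad (expC G x) : E →L[ℝ] E)) 0 :=
    ContMDiffAt.comp (0 : E) (g := fun u : G => (Ad u : E →L[ℝ] E)) (contMDiff_Ad _)
      contMDiffAt_expC
  exact ((contMDiffAt_iff_contDiffAt.1 h).differentiableAt (by simp)).hasFDerivAt

lemma HasLogDerivAt.Ad {Φ : N → G} {T : N →L[ℝ] E} {n₀ : N} (h : HasLogDerivAt Φ T n₀) :
    HasFDerivAt (fun n => (Flower.Ad (Φ n) : E →L[ℝ] E))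
      ((ContinuousLinearMap.compL ℝ E E E (Flower.Ad (Φ n₀))).comp ((ad G).comp T)) n₀ := by
  have h1 : HasFDerivAt (fun x : E => (Flower.Ad (Φ n₀ * expC G x) : E →L[ℝ] E))
      ((ContinuousLinearMap.compL ℝ E E E (Flower.Ad (Φ n₀))).comp (ad G)) 0 := by
    simp only [Ad_mul]
    exact ((ContinuousLinearMap.compL ℝ E E E (Flower.Ad (Φ n₀))).hasFDerivAt).comp 0
      hasFDerivAt_Ad_expC
  exact h.comp_hasFDerivAt (f := fun u => (Flower.Ad u : E →L[ℝ] E)) h1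

variable (E G) in
/-- Multiplication in the chart at `1`. -/
def chartMul (p : E × E) : E := logC (expC G p.1 * expC G p.2)

lemma contDiffAt_chartMul : ContDiffAt ℝ ∞ (chartMul E G) 0 := by
  have := contDiffAt_logC_conj_mul (E := E) (1 : G)
  simp only [one_mul, inv_one, mul_one] at this
  exact this

variable (E G) in
/-- The left-invariant frame in the chart at `1`. -/
def leftFrame (s : E) : E →L[ℝ] E := fderiv ℝ (fun t => chartMul E G (s, t)) 0

lemma contDiffAt_leftFrame : ContDiffAt ℝ ∞ (leftFrame E G) 0 := by
  rw [← contMDiffAt_iff_contDiffAt]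
  refine contMDiffAt_fderiv_param (F := fun s t => chartMul E G (s, t)) ?_
  rw [← modelWithCornersSelf_prod, chartedSpaceSelf_prod]
  exact contMDiffAt_iff_contDiffAt.2 contDiffAt_chartMul

lemma eventually_differentiableAt_chartMul :
    ∀ᶠ p in 𝓝 (0 : E × E), DifferentiableAt ℝ (chartMul E G) p := by
  have h : ContDiffAt ℝ 1 (chartMul E G) 0 := contDiffAt_chartMul.of_le (by norm_cast)
  filter_upwards [h.eventually (by simp)] with p hp
  exact hp.differentiableAt (by simp)

lemma hasFDerivAt_fderiv_chartMul :
    HasFDerivAt (fderiv ℝ (chartMul E G)) (fderiv ℝ (fderiv ℝ (chartMul E G)) 0) 0 :=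
  ((contDiffAt_chartMul.fderiv_right (m := 1) (by norm_cast)).differentiableAt
    (by simp)).hasFDerivAt

/-- As a mixed second derivative of the multiplication, this quantity can be compared with its
analogue for the right frame by symmetry of second derivatives. -/
lemma fderiv_leftFrame_apply (x y : E) :
    fderiv ℝ (leftFrame E G) 0 x y = fderiv ℝ (fderiv ℝ (chartMul E G)) 0 (x, 0) (0, y) := by
  have h1 : HasFDerivAt (fun s : E => fderiv ℝ (chartMul E G) (s, 0))
      ((fderiv ℝ (fderiv ℝ (chartMul E G)) 0).comp (ContinuousLinearMap.inl ℝ E E)) 0 :=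
    HasFDerivAt.comp (0 : E) (g := fderiv ℝ (chartMul E G)) (f := fun s : E => (s, (0 : E)))
      hasFDerivAt_fderiv_chartMul (ContinuousLinearMap.inl ℝ E E).hasFDerivAt
  have h2 := ((ContinuousLinearMap.compL ℝ E (E × E) E).flip
    (ContinuousLinearMap.inr ℝ E E)).hasFDerivAt.comp (0 : E) h1
  have h3 : HasFDerivAt (leftFrame E G) _ 0 := h2.congr_of_eventuallyEq (by
    have hc : Tendsto (fun s : E => (s, (0 : E))) (𝓝 0) (𝓝 0) :=
      (ContinuousLinearMap.inl ℝ E E).continuous.tendsto' _ _ (by simp)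
    filter_upwards [hc (eventually_differentiableAt_chartMul (G := G))] with s hs
    have hs' : DifferentiableAt ℝ (chartMul E G) (s, 0) := hs
    have hh : HasFDerivAt (fun t : E => (s, t)) (ContinuousLinearMap.inr ℝ E E) 0 :=
      (hasFDerivAt_const s (0 : E)).prodMk (hasFDerivAt_id (0 : E))
    exact (HasFDerivAt.comp (0 : E) (g := chartMul E G) hs'.hasFDerivAt hh).fderiv)
  rw [h3.fderiv]
  simp

lemma isSymm_chartMul (a b : E × E) :
    fderiv ℝ (fderiv ℝ (chartMul E G)) 0 a b = fderiv ℝ (fderiv ℝ (chartMul E G)) 0 b a :=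
  (contDiffAt_chartMul.isSymmSndFDerivAt (by simp; norm_cast)) a b

lemma leftFrame_zero : leftFrame E G 0 = ContinuousLinearMap.id ℝ E := by
  have : HasFDerivAt (fun t => chartMul E G (0, t)) (ContinuousLinearMap.id ℝ E) 0 :=
    (hasFDerivAt_id (0 : E)).congr_of_eventuallyEq (by
      filter_upwards [eventually_logC_expC (E := E) (G := G)] with x hx
      simp [chartMul, hx])
  exact this.fderiv

variable (E G) in
/-- The right-invariant frame in the chart at `1`. -/
def rightFrame (s : E) : E →L[ℝ] E := fderiv ℝ (fun t => chartMul E G (t, s)) 0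

lemma rightFrame_zero : rightFrame E G 0 = ContinuousLinearMap.id ℝ E := by
  have : HasFDerivAt (fun t => chartMul E G (t, 0)) (ContinuousLinearMap.id ℝ E) 0 :=
    (hasFDerivAt_id (0 : E)).congr_of_eventuallyEq (by
      filter_upwards [eventually_logC_expC (E := E) (G := G)] with x hx
      simp [chartMul, hx])
  exact this.fderiv

lemma hasFDerivAt_rightFrame : HasFDerivAt (rightFrame E G)
    ((((ContinuousLinearMap.compL ℝ E (E × E) E).flip (ContinuousLinearMap.inl ℝ E E))).comp
      ((fderiv ℝ (fderiv ℝ (chartMul E G)) 0).comp (ContinuousLinearMap.inr ℝ E E))) 0 := by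
  have h1 : HasFDerivAt (fun s : E => fderiv ℝ (chartMul E G) (0, s))
      ((fderiv ℝ (fderiv ℝ (chartMul E G)) 0).comp (ContinuousLinearMap.inr ℝ E E)) 0 :=
    HasFDerivAt.comp (0 : E) (g := fderiv ℝ (chartMul E G)) (f := fun s : E => ((0 : E), s))
      hasFDerivAt_fderiv_chartMul (ContinuousLinearMap.inr ℝ E E).hasFDerivAt
  have h2 := ((ContinuousLinearMap.compL ℝ E (E × E) E).flip
    (ContinuousLinearMap.inl ℝ E E)).hasFDerivAt.comp (0 : E) h1
  refine h2.congr_of_eventuallyEq ?_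
  have hc : Tendsto (fun s : E => ((0 : E), s)) (𝓝 0) (𝓝 0) :=
    (ContinuousLinearMap.inr ℝ E E).continuous.tendsto' _ _ (by simp)
  filter_upwards [hc (eventually_differentiableAt_chartMul (G := G))] with s hs
  have hs' : DifferentiableAt ℝ (chartMul E G) (0, s) := hs
  have hh : HasFDerivAt (fun t : E => (t, s)) (ContinuousLinearMap.inl ℝ E E) 0 :=
    (hasFDerivAt_id (0 : E)).prodMk (hasFDerivAt_const s (0 : E))
  exact (HasFDerivAt.comp (0 : E) (g := chartMul E G) hs'.hasFDerivAt hh).fderiv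

/-- Differentiate `s t = (s t s⁻¹) s` in `t` at the identity. -/
lemma eventually_leftFrame_eq :
    ∀ᶠ s in 𝓝 (0 : E), leftFrame E G s = (rightFrame E G s).comp (Ad (expC G s)) := by
  have hc : Tendsto (fun s : E => ((0 : E), s)) (𝓝 0) (𝓝 0) :=
    (ContinuousLinearMap.inr ℝ E E).continuous.tendsto' _ _ (by simp)
  filter_upwards [hc (eventually_differentiableAt_chartMul (G := G))] with s hs
  have hs' : DifferentiableAt ℝ (chartMul E G) (0, s) := hs
  have hh : HasFDerivAt (fun t : E => (t, s)) (ContinuousLinearMap.inl ℝ E E) 0 :=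
    (hasFDerivAt_id (0 : E)).prodMk (hasFDerivAt_const s (0 : E))
  have hR := (HasFDerivAt.comp (0 : E) (g := chartMul E G) hs'.hasFDerivAt hh)
  have hR' : HasFDerivAt (fun t => chartMul E G (t, s)) (rightFrame E G s) 0 := by
    have : rightFrame E G s = _ := hR.fderiv
    rw [this]; exact hR
  have hcj := hasFDerivAt_logC_conj (E := E) (expC G s)
  have h0 : (logC (expC G s * expC G (0 : E) * (expC G s)⁻¹) : E) = 0 := by simp
  have hcomp := HasFDerivAt.comp (0 : E) (g := fun t => chartMul E G (t, s)) (by rwa [h0]) hcj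
  refine (hcomp.congr_of_eventuallyEq ?_).fderiv
  have : IsTopologicalGroup G := topologicalGroup_of_lieGroup 𝓘(ℝ, E) ∞
  have ht : Tendsto (fun t : E => expC G s * expC G t * (expC G s)⁻¹) (𝓝 0) (𝓝 1) := by
    have : ContinuousAt (fun t : E => expC G s * expC G t * (expC G s)⁻¹) 0 :=
      (continuousAt_const.mul continuousAt_expC).mul continuousAt_const
    simpa [ContinuousAt] using this
  filter_upwards [ht (eventually_expC_logC (E := E) (G := G))] with t ht
  have ht' : expC G (logC (expC G s * expC G t * (expC G s)⁻¹) : E)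
    = expC G s * expC G t * (expC G s)⁻¹ := ht
  simp only [Function.comp_apply, chartMul, ht']
  simp

/-- Write `L`, `R` for the two frames. Differentiating `L = R ∘ Ad` at the origin gives `DL(x) y =
DR(x) y + ad x y`, and symmetry of the second derivative of the multiplication identifies `DR(x) y`
with `DL(y) x`. -/
lemma ad_eq_fderiv_leftFrame (x y : E) :
    ad G x y = fderiv ℝ (leftFrame E G) 0 x y - fderiv ℝ (leftFrame E G) 0 y x := by
  have hL : HasFDerivAt (leftFrame E G) (fderiv ℝ (leftFrame E G) 0) 0 :=
    (contDiffAt_leftFrame.differentiableAt (by simp)).hasFDerivAt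
  have hRA := ((hasFDerivAt_rightFrame (E := E) (G := G)).clm_comp
    (hasFDerivAt_Ad_expC (E := E) (G := G)))
  have := DFunLike.congr_fun (DFunLike.congr_fun
    ((hRA.congr_of_eventuallyEq (eventually_leftFrame_eq)).unique hL) x) y
  simp [rightFrame_zero, Ad_one] at this
  rw [← this, fderiv_leftFrame_apply, isSymm_chartMul (y, 0)]
  abel

lemma mfderiv_extChartAt_self {M : Type*} [TopologicalSpace M] [ChartedSpace E M]
    [IsManifold 𝓘(ℝ, E) 1 M] (p : M) :
    (mfderiv 𝓘(ℝ, E) 𝓘(ℝ, E) (extChartAt 𝓘(ℝ, E) p) p : E →L[ℝ] E)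
      = ContinuousLinearMap.id ℝ E := by
  ext v
  have h := tangentCoordChange_self (I := 𝓘(ℝ, E)) (x := p) (z := p) (v := v)
    (mem_extChartAt_source p)
  rw [← mfderiv_chartAt_eq_tangentCoordChange (mem_chart_source E p)] at h
  exact h

/-- Read in the chart, the left-invariant field of `ξ` is `z ↦ leftFrame (z - φ 1) ξ`, with value
`ξ` at the base point. The coordinate bracket of two such fields is the antisymmetrised derivative
of the frame. -/
lemma lieBr_eq_ad [CompleteSpace E] (x y : E) : lieBr G x y = ad G x y := by
  have hM : IsManifold 𝓘(ℝ, E) 1 G := IsManifold.of_le (n := ∞) (by norm_cast)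
  set φ := extChartAt 𝓘(ℝ, E) (1 : G) with hφ
  have hV : ∀ ξ : E, ∀ᶠ z in 𝓝 (φ 1),
      (VectorField.mpullbackWithin 𝓘(ℝ, E) 𝓘(ℝ, E) φ.symm
        (mulInvariantVectorField (I := 𝓘(ℝ, E)) (G := G) ξ) (range 𝓘(ℝ, E)) z : E)
      = leftFrame E G (z - φ 1) ξ := by
    intro ξ
    filter_upwards [extChartAt_target_mem_nhds (I := 𝓘(ℝ, E)) (1 : G)] with z hz
    have i1 := mfderiv_extChartAt_comp_mfderivWithin_extChartAt_symm (I := 𝓘(ℝ, E)) hz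
    have i2 := mfderivWithin_extChartAt_symm_comp_mfderiv_extChartAt (I := 𝓘(ℝ, E)) hz
    have hinv := ContinuousLinearMap.inverse_eq i2 i1
    rw [VectorField.mpullbackWithin_apply, hinv]
    have hu : expC G (z - φ 1) = φ.symm z := by simp [expC, hφ]
    set u := φ.symm z
    have hus : u ∈ (chartAt E (1 : G)).source := by
      have := φ.map_target hz
      rwa [hφ, extChartAt_source] at this
    -- The points `u * 1` and `u` are equal but not syntactically so, and the tangent spaces depend
    -- on them; stating the derivative at any point equal to `u` avoids a transport.
    have key : ∀ y : G, y = u → HasMFDerivAt 𝓘(ℝ, E) 𝓘(ℝ, E) φ y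
        (mfderiv 𝓘(ℝ, E) 𝓘(ℝ, E) φ u : E →L[ℝ] E) := by
      rintro y rfl
      exact (mdifferentiableAt_extChartAt hus).hasMFDerivAt
    have hmul : HasMFDerivAt 𝓘(ℝ, E) 𝓘(ℝ, E) (fun v : G => u * v) 1
        (mfderiv 𝓘(ℝ, E) 𝓘(ℝ, E) (fun v : G => u * v) 1) :=
      ((contMDiff_mul_left' u).mdifferentiableAt (by simp)).hasMFDerivAt
    have hc := HasMFDerivAt.comp (1 : G) (key (u * 1) (mul_one u)) hmul
    have h3 := hasFDerivAt_comp_expC hc.mdifferentiableAt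
    rw [hc.mfderiv] at h3
    have h4 := h3.sub_const (φ 1)
    have h5 : leftFrame E G (z - φ 1) = fderiv ℝ (fun x : E => (φ ∘ HMul.hMul u) (expC G x) - φ 1) 0 := by
      unfold leftFrame chartMul
      simp only [hu]
      rfl
    rw [h5, h4.fderiv]
    rfl
  have hs : φ.symm ⁻¹' univ ∩ range 𝓘(ℝ, E) = univ := by simp
  have hL : HasFDerivAt (leftFrame E G) (fderiv ℝ (leftFrame E G) 0) 0 :=
    (contDiffAt_leftFrame.differentiableAt (by simp)).hasFDerivAt
  have hd : ∀ ξ : E, HasFDerivAt (fun z => leftFrame E G (z - φ 1) ξ)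
      ((fderiv ℝ (leftFrame E G) 0).flip ξ) (φ 1) := by
    intro ξ
    have h1 : HasFDerivAt (fun z => leftFrame E G (z - φ 1)) (fderiv ℝ (leftFrame E G) 0) (φ 1) :=
      HasFDerivAt.comp (φ 1) (g := leftFrame E G) (by rwa [id, sub_self])
        ((hasFDerivAt_id (φ 1)).sub_const (φ 1))
    exact ((ContinuousLinearMap.apply ℝ E ξ).hasFDerivAt.comp (φ 1) h1)
  -- The fields are replaced by plain functions `E → E`, so that ordinary derivatives can be
  -- rewritten without tangent-space types interfering.
  obtain ⟨VF, hVF⟩ : ∃ VF : E → E → E, ∀ ξ, VF ξ =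
      (VectorField.mpullbackWithin 𝓘(ℝ, E) 𝓘(ℝ, E) φ.symm
        (mulInvariantVectorField (I := 𝓘(ℝ, E)) (G := G) ξ) (range 𝓘(ℝ, E)) : E → E) :=
    ⟨_, fun ξ => rfl⟩
  have hV' : ∀ ξ : E, VF ξ =ᶠ[𝓝 (φ 1)] fun z => leftFrame E G (z - φ 1) ξ := fun ξ => by
    rw [hVF]; exact hV ξ
  have e : ∀ ξ : E, fderiv ℝ (VF ξ) (φ 1) = (fderiv ℝ (leftFrame E G) 0).flip ξ := fun ξ =>
    ((hd ξ).congr_of_eventuallyEq (hV' ξ)).fderiv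
  have e0 : ∀ ξ : E, VF ξ (φ 1) = ξ := by
    intro ξ
    rw [(hV' ξ).self_of_nhds]
    simp [leftFrame_zero]
  obtain ⟨B, hB⟩ : ∃ B : E, B = VectorField.lieBracketWithin ℝ (VF x) (VF y)
        (φ.symm ⁻¹' univ ∩ range 𝓘(ℝ, E)) (φ 1) := ⟨_, rfl⟩
  obtain ⟨A, hA⟩ : ∃ A : E →L[ℝ] E, A = (mfderiv 𝓘(ℝ, E) 𝓘(ℝ, E) φ (1 : G) : E →L[ℝ] E) :=
    ⟨_, rfl⟩
  have hb : lieBr G x y = ContinuousLinearMap.inverse A B := by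
    rw [hA, hB, hVF, hVF]; rfl
  rw [mfderiv_extChartAt_self] at hA
  rw [hs, VectorField.lieBracketWithin_univ] at hB
  simp only [VectorField.lieBracket] at hB
  rw [e, e, e0, e0] at hB
  rw [hb, hA, ContinuousLinearMap.inverse_id, hB, ad_eq_fderiv_leftFrame]
  rfl

lemma ad_skew (x y : E) : ad G x y = -ad G y x := by
  rw [ad_eq_fderiv_leftFrame, ad_eq_fderiv_leftFrame, neg_sub]

@[simp] lemma ad_self (x : E) : ad G x x = 0 := by
  rw [ad_eq_fderiv_leftFrame, sub_self]

/-- The curve `Ad(u e^x u⁻¹)` is differentiated twice over: through the logarithmic derivative `Ad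
u`, and as `Ad(u) Ad(e^x) Ad(u⁻¹)`. -/
lemma Ad_ad (u : G) (x y : E) : Ad u (ad G x y) = ad G (Ad u x) (Ad u y) := by
  have h1 : HasLogDerivAt (fun n : E => u * expC G n * u⁻¹) (Ad u : E →L[ℝ] E) 0 := by
    have := ((hasLogDerivAt_const u (0 : E)).mul (hasLogDerivAt_expC (E := E) (G := G))).mul
      (hasLogDerivAt_const u⁻¹ (0 : E))
    convert this using 1
    ext x; simp
  have h2 := h1.Ad
  have h3 : HasFDerivAt (fun n : E => (Ad (u * expC G n * u⁻¹) : E →L[ℝ] E))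
      ((ContinuousLinearMap.compL ℝ E E E (Ad u)).comp
        (((ContinuousLinearMap.compL ℝ E E E).flip (Ad u⁻¹)).comp (ad G))) 0 := by
    simp only [Ad_mul]
    exact ((ContinuousLinearMap.compL ℝ E E E (Ad u)).comp
      ((ContinuousLinearMap.compL ℝ E E E).flip (Ad u⁻¹))).hasFDerivAt.comp 0 hasFDerivAt_Ad_expC
  have := DFunLike.congr_fun (DFunLike.congr_fun (h2.unique h3) x) (Ad u y)
  have huu : (Ad u⁻¹ : E →L[ℝ] E) (Ad u y) = y := by
    have := DFunLike.congr_fun (Ad_mul (E := E) u⁻¹ u) y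
    simpa [Ad_one] using this.symm
  simp [Ad_one, huu] at this
  exact this.symm

/-! ### The Maurer-Cartan equation -/

variable (E G) in
/-- Left division in the chart at `1`. -/
def chartDiv (p : E × E) : E := logC ((expC G p.1)⁻¹ * expC G p.2)

lemma contDiffAt_chartDiv : ContDiffAt ℝ ∞ (chartDiv E G) 0 := by
  rw [← contMDiffAt_iff_contDiffAt]
  have h1 : ContMDiffAt 𝓘(ℝ, E × E) 𝓘(ℝ, E) ∞ (fun p : E × E => expC G p.1) 0 :=
    ContMDiffAt.comp (0 : E × E) (g := (expC G : E → G)) contMDiffAt_expC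
      contDiff_fst.contMDiff.contMDiffAt
  have h2 : ContMDiffAt 𝓘(ℝ, E × E) 𝓘(ℝ, E) ∞ (fun p : E × E => expC G p.2) 0 :=
    ContMDiffAt.comp (0 : E × E) (g := (expC G : E → G)) contMDiffAt_expC
      contDiff_snd.contMDiff.contMDiffAt
  refine ContMDiffAt.comp (0 : E × E) (g := (logC : G → E)) ?_ (h1.inv.mul h2)
  simpa using contMDiffAt_logC

variable (E G) in
/-- The Maurer-Cartan form in the chart at `1`. -/
def leftCoframe (s : E) : E →L[ℝ] E :=
  (fderiv ℝ (chartDiv E G) (s, s)).comp (ContinuousLinearMap.inr ℝ E E)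

lemma eventually_differentiableAt_chartDiv :
    ∀ᶠ p in 𝓝 (0 : E × E), DifferentiableAt ℝ (chartDiv E G) p := by
  have h : ContDiffAt ℝ 1 (chartDiv E G) 0 := contDiffAt_chartDiv.of_le (by norm_cast)
  filter_upwards [h.eventually (by simp)] with p hp
  exact hp.differentiableAt (by simp)

lemma eventually_hasFDerivAt_chartDiv :
    ∀ᶠ s in 𝓝 (0 : E), HasFDerivAt (fun t => chartDiv E G (s, t)) (leftCoframe E G s) s := by
  have hc : Tendsto (fun s : E => (s, s)) (𝓝 0) (𝓝 0) :=
    (continuous_id.prodMk continuous_id).tendsto' _ _ (by simp)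
  filter_upwards [hc (eventually_differentiableAt_chartDiv (G := G))] with s hs
  have hs' : DifferentiableAt ℝ (chartDiv E G) (s, s) := hs
  have hh : HasFDerivAt (fun t : E => (s, t)) (ContinuousLinearMap.inr ℝ E E) s :=
    (hasFDerivAt_const s s).prodMk (hasFDerivAt_id s)
  exact HasFDerivAt.comp s (g := chartDiv E G) hs'.hasFDerivAt hh

/-- Differentiate `s (s⁻¹ t) = t` in `t` at `t = s`. -/
lemma eventually_leftFrame_comp_leftCoframe :
    ∀ᶠ s in 𝓝 (0 : E), (leftFrame E G s).comp (leftCoframe E G s) = ContinuousLinearMap.id ℝ E := by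
  have : IsTopologicalGroup G := topologicalGroup_of_lieGroup 𝓘(ℝ, E) ∞
  have hc : Tendsto (fun s : E => (s, (0 : E))) (𝓝 0) (𝓝 0) :=
    (ContinuousLinearMap.inl ℝ E E).continuous.tendsto' _ _ (by simp)
  have hq : Tendsto (fun p : E × E => (expC G p.1)⁻¹ * expC G p.2) (𝓝 0) (𝓝 1) := by
    have h1 : ContinuousAt (fun p : E × E => expC G p.1) 0 :=
      ContinuousAt.comp (g := expC G) (f := Prod.fst) continuousAt_expC continuousAt_fst
    have h2 : ContinuousAt (fun p : E × E => expC G p.2) 0 :=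
      ContinuousAt.comp (g := expC G) (f := Prod.snd) continuousAt_expC continuousAt_snd
    have h3 : Tendsto (fun p : E × E => (expC G p.1)⁻¹ * expC G p.2) (𝓝 0)
      (𝓝 ((expC G (0 : E × E).1)⁻¹ * expC G (0 : E × E).2)) := h1.inv.mul h2
    simpa using h3
  have hd : Tendsto (fun s : E => (s, s)) (𝓝 0) (𝓝 0) :=
    (continuous_id.prodMk continuous_id).tendsto' _ _ (by simp)
  have hev := (hd (eventually_eventually_nhds.2 (hq (eventually_expC_logC (E := E) (G := G)))))
  filter_upwards [hev, eventually_hasFDerivAt_chartDiv (E := E) (G := G),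
    hc (eventually_differentiableAt_chartMul (G := G)),
    eventually_eventually_nhds.2 (eventually_logC_expC (E := E) (G := G))] with s h1 h2 h3 h4
  have h3' : DifferentiableAt ℝ (chartMul E G) (s, 0) := h3
  have h0 : chartDiv E G (s, s) = 0 := by simp [chartDiv]
  have hh : HasFDerivAt (fun t : E => (s, t)) (ContinuousLinearMap.inr ℝ E E) 0 :=
    (hasFDerivAt_const s (0 : E)).prodMk (hasFDerivAt_id (0 : E))
  have hL : HasFDerivAt (fun t : E => chartMul E G (s, t)) (leftFrame E G s) 0 :=
    (HasFDerivAt.comp (0 : E) (g := chartMul E G) h3'.hasFDerivAt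
      hh).differentiableAt.hasFDerivAt
  have hcomp := HasFDerivAt.comp s (g := fun t : E => chartMul E G (s, t)) (by rwa [h0]) h2
  refine hcomp.unique ((hasFDerivAt_id s).congr_of_eventuallyEq ?_)
  have hcs : Tendsto (fun t : E => (s, t)) (𝓝 s) (𝓝 (s, s)) :=
    (continuous_const.prodMk continuous_id).tendsto' _ _ rfl
  filter_upwards [hcs h1, h4] with t ht1 ht2
  have ht1' : expC G (logC ((expC G s)⁻¹ * expC G t) : E) = (expC G s)⁻¹ * expC G t := ht1
  simp only [Function.comp_apply, chartMul, chartDiv, ht1', mul_inv_cancel_left, ht2, id]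

lemma leftCoframe_zero : leftCoframe E G 0 = ContinuousLinearMap.id ℝ E := by
  have := (eventually_leftFrame_comp_leftCoframe (E := E) (G := G)).self_of_nhds
  rwa [leftFrame_zero, ContinuousLinearMap.id_comp] at this

/-- Frame and coframe are mutually inverse and both equal the identity at the origin, so their
derivatives there are opposite. -/
lemma hasFDerivAt_leftCoframe :
    HasFDerivAt (leftCoframe E G) (-fderiv ℝ (leftFrame E G) 0) 0 := by
  have hL : HasFDerivAt (leftFrame E G) (fderiv ℝ (leftFrame E G) 0) 0 :=
    (contDiffAt_leftFrame.differentiableAt (by simp)).hasFDerivAt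
  have hQ : DifferentiableAt ℝ (fderiv ℝ (chartDiv E G)) 0 :=
    (contDiffAt_chartDiv.fderiv_right (m := 1) (by norm_cast)).differentiableAt (by simp)
  have hC : DifferentiableAt ℝ (leftCoframe E G) 0 := by
    have h1 : DifferentiableAt ℝ (fun s : E => fderiv ℝ (chartDiv E G) (s, s)) 0 :=
      DifferentiableAt.comp (0 : E) (g := fderiv ℝ (chartDiv E G)) (f := fun s : E => (s, s))
        hQ (differentiableAt_id.prodMk differentiableAt_id)
    exact h1.clm_comp (differentiableAt_const _)
  have hP := (hL.clm_comp hC.hasFDerivAt).unique ((hasFDerivAt_const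
    (ContinuousLinearMap.id ℝ E) (0 : E)).congr_of_eventuallyEq
      eventually_leftFrame_comp_leftCoframe)
  refine hC.hasFDerivAt.congr_fderiv ?_
  ext x y
  have := DFunLike.congr_fun (DFunLike.congr_fun hP x) y
  simp [leftFrame_zero, leftCoframe_zero] at this
  simp [eq_neg_of_add_eq_zero_left this]

/-- The Maurer-Cartan equation `d(c⁻¹dc) = -[c⁻¹dc, c⁻¹dc]`. -/
lemma maurerCartan {c : N → G} {θ : N → N →L[ℝ] E} {z₀ : N}
    (hθ : ∀ᶠ z in 𝓝 z₀, HasLogDerivAt c (θ z) z)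
    (hr : ContDiffAt ℝ 2 (fun z => (logC ((c z₀)⁻¹ * c z) : E)) z₀) :
    ∃ θ' : N →L[ℝ] N →L[ℝ] E, HasFDerivAt θ θ' z₀ ∧
      ∀ a b, θ' a b - θ' b a = -ad G (θ z₀ a) (θ z₀ b) := by
  have : IsTopologicalGroup G := topologicalGroup_of_lieGroup 𝓘(ℝ, E) ∞
  set r : N → E := fun z => logC ((c z₀)⁻¹ * c z) with hrdef
  have hr0 : r z₀ = 0 := by simp [hrdef]
  have hrc : Tendsto r (𝓝 z₀) (𝓝 0) := by simpa [hr0] using hr.continuousAt.tendsto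
  have hrd : ∀ᶠ z in 𝓝 z₀, DifferentiableAt ℝ r z := by
    filter_upwards [hr.eventually (by simp)] with z hz using hz.differentiableAt (by simp)
  have hev := eventually_eventually_nhds.2 (hθ.self_of_nhds.eventually_eq)
  -- Left translation by `c z₀` does not affect the form, so it is the pull-back by `r` of the
  -- coframe of the chart.
  have heq : ∀ᶠ z in 𝓝 z₀, θ z = (leftCoframe E G (r z)).comp (fderiv ℝ r z) := by
    filter_upwards [hθ, hrd, hev, hrc (eventually_hasFDerivAt_chartDiv (E := E) (G := G))]
      with z h1 h2 h3 h4
    have h4' : HasFDerivAt (fun t => chartDiv E G (r z, t)) (leftCoframe E G (r z)) (r z) := h4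
    refine h1.2.unique ((h4'.comp z h2.hasFDerivAt).congr_of_eventuallyEq ?_)
    filter_upwards [h3] with z' hz'
    have hz := h3.self_of_nhds
    simp only [Function.comp_apply, chartDiv]
    congr 1
    conv_lhs => rw [hz, hz']
    simp only [hrdef]
    group
  have h1 : HasFDerivAt (fun z => leftCoframe E G (r z))
      ((-fderiv ℝ (leftFrame E G) 0).comp (fderiv ℝ r z₀)) z₀ :=
    HasFDerivAt.comp z₀ (g := leftCoframe E G) (by rw [hr0]; exact hasFDerivAt_leftCoframe)
      (hrd.self_of_nhds).hasFDerivAt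
  have h2 : HasFDerivAt (fderiv ℝ r) (fderiv ℝ (fderiv ℝ r) z₀) z₀ :=
    ((hr.fderiv_right (m := 1) (by norm_num)).differentiableAt (by simp)).hasFDerivAt
  refine ⟨_, (h1.clm_comp h2).congr_of_eventuallyEq heq, fun a b => ?_⟩
  -- The second derivative of `r` is symmetric and drops out of the antisymmetrisation; only the
  -- derivative of the coframe survives.
  have hs : fderiv ℝ (fderiv ℝ r) z₀ a b = fderiv ℝ (fderiv ℝ r) z₀ b a :=
    (hr.isSymmSndFDerivAt (by simp)) a b
  rw [heq.self_of_nhds, ad_eq_fderiv_leftFrame]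
  simp [hr0, leftCoframe_zero, hs]
  abel

end LieCalculus

/-! ### Finite products of manifolds. -/

section PiManifold

variable {κ : Type*} [Fintype κ] {EF : κ → Type*} [∀ i, NormedAddCommGroup (EF i)]
  [∀ i, NormedSpace ℝ (EF i)] {HF : κ → Type*} [∀ i, TopologicalSpace (HF i)]
  (IF : ∀ i, ModelWithCorners ℝ (EF i) (HF i))
  {MF : κ → Type*} [∀ i, TopologicalSpace (MF i)] [∀ i, ChartedSpace (HF i) (MF i)]
  {EN : Type*} [NormedAddCommGroup EN] [NormedSpace ℝ EN]
  {HN : Type*} [TopologicalSpace HN] {IN : ModelWithCorners ℝ EN HN}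
  {N : Type*} [TopologicalSpace N] [ChartedSpace HN N]

instance boundaryless_pi [∀ i, (IF i).Boundaryless] : (ModelWithCorners.pi IF).Boundaryless := by
  constructor
  have : range (ModelWithCorners.pi IF) = range (Pi.map fun i => IF i) := rfl
  rw [this, Set.range_piMap]
  simp [ModelWithCorners.range_eq_univ]

/-- The charts of the product are products of charts, so a transition map is smooth because each
component is a transition map of one factor composed with a projection. -/
instance isManifold_pi {m : WithTop ℕ∞} [∀ i, IsManifold (IF i) m (MF i)] :
    IsManifold (ModelWithCorners.pi IF) m (∀ i, MF i) := by
  refine isManifold_of_contDiffOn _ _ _ ?_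
  rintro _ _ ⟨e, he, rfl⟩ ⟨e', he', rfl⟩
  rw [contDiffOn_pi]
  intro i
  have hc := (contDiffGroupoid m (IF i)).compatible (he i (mem_univ i)) (he' i (mem_univ i))
  rw [contDiffGroupoid, mem_groupoid_of_pregroupoid] at hc
  have h : ContDiffOn ℝ m (IF i ∘ ((e i).symm ≫ₕ e' i) ∘ (IF i).symm)
    ((IF i).symm ⁻¹' ((e i).symm ≫ₕ e' i).source ∩ range (IF i)) := hc.1
  refine h.comp (g := IF i ∘ ((e i).symm ≫ₕ e' i) ∘ (IF i).symm) (f := fun z : ∀ i, EF i => z i)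
    (ContinuousLinearMap.proj (R := ℝ) (φ := EF) i).contDiff.contDiffOn ?_
  rintro z ⟨⟨h1, h2⟩, ⟨y, rfl⟩⟩
  exact ⟨⟨h1 i (mem_univ i), h2 i (mem_univ i)⟩, ⟨y i, rfl⟩⟩

variable {IF}

lemma contMDiffAt_pi_of {m : WithTop ℕ∞} {f : N → ∀ i, MF i} {x : N}
    (h : ∀ i, ContMDiffAt IN (IF i) m (fun n => f n i) x) :
    ContMDiffAt IN (ModelWithCorners.pi IF) m f x := by
  rw [contMDiffAt_iff]
  refine ⟨continuousAt_pi.2 fun i => (h i).continuousAt, contDiffWithinAt_pi.2 fun i => ?_⟩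
  exact (contMDiffAt_iff.1 (h i)).2

lemma hasMFDerivAt_pi_of {f : N → ∀ i, MF i} {x : N}
    {f' : ∀ i, TangentSpace IN x →L[ℝ] TangentSpace (IF i) (f x i)}
    (h : ∀ i, HasMFDerivAt IN (IF i) (fun n => f n i) x (f' i)) :
    HasMFDerivAt IN (ModelWithCorners.pi IF) f x
      (ContinuousLinearMap.pi (fun i => (f' i : EN →L[ℝ] EF i)) : EN →L[ℝ] (∀ i, EF i)) := by
  refine ⟨continuousAt_pi.2 fun i => (h i).continuousAt, ?_⟩
  exact hasFDerivWithinAt_pi.2 fun i => (h i).2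

lemma hasMFDerivAt_apply (p : ∀ i, MF i) (i : κ) :
    HasMFDerivAt (ModelWithCorners.pi IF) (IF i) (fun q : ∀ i, MF i => q i) p
      (ContinuousLinearMap.proj i : (∀ i, EF i) →L[ℝ] EF i) := by
  refine ⟨continuousAt_apply i p, ?_⟩
  have h1 : HasFDerivWithinAt (fun z : ∀ i, EF i => z i)
      (ContinuousLinearMap.proj i : (∀ i, EF i) →L[ℝ] EF i) (range (ModelWithCorners.pi IF))
      (extChartAt (ModelWithCorners.pi IF) p p) :=
    (ContinuousLinearMap.proj i : (∀ i, EF i) →L[ℝ] EF i).hasFDerivAt.hasFDerivWithinAt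
  refine h1.congr_of_eventuallyEq ?_ ?_
  · filter_upwards [extChartAt_target_mem_nhdsWithin (I := ModelWithCorners.pi IF) p] with z hz
    exact congrFun ((extChartAt (ModelWithCorners.pi IF) p).right_inv hz) i
  · simp only [writtenInExtChartAt, Function.comp_apply, extChartAt_to_inv]
    rfl

lemma contMDiff_apply_pi {m : WithTop ℕ∞} (i : κ) :
    ContMDiff (ModelWithCorners.pi IF) (IF i) m (fun q : ∀ i, MF i => q i) := by
  intro p
  rw [contMDiffAt_iff]
  refine ⟨continuousAt_apply i p, ?_⟩
  have h1 : ContDiffWithinAt ℝ m (fun z : ∀ i, EF i => z i)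
      (range (ModelWithCorners.pi IF)) (extChartAt (ModelWithCorners.pi IF) p p) :=
    (ContinuousLinearMap.proj (R := ℝ) (φ := EF) i).contDiff.contDiffWithinAt
  refine h1.congr_of_eventuallyEq ?_ ?_
  · filter_upwards [extChartAt_target_mem_nhdsWithin (I := ModelWithCorners.pi IF) p] with z hz
    exact congrFun ((extChartAt (ModelWithCorners.pi IF) p).right_inv hz) i
  · simp only [Function.comp_apply, extChartAt_to_inv]
    rfl

end PiManifold

/-! ### Smooth functions with a prescribed differential at a point. -/

section Separation

variable {EM : Type*} [NormedAddCommGroup EM] [NormedSpace ℝ EM] [FiniteDimensional ℝ EM]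
  {HM : Type*} [TopologicalSpace HM] {I : ModelWithCorners ℝ EM HM}
  {M : Type*} [TopologicalSpace M] [ChartedSpace HM M] [IsManifold I ∞ M] [T2Space M]

/-- Every covector is the differential of a smooth function. -/
lemma exists_contMDiff_hasMFDerivAt (p : M) (l : EM →L[ℝ] ℝ) :
    ∃ f : M → ℝ, ContMDiff I 𝓘(ℝ, ℝ) ∞ f ∧ HasMFDerivAt I 𝓘(ℝ, ℝ) f p l := by
  -- The linear form in the chart at `p`, cut off by a bump function that equals `1` near `p`.
  obtain ⟨b⟩ : Nonempty (SmoothBumpFunction I p) := inferInstance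
  refine ⟨fun q => b q • l (extChartAt I p q), b.contMDiff_smul ?_, ?_⟩
  · exact l.contDiff.contMDiff.comp_contMDiffOn contMDiffOn_extChartAt
  · have hc : ContMDiff I 𝓘(ℝ, ℝ) ∞ (fun q => b q • l (extChartAt I p q)) :=
      b.contMDiff_smul (l.contDiff.contMDiff.comp_contMDiffOn contMDiffOn_extChartAt)
    refine ⟨hc.continuous.continuousAt, ?_⟩
    refine (l.hasFDerivAt.hasFDerivWithinAt).congr_of_eventuallyEq ?_ ?_
    · have h1 := (continuousAt_extChartAt_symm (I := I) p).tendsto.mono_left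
        (nhdsWithin_le_nhds (s := range I))
      rw [extChartAt_to_inv] at h1
      filter_upwards [extChartAt_target_mem_nhdsWithin (I := I) p, h1 b.eventuallyEq_one]
        with z hz hb
      have hb' : b ((extChartAt I p).symm z) = 1 := hb
      simp only [writtenInExtChartAt, extChartAt_model_space_eq_id, PartialEquiv.refl_coe,
        Function.comp_apply, id, (extChartAt I p).right_inv hz, hb', one_smul]
    · simp only [writtenInExtChartAt, extChartAt_model_space_eq_id, PartialEquiv.refl_coe,
        Function.comp_apply, id, extChartAt_to_inv, b.eq_one, one_smul]

end Separation

/-! ### Trivialised tangent and cotangent calculus on `H^{n+2g}`. -/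

section PhaseCalculus

variable {E : Type*} [NormedAddCommGroup E] [NormedSpace ℝ E] [FiniteDimensional ℝ E]
  {G : Type*} [TopologicalSpace G] [ChartedSpace E G] [Group G]
  {ι : Type*} [Fintype ι] (J : Module.Basis ι ℝ E) {n g : ℕ}
  {N : Type*} [NormedAddCommGroup N] [NormedSpace ℝ N]
  [LieGroup 𝓘(ℝ, E) ∞ G]

/-! ### Left-trivialised tangent vectors and covectors on the phase space -/

/-- The differential at `1` of left multiplication by `u`. -/
def leftMulD (u : G) : E →L[ℝ] E := (mfderiv 𝓘(ℝ, E) 𝓘(ℝ, E) (fun v : G => u * v) 1 :)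

variable (E n g) in
/-- Left-trivialised tangent vectors of `H^{n+2g}`. -/
abbrev Vec : Type _ := Loop n g → E × (E →L[ℝ] ℝ)

variable (E n g) in
/-- Left-trivialised covectors of `H^{n+2g}`. -/
abbrev Cov : Type _ := Loop n g → (E →L[ℝ] ℝ) × E

/-- The left trivialisation of the tangent space at `p`. -/
def triv (p : Phase E G n g) : Vec E n g →L[ℝ] Vec E n g :=
  ContinuousLinearMap.pi fun X =>
    ((leftMulD (p X).1).comp ((ContinuousLinearMap.fst ℝ E (E →L[ℝ] ℝ)).comp
      (ContinuousLinearMap.proj X))).prod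
    ((ContinuousLinearMap.snd ℝ E (E →L[ℝ] ℝ)).comp (ContinuousLinearMap.proj X))

/-- The differential at `u` of left division by `u`. -/
def leftDivD (u : G) : E →L[ℝ] E := (mfderiv 𝓘(ℝ, E) 𝓘(ℝ, E) (fun v : G => u⁻¹ * v) u :)

lemma leftDivD_comp_leftMulD (u : G) :
    (leftDivD u : E →L[ℝ] E).comp (leftMulD u) = ContinuousLinearMap.id ℝ E := by
  have key : ∀ y : G, y = u → HasMFDerivAt 𝓘(ℝ, E) 𝓘(ℝ, E) (fun v : G => u⁻¹ * v) y
      (leftDivD u : E →L[ℝ] E) := by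
    rintro y rfl
    exact ((contMDiff_mul_left' y⁻¹).mdifferentiableAt (by simp)).hasMFDerivAt
  have hmul : HasMFDerivAt 𝓘(ℝ, E) 𝓘(ℝ, E) (fun v : G => u * v) 1 (leftMulD u : E →L[ℝ] E) :=
    ((contMDiff_mul_left' u).mdifferentiableAt (by simp)).hasMFDerivAt
  have hc := HasMFDerivAt.comp (1 : G) (key (u * 1) (mul_one u)) hmul
  have he : (fun v : G => u⁻¹ * v) ∘ (fun v : G => u * v) = id := by ext v; simp
  rw [he] at hc
  exact hasMFDerivAt_unique hc (hasMFDerivAt_id (1 : G))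

/-- A one-sided inverse of an endomorphism of a finite-dimensional space is two-sided. -/
lemma leftMulD_comp_leftDivD (u : G) :
    (leftMulD u : E →L[ℝ] E).comp (leftDivD u) = ContinuousLinearMap.id ℝ E := by
  have h := leftDivD_comp_leftMulD (E := E) u
  have h2 : (leftDivD u : E →L[ℝ] E).toLinearMap ∘ₗ (leftMulD u : E →L[ℝ] E).toLinearMap
      = LinearMap.id := by
    ext x; exact DFunLike.congr_fun h x
  rw [LinearMap.comp_eq_id_comm] at h2
  ext x
  exact DFunLike.congr_fun h2 x

/-- The inverse of the left trivialisation. -/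
def trivInv (p : Phase E G n g) : Vec E n g →L[ℝ] Vec E n g :=
  ContinuousLinearMap.pi fun X =>
    ((leftDivD (p X).1).comp ((ContinuousLinearMap.fst ℝ E (E →L[ℝ] ℝ)).comp
      (ContinuousLinearMap.proj X))).prod
    ((ContinuousLinearMap.snd ℝ E (E →L[ℝ] ℝ)).comp (ContinuousLinearMap.proj X))

@[simp] lemma triv_trivInv (p : Phase E G n g) (v : Vec E n g) : triv p (trivInv p v) = v := by
  ext1 X
  have := DFunLike.congr_fun (leftMulD_comp_leftDivD (E := E) (p X).1) (v X).1
  exact Prod.ext this rfl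

@[simp] lemma trivInv_triv (p : Phase E G n g) (v : Vec E n g) : trivInv p (triv p v) = v := by
  ext1 X
  have := DFunLike.congr_fun (leftDivD_comp_leftMulD (E := E) (p X).1) (v X).1
  exact Prod.ext this rfl

/-- `Φ` is differentiable at `n₀` with left-trivialised derivative `T`. -/
def HasPhaseDerivAt (Φ : N → Phase E G n g) (T : N →L[ℝ] Vec E n g) (n₀ : N) : Prop :=
  ∀ X, HasLogDerivAt (fun m => (Φ m X).1)
      ((ContinuousLinearMap.fst ℝ E (E →L[ℝ] ℝ)).comp ((ContinuousLinearMap.proj X).comp T)) n₀ ∧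
    HasFDerivAt (fun m => (Φ m X).2)
      ((ContinuousLinearMap.snd ℝ E (E →L[ℝ] ℝ)).comp ((ContinuousLinearMap.proj X).comp T)) n₀

lemma hasFDerivAt_extChartAt_mul_expC (u : G) :
    HasFDerivAt (fun x : E => extChartAt 𝓘(ℝ, E) u (u * expC G x)) (leftMulD u : E →L[ℝ] E) 0 := by
  have hM : IsManifold 𝓘(ℝ, E) 1 G := IsManifold.of_le (n := ∞) (by norm_cast)
  have key : ∀ y : G, y = u → HasMFDerivAt 𝓘(ℝ, E) 𝓘(ℝ, E) (extChartAt 𝓘(ℝ, E) u) y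
      (ContinuousLinearMap.id ℝ E) := by
    rintro y rfl
    have h := (mdifferentiableAt_extChartAt (I := 𝓘(ℝ, E)) (mem_chart_source E y)).hasMFDerivAt
    have h2 := mfderiv_extChartAt_self (E := E) y
    exact h2 ▸ h
  have hmul : HasMFDerivAt 𝓘(ℝ, E) 𝓘(ℝ, E) (fun v : G => u * v) 1
      (mfderiv 𝓘(ℝ, E) 𝓘(ℝ, E) (fun v : G => u * v) 1) :=
    ((contMDiff_mul_left' u).mdifferentiableAt (by simp)).hasMFDerivAt
  have hc := HasMFDerivAt.comp (1 : G) (key (u * 1) (mul_one u)) hmul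
  have h3 := hasFDerivAt_comp_expC hc.mdifferentiableAt
  rw [hc.mfderiv] at h3
  exact h3

lemma HasLogDerivAt.hasMFDerivAt {Φ : N → G} {T : N →L[ℝ] E} {n₀ : N}
    (h : HasLogDerivAt Φ T n₀) :
    HasMFDerivAt 𝓘(ℝ, N) 𝓘(ℝ, E) Φ n₀ ((leftMulD (Φ n₀)).comp T : N →L[ℝ] E) := by
  refine ⟨h.1, ?_⟩
  have := h.comp_hasFDerivAt (hasFDerivAt_extChartAt_mul_expC (Φ n₀))
  have h2 : HasFDerivWithinAt (extChartAt 𝓘(ℝ, E) (Φ n₀) ∘ Φ) _ (range 𝓘(ℝ, N)) n₀ :=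
    this.hasFDerivWithinAt
  exact h2

lemma HasPhaseDerivAt.hasMFDerivAt {Φ : N → Phase E G n g} {T : N →L[ℝ] Vec E n g} {n₀ : N}
    (h : HasPhaseDerivAt Φ T n₀) :
    HasMFDerivAt 𝓘(ℝ, N) (phaseModel E n g) Φ n₀ ((triv (Φ n₀)).comp T : N →L[ℝ] Vec E n g) := by
  have := hasMFDerivAt_pi_of (IF := fun _ : Loop n g => (𝓘(ℝ, E)).prod 𝓘(ℝ, E →L[ℝ] ℝ))
    (f := Φ) (x := n₀) fun X => (h X).1.hasMFDerivAt.prodMk (h X).2.hasMFDerivAt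
  exact this

/-- A local parametrisation of the phase space around `p`. -/
def phaseExp (p : Phase E G n g) (v : Vec E n g) : Phase E G n g :=
  fun X => ((p X).1 * expC G (v X).1, (p X).2 + (v X).2)

@[simp] lemma phaseExp_zero (p : Phase E G n g) : phaseExp p 0 = p := by
  ext1 X; simp [phaseExp]

lemma HasLogDerivAt.comp_clm {N' : Type*} [NormedAddCommGroup N'] [NormedSpace ℝ N']
    {Φ : N → G} {T : N →L[ℝ] E} {A : N' →L[ℝ] N} {n₀ : N'} (h : HasLogDerivAt Φ T (A n₀)) :
    HasLogDerivAt (fun m => Φ (A m)) (T.comp A) n₀ :=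
  ⟨ContinuousAt.comp (g := Φ) h.1 A.continuous.continuousAt,
    HasFDerivAt.comp n₀ h.2 A.hasFDerivAt⟩

lemma HasLogDerivAt.const_mul {Φ : N → G} {T : N →L[ℝ] E} {n₀ : N} (u : G)
    (h : HasLogDerivAt Φ T n₀) : HasLogDerivAt (fun m => u * Φ m) T n₀ := by
  have := (hasLogDerivAt_const (E := E) u n₀).mul h
  simpa using this

lemma HasLogDerivAt.mul_const {Φ : N → G} {T : N →L[ℝ] E} {n₀ : N} (u : G)
    (h : HasLogDerivAt Φ T n₀) :
    HasLogDerivAt (fun m => Φ m * u) ((Flower.Ad u⁻¹ : E →L[ℝ] E).comp T) n₀ := by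
  have := h.mul (hasLogDerivAt_const (E := E) u n₀)
  simpa using this

lemma hasPhaseDerivAt_phaseExp (p : Phase E G n g) :
    HasPhaseDerivAt (phaseExp p) (ContinuousLinearMap.id ℝ (Vec E n g)) 0 := by
  intro X
  constructor
  · have h := ((hasLogDerivAt_expC (E := E) (G := G)).const_mul (p X).1)
    exact HasLogDerivAt.comp_clm (n₀ := (0 : Vec E n g))
      (A := (ContinuousLinearMap.fst ℝ E (E →L[ℝ] ℝ)).comp (ContinuousLinearMap.proj X)) h
  · exact ((ContinuousLinearMap.snd ℝ E (E →L[ℝ] ℝ)).comp (ContinuousLinearMap.proj (R := ℝ)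
      (φ := fun _ : Loop n g => E × (E →L[ℝ] ℝ)) X)).hasFDerivAt.const_add (p X).2

lemma contMDiff_phase_fst (X : Loop n g) :
    ContMDiff (phaseModel E n g) 𝓘(ℝ, E) ∞ (fun p : Phase E G n g => (p X).1) :=
  contMDiff_fst.comp (contMDiff_apply_pi X)

lemma contMDiff_phase_snd (X : Loop n g) :
    ContMDiff (phaseModel E n g) 𝓘(ℝ, E →L[ℝ] ℝ) ∞ (fun p : Phase E G n g => (p X).2) :=
  contMDiff_snd.comp (contMDiff_apply_pi X)

lemma contMDiffAt_phase_of {EN : Type*} [NormedAddCommGroup EN] [NormedSpace ℝ EN]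
    {HN : Type*} [TopologicalSpace HN] {IN : ModelWithCorners ℝ EN HN}
    {M : Type*} [TopologicalSpace M] [ChartedSpace HN M] {Φ : M → Phase E G n g} {x : M}
    (h1 : ∀ X, ContMDiffAt IN 𝓘(ℝ, E) ∞ (fun m => (Φ m X).1) x)
    (h2 : ∀ X, ContMDiffAt IN 𝓘(ℝ, E →L[ℝ] ℝ) ∞ (fun m => (Φ m X).2) x) :
    ContMDiffAt IN (phaseModel E n g) ∞ Φ x :=
  contMDiffAt_pi_of fun X => (h1 X).prodMk (h2 X)

/-- Smoothness jointly in the base point and the increment is what makes the trivialised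
differential of a smooth function depend smoothly on the point. -/
lemma contMDiffAt_phaseExp (p : Phase E G n g) :
    ContMDiffAt ((phaseModel E n g).prod 𝓘(ℝ, Vec E n g)) (phaseModel E n g) ∞
      (Function.uncurry (phaseExp : Phase E G n g → Vec E n g → Phase E G n g)) (p, 0) := by
  have hv : ∀ X : Loop n g, ContMDiffAt ((phaseModel E n g).prod 𝓘(ℝ, Vec E n g))
      𝓘(ℝ, E × (E →L[ℝ] ℝ)) ∞ (fun q : Phase E G n g × Vec E n g => q.2 X) (p, 0) := fun X =>
    ((ContinuousLinearMap.proj (R := ℝ) (φ := fun _ : Loop n g => E × (E →L[ℝ] ℝ))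
      X).contDiff.contMDiff _).comp _ contMDiffAt_snd
  refine contMDiffAt_phase_of (fun X => ?_) (fun X => ?_)
  · refine ContMDiffAt.mul (((contMDiff_phase_fst X) _).comp _ contMDiffAt_fst) ?_
    exact ContMDiffAt.comp (p, (0 : Vec E n g)) (g := (expC G : E → G)) contMDiffAt_expC
      ((contDiff_fst.contMDiff _).comp _ (hv X))
  · exact ContMDiffAt.add (((contMDiff_phase_snd X) _).comp _ contMDiffAt_fst)
      ((contDiff_snd.contMDiff _).comp _ (hv X))

/-! ### The left-trivialised differential -/

/-- The left-trivialised differential of `f` at `p`. -/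
def dcov (f : Phase E G n g → ℝ) (p : Phase E G n g) : Cov E n g := fun X =>
  ((mfderiv 𝓘(ℝ, E) 𝓘(ℝ, ℝ) (fun v : G => slice f p X ((p X).1 * v, (p X).2)) 1 : E →L[ℝ] ℝ),
    gradAt J f p X)

/-- The pairing of covectors and vectors. -/
def pair (a : Cov E n g) : Vec E n g →L[ℝ] ℝ :=
  ∑ X, ((a X).1.comp ((ContinuousLinearMap.fst ℝ E (E →L[ℝ] ℝ)).comp (ContinuousLinearMap.proj X))
    + (ContinuousLinearMap.apply ℝ ℝ (a X).2).comp
      ((ContinuousLinearMap.snd ℝ E (E →L[ℝ] ℝ)).comp (ContinuousLinearMap.proj X)))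

lemma pair_apply (a : Cov E n g) (v : Vec E n g) :
    pair a v = ∑ X, ((a X).1 (v X).1 + (v X).2 (a X).2) := by
  simp [pair, sum_apply]

omit [LieGroup 𝓘(ℝ, E) ∞ G] in
-- Expanding `y` in the dual basis shows that the fibre gradient does not depend on the basis `J`.
lemma apply_fibGrad (φ : G × (E →L[ℝ] ℝ) → ℝ) (z : G × (E →L[ℝ] ℝ)) (y : E →L[ℝ] ℝ) :
    y (fibGrad J φ z) = fderiv ℝ (fun j : E →L[ℝ] ℝ => φ (z.1, j)) z.2 y := by
  have hy : y = ∑ a, y (J a) • dualP J a := by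
    ext x
    conv_lhs => rw [← J.sum_repr x]
    simp only [map_sum, map_smul]
    simp [dualP, mul_comm]
  conv_rhs => rw [hy]
  simp [fibGrad, mul_comm]

lemma hasPhaseDerivAt_update_fst (p : Phase E G n g) (X : Loop n g) :
    HasPhaseDerivAt (fun x : E => Function.update p X ((p X).1 * expC G x, (p X).2))
      ((ContinuousLinearMap.single ℝ (fun _ : Loop n g => E × (E →L[ℝ] ℝ)) X).comp
        (ContinuousLinearMap.inl ℝ E (E →L[ℝ] ℝ))) 0 := by
  intro Y
  by_cases h : Y = X
  · subst h
    simp only [Function.update_self]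
    exact ⟨((hasLogDerivAt_expC.const_mul (p Y).1)).congr_fderiv (by ext; simp),
      (hasFDerivAt_const _ _).congr_fderiv (by ext; simp)⟩
  · simp only [Function.update_of_ne h]
    exact ⟨(hasLogDerivAt_const _ _).congr_fderiv (by ext; simp [h]),
      (hasFDerivAt_const _ _).congr_fderiv (by ext; simp [h])⟩

lemma hasPhaseDerivAt_update_snd (p : Phase E G n g) (X : Loop n g) :
    HasPhaseDerivAt (fun y : E →L[ℝ] ℝ => Function.update p X ((p X).1, y))
      ((ContinuousLinearMap.single ℝ (fun _ : Loop n g => E × (E →L[ℝ] ℝ)) X).comp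
        (ContinuousLinearMap.inr ℝ E (E →L[ℝ] ℝ))) (p X).2 := by
  intro Y
  by_cases h : Y = X
  · subst h
    simp only [Function.update_self]
    exact ⟨(hasLogDerivAt_const _ _).congr_fderiv (by ext; simp),
      (hasFDerivAt_id _).congr_fderiv (by ext; simp)⟩
  · simp only [Function.update_of_ne h]
    exact ⟨(hasLogDerivAt_const _ _).congr_fderiv (by ext; simp [h]),
      (hasFDerivAt_const _ _).congr_fderiv (by ext; simp [h])⟩

lemma contMDiff_update_fst (p : Phase E G n g) (X : Loop n g) :
    ContMDiff 𝓘(ℝ, E) (phaseModel E n g) ∞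
      (fun v : G => Function.update p X ((p X).1 * v, (p X).2)) := by
  intro v
  refine contMDiffAt_phase_of (fun Y => ?_) (fun Y => ?_)
  · by_cases h : Y = X
    · subst h
      simp only [Function.update_self]
      exact contMDiff_mul_left' _ _
    · simp only [Function.update_of_ne h]
      exact contMDiffAt_const
  · by_cases h : Y = X
    · subst h
      simp only [Function.update_self]
      exact contMDiffAt_const
    · simp only [Function.update_of_ne h]
      exact contMDiffAt_const

lemma HasMFDerivAt.comp_hasPhaseDerivAt {W : Type*} [NormedAddCommGroup W] [NormedSpace ℝ W]
    {f : Phase E G n g → W} {Φ : N → Phase E G n g}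
    {T : N →L[ℝ] Vec E n g} {n₀ : N} {f' : Vec E n g →L[ℝ] W}
    (hf : HasMFDerivAt (phaseModel E n g) 𝓘(ℝ, W) f (Φ n₀) f')
    (h : HasPhaseDerivAt Φ T n₀) :
    HasFDerivAt (fun m => f (Φ m)) (f'.comp ((triv (Φ n₀)).comp T)) n₀ :=
  (HasMFDerivAt.comp n₀ hf h.hasMFDerivAt).hasFDerivAt

/-- A vector is the sum of its group and fibre components along the single factors, and on each of
these the total differential restricts to the partial derivative that enters `dcov`. -/
lemma pair_dcov {f : Phase E G n g → ℝ} {p : Phase E G n g} {f' : Vec E n g →L[ℝ] ℝ}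
    (hf : HasMFDerivAt (phaseModel E n g) 𝓘(ℝ, ℝ) f p f') :
    pair (dcov J f p) = f'.comp (triv p) := by
  have key : ∀ q, q = p → HasMFDerivAt (phaseModel E n g) 𝓘(ℝ, ℝ) f q f' := by
    rintro q rfl; exact hf
  ext v
  have hv : v = ∑ X, ((ContinuousLinearMap.single ℝ (fun _ : Loop n g => E × (E →L[ℝ] ℝ)) X)
      ((ContinuousLinearMap.inl ℝ E (E →L[ℝ] ℝ)) (v X).1)
      + (ContinuousLinearMap.single ℝ (fun _ : Loop n g => E × (E →L[ℝ] ℝ)) X)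
      ((ContinuousLinearMap.inr ℝ E (E →L[ℝ] ℝ)) (v X).2)) := by
    simp_rw [← map_add]
    ext1 Y
    simp [Finset.sum_apply, Pi.single_apply]
  conv_rhs => rw [hv]
  rw [pair_apply, map_sum]
  refine Finset.sum_congr rfl fun X _ => ?_
  rw [map_add]
  congr 1
  · have h1 := HasMFDerivAt.comp_hasPhaseDerivAt (key _ (by simp)) (hasPhaseDerivAt_update_fst p X)
    have hm : MDifferentiableAt 𝓘(ℝ, E) 𝓘(ℝ, ℝ)
        (fun v : G => slice f p X ((p X).1 * v, (p X).2)) 1 :=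
      MDifferentiableAt.comp (1 : G) (key _ (by simp)).mdifferentiableAt
        ((contMDiff_update_fst p X).mdifferentiableAt (by simp))
    have h2 : HasFDerivAt (fun x : E => slice f p X ((p X).1 * expC G x, (p X).2))
        (dcov J f p X).1 0 := hasFDerivAt_comp_expC hm
    have h3 := DFunLike.congr_fun (h2.unique h1) (v X).1
    simp only [expC_zero, mul_one, Prod.mk.eta, Function.update_eq_self] at h3
    exact h3
  · have h1 := HasMFDerivAt.comp_hasPhaseDerivAt (key _ (by simp)) (hasPhaseDerivAt_update_snd p X)
    have h3 := DFunLike.congr_fun h1.fderiv (v X).2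
    simp only [Prod.mk.eta, Function.update_eq_self] at h3
    exact (apply_fibGrad J _ _ _).trans h3

lemma hasFDerivAt_comp_phase {f : Phase E G n g → ℝ}
    (hf : ContMDiff (phaseModel E n g) 𝓘(ℝ, ℝ) ∞ f) {Φ : N → Phase E G n g}
    {T : N →L[ℝ] Vec E n g} {n₀ : N} (h : HasPhaseDerivAt Φ T n₀) :
    HasFDerivAt (fun m => f (Φ m)) ((pair (dcov J f (Φ n₀))).comp T) n₀ := by
  have h1 := (hf.mdifferentiableAt (x := Φ n₀) (by simp)).hasMFDerivAt
  have h2 := HasMFDerivAt.comp_hasPhaseDerivAt h1 h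
  rw [pair_dcov J h1]
  exact h2

lemma fderiv_comp_phaseExp {f : Phase E G n g → ℝ}
    (hf : ContMDiff (phaseModel E n g) 𝓘(ℝ, ℝ) ∞ f) (p : Phase E G n g) :
    fderiv ℝ (fun v => f (phaseExp p v)) 0 = pair (dcov J f p) := by
  have h := (hasFDerivAt_comp_phase J hf (hasPhaseDerivAt_phaseExp p)).fderiv
  simpa using h

lemma contMDiff_pair_dcov {f : Phase E G n g → ℝ}
    (hf : ContMDiff (phaseModel E n g) 𝓘(ℝ, ℝ) ∞ f) :
    ContMDiff (phaseModel E n g) 𝓘(ℝ, Vec E n g →L[ℝ] ℝ) ∞ (fun p => pair (dcov J f p)) := by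
  intro p
  simp_rw [← fderiv_comp_phaseExp J hf]
  refine contMDiffAt_fderiv_param (F := fun p v => f (phaseExp p v)) ?_
  exact (hf _).comp _ (contMDiffAt_phaseExp p)

lemma contMDiff_dcov_snd {f : Phase E G n g → ℝ}
    (hf : ContMDiff (phaseModel E n g) 𝓘(ℝ, ℝ) ∞ f) (X : Loop n g) :
    ContMDiff (phaseModel E n g) 𝓘(ℝ, E) ∞ (fun p => (dcov J f p X).2) := by
  have h : ∀ a, ContMDiff (phaseModel E n g) 𝓘(ℝ, ℝ) ∞ (fun p => pair (dcov J f p)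
      (Pi.single X (0, dualP J a))) := fun a =>
    ((ContinuousLinearMap.apply ℝ ℝ (Pi.single X ((0 : E), dualP J a) :
      Vec E n g)).contDiff.contMDiff).comp (contMDiff_pair_dcov J hf)
  have h2 : ContMDiff (phaseModel E n g) 𝓘(ℝ, E) ∞ (fun p => ∑ a, (pair (dcov J f p)
      (Pi.single X (0, dualP J a))) • J a) :=
    contMDiff_finsetSum fun a _ => (h a).smul contMDiff_const
  refine h2.congr fun p => ?_
  have h3 : ∀ a, pair (dcov J f p) (Pi.single X (0, dualP J a)) = J.coord a (dcov J f p X).2 := by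
    intro a
    rw [pair_apply, Finset.sum_eq_single X]
    · simp [dualP]
    · intro Y _ h; simp [h]
    · simp
  simp_rw [h3]
  exact (J.sum_repr _).symm

lemma pair_injective : Function.Injective (pair : Cov E n g → Vec E n g →L[ℝ] ℝ) := by
  intro a b hab
  ext1 X
  have h : ∀ z : E × (E →L[ℝ] ℝ), (a X).1 z.1 + z.2 (a X).2 = (b X).1 z.1 + z.2 (b X).2 := by
    intro z
    have := DFunLike.congr_fun hab (Pi.single X z)
    rw [pair_apply, pair_apply, Finset.sum_eq_single X, Finset.sum_eq_single X] at this
    · simpa using this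
    all_goals simp +contextual
  refine Prod.ext ?_ ?_
  · ext x; simpa using h (x, 0)
  · by_contra hne
    obtain ⟨y, hy⟩ := SeparatingDual.exists_separating_of_ne (R := ℝ) hne
    exact hy (by simpa using h (0, y))

lemma exists_pair_eq (l : Vec E n g →L[ℝ] ℝ) : ∃ a : Cov E n g, pair a = l := by
  obtain ⟨m, J⟩ : ∃ m, Nonempty (Module.Basis (Fin m) ℝ E) :=
    ⟨_, ⟨Module.finBasis ℝ E⟩⟩
  obtain ⟨J⟩ := J
  refine ⟨fun X => (l.comp ((ContinuousLinearMap.single ℝ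
    (fun _ : Loop n g => E × (E →L[ℝ] ℝ)) X).comp (ContinuousLinearMap.inl ℝ E (E →L[ℝ] ℝ))),
    ∑ a, l (Pi.single X (0, dualP J a)) • J a), ?_⟩
  ext v
  have hy : ∀ y : E →L[ℝ] ℝ, y = ∑ a, y (J a) • dualP J a := by
    intro y
    ext x
    conv_lhs => rw [← J.sum_repr x]
    simp only [map_sum, map_smul]
    simp [dualP, mul_comm]
  have h2 : ∀ X, (v X).2 (∑ a, l (Pi.single X (0, dualP J a)) • J a)
      = l ((ContinuousLinearMap.single ℝ (fun _ : Loop n g => E × (E →L[ℝ] ℝ)) X)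
      ((ContinuousLinearMap.inr ℝ E (E →L[ℝ] ℝ)) (v X).2)) := by
    intro X
    conv_rhs => rw [hy (v X).2]
    simp only [map_sum, map_smul]
    simp [mul_comm]
  rw [pair_apply]
  simp only [h2]
  simp only [ContinuousLinearMap.comp_apply, ← map_add, ← map_sum]
  congr 1
  ext1 Y
  simp [Finset.sum_apply, Pi.single_apply]

/-- Since every covector is the differential of a function, the tangent space of a leaf is the image
of the contraction by the bivector. -/
lemma exists_dcov_eq [T2Space G] (p : Phase E G n g) (a : Cov E n g) :
    ∃ f : Phase E G n g → ℝ, ContMDiff (phaseModel E n g) 𝓘(ℝ, ℝ) ∞ f ∧ dcov J f p = a := by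
  haveI : IsManifold 𝓘(ℝ, E) ∞ G := inferInstance
  obtain ⟨f, hf, hf'⟩ := exists_contMDiff_hasMFDerivAt (I := phaseModel E n g) p
    ((pair a).comp (trivInv p) : Vec E n g →L[ℝ] ℝ)
  refine ⟨f, hf, pair_injective ?_⟩
  rw [pair_dcov J hf']
  ext v
  simp

end PhaseCalculus

/-! ### Invariant vector fields and the bracket of `H*` on covectors. -/

section Brackets

variable {E : Type*} [NormedAddCommGroup E] [NormedSpace ℝ E] [FiniteDimensional ℝ E]
  {G : Type*} [TopologicalSpace G] [ChartedSpace E G] [Group G]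
  {ι : Type*} [Fintype ι] (J : Module.Basis ι ℝ E) {n g : ℕ}
  {N : Type*} [NormedAddCommGroup N] [NormedSpace ℝ N]
  [LieGroup 𝓘(ℝ, E) ∞ G]

lemma Ad_one_apply (x : E) : Ad (1 : G) x = x := by rw [Ad_one]; rfl

lemma Ad_mul_apply (u v : G) (x : E) : Ad (u * v) x = Ad u (Ad v x : E) := by
  rw [Ad_mul]; rfl

lemma Ad_inv_Ad (u : G) (x : E) : Ad u⁻¹ (Ad u x : E) = x := by
  rw [← Ad_mul_apply, inv_mul_cancel, Ad_one_apply]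

lemma Ad_Ad_inv (u : G) (x : E) : Ad u (Ad u⁻¹ x : E) = x := by
  rw [← Ad_mul_apply, mul_inv_cancel, Ad_one_apply]

lemma coAd_apply (u : G) (j : E →L[ℝ] ℝ) (x : E) : coAd u j x = j (Ad u x) := rfl

lemma lieBr_eq (x y : E) : lieBr G x y = ad G x y :=
  have : CompleteSpace E := FiniteDimensional.complete ℝ E
  lieBr_eq_ad x y

lemma HasLogDerivAt.coAd {Φ : N → G} {T : N →L[ℝ] E} {n₀ : N} (h : HasLogDerivAt Φ T n₀)
    {j : N → E →L[ℝ] ℝ} {S : N →L[ℝ] E →L[ℝ] ℝ} (hj : HasFDerivAt j S n₀) :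
    HasFDerivAt (fun m => Flower.coAd (Φ m) (j m))
      ((ContinuousLinearMap.compL ℝ E E ℝ (j n₀)).comp
        ((ContinuousLinearMap.compL ℝ E E E (Flower.Ad (Φ n₀))).comp ((ad G).comp T))
      + ((ContinuousLinearMap.compL ℝ E E ℝ).flip (Flower.Ad (Φ n₀))).comp S) n₀ :=
  hj.clm_comp h.Ad

lemma hasPhaseDerivAt_update (p : Phase E G n g) (X : Loop n g) {z : N → G × (E →L[ℝ] ℝ)}
    {T : N →L[ℝ] E} {S : N →L[ℝ] E →L[ℝ] ℝ} {n₀ : N}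
    (h1 : HasLogDerivAt (fun m => (z m).1) T n₀) (h2 : HasFDerivAt (fun m => (z m).2) S n₀) :
    HasPhaseDerivAt (fun m => Function.update p X (z m))
      ((ContinuousLinearMap.single ℝ (fun _ : Loop n g => E × (E →L[ℝ] ℝ)) X).comp
        (T.prod S)) n₀ := by
  intro Y
  by_cases h : Y = X
  · subst h
    simp only [Function.update_self]
    exact ⟨h1.congr_fderiv (by ext; simp), h2.congr_fderiv (by ext; simp)⟩
  · simp only [Function.update_of_ne h]
    exact ⟨(hasLogDerivAt_const _ _).congr_fderiv (by ext; simp [h]),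
      (hasFDerivAt_const _ _).congr_fderiv (by ext; simp [h])⟩

lemma pair_single (a : Cov E n g) (X : Loop n g) (z : E × (E →L[ℝ] ℝ)) :
    pair a (Pi.single X z) = (a X).1 z.1 + z.2 (a X).2 := by
  rw [pair_apply, Finset.sum_eq_single X]
  · simp
  · intro Y _ h; simp [h]
  · simp

/-- Derivatives of a function of one factor. -/
lemma hasFDerivAt_slice {f : Phase E G n g → ℝ}
    (hf : ContMDiff (phaseModel E n g) 𝓘(ℝ, ℝ) ∞ f) (p : Phase E G n g) (X : Loop n g)
    {z : N → G × (E →L[ℝ] ℝ)} {T : N →L[ℝ] E} {S : N →L[ℝ] E →L[ℝ] ℝ} {n₀ : N}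
    (h0 : z n₀ = p X)
    (h1 : HasLogDerivAt (fun m => (z m).1) T n₀) (h2 : HasFDerivAt (fun m => (z m).2) S n₀) :
    HasFDerivAt (fun m => slice f p X (z m))
      ((dcov J f p X).1.comp T + (ContinuousLinearMap.apply ℝ ℝ (dcov J f p X).2).comp S) n₀ := by
  have h := hasFDerivAt_comp_phase J hf (hasPhaseDerivAt_update p X h1 h2)
  rw [h0, Function.update_eq_self] at h
  refine h.congr_fderiv ?_
  ext x
  have := pair_single (dcov J f p) X (T x, S x)
  simpa using this

lemma mdifferentiableAt_slice {f : Phase E G n g → ℝ}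
    (hf : ContMDiff (phaseModel E n g) 𝓘(ℝ, ℝ) ∞ f) (p : Phase E G n g) (X : Loop n g)
    {z : G → G × (E →L[ℝ] ℝ)} (h1 : ContMDiff 𝓘(ℝ, E) 𝓘(ℝ, E) ∞ fun v => (z v).1)
    (h2 : ContMDiff 𝓘(ℝ, E) 𝓘(ℝ, E →L[ℝ] ℝ) ∞ fun v => (z v).2) (v : G) :
    MDifferentiableAt 𝓘(ℝ, E) 𝓘(ℝ, ℝ) (fun v => slice f p X (z v)) v := by
  have : ContMDiff 𝓘(ℝ, E) (phaseModel E n g) ∞ (fun v : G => Function.update p X (z v)) := by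
    intro v
    refine contMDiffAt_phase_of (fun Y => ?_) (fun Y => ?_)
    · by_cases h : Y = X
      · subst h
        simp only [Function.update_self]
        exact h1 _
      · simp only [Function.update_of_ne h]
        exact contMDiffAt_const
    · by_cases h : Y = X
      · subst h
        simp only [Function.update_self]
        exact h2 _
      · simp only [Function.update_of_ne h]
        exact contMDiffAt_const
  exact (hf.comp this).mdifferentiableAt (by simp)

lemma mfderiv_one_apply {k : G → ℝ} {k' : E →L[ℝ] ℝ}
    (hk : MDifferentiableAt 𝓘(ℝ, E) 𝓘(ℝ, ℝ) k 1)
    (h : HasFDerivAt (fun x : E => k (expC G x)) k' 0) (ξ : E) :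
    (mfderiv 𝓘(ℝ, E) 𝓘(ℝ, ℝ) k 1 : E →L[ℝ] ℝ) ξ = k' ξ := by
  let k₁ : E →L[ℝ] ℝ := mfderiv 𝓘(ℝ, E) 𝓘(ℝ, ℝ) k 1
  have h3 : HasFDerivAt (fun x : E => k (expC G x)) k₁ 0 := hasFDerivAt_comp_expC hk
  exact DFunLike.congr_fun (h3.unique h) ξ

/-- `e^{-tξ} u = u e^{-t Ad(u⁻¹) ξ}`. -/
lemma leftDAt_eq {f : Phase E G n g → ℝ}
    (hf : ContMDiff (phaseModel E n g) 𝓘(ℝ, ℝ) ∞ f) (p : Phase E G n g) (X : Loop n g) (ξ : E) :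
    leftDAt X ξ f p = -(dcov J f p X).1 (Ad (p X).1⁻¹ ξ) := by
  have h1 := (hasLogDerivAt_expC (E := E) (G := G)).inv.mul_const (p X).1
  have h := hasFDerivAt_slice J hf p X (z := fun x : E => ((expC G x)⁻¹ * (p X).1, (p X).2))
    (by simp) h1 (hasFDerivAt_const _ _)
  have hm : MDifferentiableAt 𝓘(ℝ, E) 𝓘(ℝ, ℝ)
      (fun v : G => slice f p X (v⁻¹ * (p X).1, (p X).2)) 1 :=
    mdifferentiableAt_slice hf p X (z := fun v => (v⁻¹ * (p X).1, (p X).2))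
      (contMDiff_id.inv.mul contMDiff_const) contMDiff_const 1
  refine (mfderiv_one_apply hm h ξ).trans ?_
  simp [Ad_one]
  rfl

lemma rightDAt_eq (f : Phase E G n g → ℝ) (p : Phase E G n g) (X : Loop n g) (ξ : E) :
    rightDAt X ξ f p = (dcov J f p X).1 ξ := rfl

lemma gradAt_eq (f : Phase E G n g → ℝ) (p : Phase E G n g) (X : Loop n g) :
    gradAt J f p X = (dcov J f p X).2 := rfl

/-- The parametrisation is adapted to left multiplication: by the formula below, elements of `G`
acting from the left fix `j`, whereas from the right they also act on `j` by `Ad*`. This is the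
source of the additional term in `vecJR_slice`. -/
lemma ofH_toH_mul (z : G × (E →L[ℝ] ℝ)) (v : G) (c : E →L[ℝ] ℝ) :
    ofH (toH z * mkH v c) = (z.1 * v, coAd v z.2 - coAd v c) := by
  refine Prod.ext rfl ?_
  change -coAd (z.1 * v) (-coAd z.1⁻¹ z.2 + coAd z.1⁻¹ c) = _
  ext x
  simp [coAd_apply, Ad_mul_apply, Ad_inv_Ad]
  ring

lemma ofH_mul_toH (z : G × (E →L[ℝ] ℝ)) (v : G) (c : E →L[ℝ] ℝ) :
    ofH (mkH v c * toH z) = (v * z.1, z.2 - coAd (v * z.1) c) := by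
  refine Prod.ext rfl ?_
  change -coAd (v * z.1) (c + coAd v⁻¹ (-coAd z.1⁻¹ z.2)) = _
  ext x
  simp [coAd_apply, Ad_mul_apply, Ad_inv_Ad]
  ring

lemma sum_coord_mul (L : E →ₗ[ℝ] ℝ) (x : E) : ∑ a, dualP J a x * L (J a) = L x := by
  conv_rhs => rw [← J.sum_repr x]
  simp only [map_sum, map_smul]
  simp [dualP]

lemma vecPR_slice {f : Phase E G n g → ℝ}
    (hf : ContMDiff (phaseModel E n g) 𝓘(ℝ, ℝ) ∞ f) (p : Phase E G n g) (X : Loop n g)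
    (c : E →L[ℝ] ℝ) : vecPR c (slice f p X) (p X) = -c (dcov J f p X).2 := by
  have h := hasFDerivAt_slice J hf p X
    (z := fun t : ℝ => ofH (toH (p X) * mkH 1 (t • c))) (n₀ := (0 : ℝ))
    (T := 0) (S := -(ContinuousLinearMap.id ℝ ℝ).smulRight c)
    (by simp [ofH_toH_mul, coAd_one]) (by
      simp only [ofH_toH_mul]
      exact hasLogDerivAt_const _ _) (by
      simp only [ofH_toH_mul, coAd_one]
      exact (((hasFDerivAt_id (0 : ℝ)).smul_const c)).const_sub (p X).2)
  refine h.hasDerivAt.deriv.trans ?_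
  simp

lemma vecPL_slice {f : Phase E G n g → ℝ}
    (hf : ContMDiff (phaseModel E n g) 𝓘(ℝ, ℝ) ∞ f) (p : Phase E G n g) (X : Loop n g)
    (c : E →L[ℝ] ℝ) : vecPL c (slice f p X) (p X) = c (Ad (p X).1 (dcov J f p X).2) := by
  have h := hasFDerivAt_slice J hf p X
    (z := fun t : ℝ => ofH (mkH 1 (-(t • c)) * toH (p X))) (n₀ := (0 : ℝ))
    (T := 0) (S := (ContinuousLinearMap.id ℝ ℝ).smulRight (coAd (p X).1 c))
    (by
      simp only [ofH_mul_toH, one_mul, zero_smul, neg_zero]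
      refine Prod.ext rfl ?_
      ext x; simp [coAd_apply]) (by
      simp only [ofH_mul_toH]
      exact hasLogDerivAt_const _ _) (by
      have h2 := ((hasFDerivAt_id (𝕜 := ℝ) (0 : ℝ)).smul_const (coAd (p X).1 c)).const_add (p X).2
      refine h2.congr_of_eventuallyEq (Eventually.of_forall fun t => ?_)
      ext x
      simp [ofH_mul_toH, coAd_apply])
  refine h.hasDerivAt.deriv.trans ?_
  simp [coAd_apply]

lemma vecJR_slice {f : Phase E G n g → ℝ}
    (hf : ContMDiff (phaseModel E n g) 𝓘(ℝ, ℝ) ∞ f) (p : Phase E G n g) (X : Loop n g)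
    (ξ : E) : vecJR ξ (slice f p X) (p X)
      = (dcov J f p X).1 ξ + (p X).2 (ad G ξ (dcov J f p X).2) := by
  have h0 : (fun v : G => slice f p X (ofH (toH (p X) * mkH v 0)))
      = fun v => slice f p X ((p X).1 * v, coAd v (p X).2) := by
    funext v
    rw [ofH_toH_mul]
    congr 2
    ext x; simp [coAd_apply]
  have h1 : vecJR ξ (slice f p X) (p X) = (mfderiv 𝓘(ℝ, E) 𝓘(ℝ, ℝ)
      (fun v : G => slice f p X ((p X).1 * v, coAd v (p X).2)) 1 : E →L[ℝ] ℝ) ξ :=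
    congrArg (fun k : G → ℝ => (mfderiv 𝓘(ℝ, E) 𝓘(ℝ, ℝ) k 1 : E →L[ℝ] ℝ) ξ) h0
  refine h1.trans ?_
  have he := hasLogDerivAt_expC (E := E) (G := G)
  have h := hasFDerivAt_slice J hf p X
    (z := fun x : E => ((p X).1 * expC G x, coAd (expC G x) (p X).2)) (n₀ := (0 : E))
    (by simp [coAd_one]) (he.const_mul (p X).1) (he.coAd (hasFDerivAt_const (p X).2 0))
  have hm : MDifferentiableAt 𝓘(ℝ, E) 𝓘(ℝ, ℝ)
      (fun v : G => slice f p X ((p X).1 * v, coAd v (p X).2)) 1 :=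
    mdifferentiableAt_slice hf p X (z := fun v => ((p X).1 * v, coAd v (p X).2))
      (contMDiff_mul_left' _)
      (((ContinuousLinearMap.compL ℝ E E ℝ (p X).2).contDiff.contMDiff).comp contMDiff_Ad) 1
  refine (mfderiv_one_apply hm h ξ).trans ?_
  simp [Ad_one]
  rfl

lemma vecJL_slice {f : Phase E G n g → ℝ}
    (hf : ContMDiff (phaseModel E n g) 𝓘(ℝ, ℝ) ∞ f) (p : Phase E G n g) (X : Loop n g)
    (ξ : E) : vecJL ξ (slice f p X) (p X) = -(dcov J f p X).1 (Ad (p X).1⁻¹ ξ) := by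
  rw [← leftDAt_eq J hf]
  have h0 : (fun v : G => slice f p X (ofH (mkH v⁻¹ 0 * toH (p X))))
      = fun v => slice f p X (v⁻¹ * (p X).1, (p X).2) := by
    funext v
    rw [ofH_mul_toH]
    congr 2
    ext x; simp [coAd_apply]
  exact congrArg (fun k : G → ℝ => (mfderiv 𝓘(ℝ, E) 𝓘(ℝ, ℝ) k 1 : E →L[ℝ] ℝ) ξ) h0

/-- The bracket of `H*` on covectors. -/
def punctureForm (z : G × (E →L[ℝ] ℝ)) (a b : (E →L[ℝ] ℝ) × E) : ℝ :=
  -z.2 (ad G a.2 b.2) - b.1 (a.2 - Ad z.1⁻¹ a.2) + a.1 (b.2 - Ad z.1⁻¹ b.2)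

/-- For covectors `(α, γ)` and `(β, δ)` the terms `P_L ∧ J^L` and `P_R ∧ J^R` each contribute `α(δ)
- β(γ)`, the second one also `-2 j([γ, δ])`, so that the factor ½ disappears; `P_R ∧ J^L` supplies
the terms with `Ad(u⁻¹)`. -/
lemma dualBracket_slice {f h : Phase E G n g → ℝ}
    (hf : ContMDiff (phaseModel E n g) 𝓘(ℝ, ℝ) ∞ f) (hh : ContMDiff (phaseModel E n g) 𝓘(ℝ, ℝ) ∞ h)
    (p : Phase E G n g) (X : Loop n g) :
    dualBracket J (slice f p X) (slice h p X) (p X)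
      = punctureForm (p X) (dcov J f p X) (dcov J h p X) := by
  unfold dualBracket punctureForm
  simp only [vecPR_slice J hf, vecPR_slice J hh, vecPL_slice J hf, vecPL_slice J hh,
    vecJR_slice J hf, vecJR_slice J hh, vecJL_slice J hf, vecJL_slice J hh]
  set u := (p X).1
  set j := (p X).2
  obtain ⟨α, γ⟩ := dcov J f p X
  obtain ⟨β, δ⟩ := dcov J h p X
  have key : ∀ (L : E →L[ℝ] ℝ) (x : E), ∑ a, dualP J a x * L (J a) = L x := fun L x =>
    sum_coord_mul J L.toLinearMap x
  have k1 := key (β.comp (Ad u⁻¹)) (Ad u γ)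
  have k2 := key (α.comp (Ad u⁻¹)) (Ad u δ)
  have k3 := key (β.comp (Ad u⁻¹)) γ
  have k4 := key (α.comp (Ad u⁻¹)) δ
  have k5 := key (β + j.comp ((ad G).flip δ)) γ
  have k6 := key (α + j.comp ((ad G).flip γ)) δ
  simp only [ContinuousLinearMap.comp_apply, add_apply,
    ContinuousLinearMap.flip_apply, Ad_inv_Ad] at k1 k2 k3 k4 k5 k6
  have hs := ad_skew (G := G) δ γ
  rw [hs, map_neg] at k6
  simp only [map_sub]
  -- Collecting the six sums into one reduces the identity to a single index.
  have e : ∀ A B C D F I : ι → ℝ, (1 / 2 : ℝ) * ((-(∑ a, A a) + ∑ a, B a)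
      + (-(∑ a, C a) + ∑ a, D a)) + (∑ a, F a - ∑ a, I a)
      = ∑ a, ((1 / 2 : ℝ) * ((-A a + B a) + (-C a + D a)) + (F a - I a)) := by
    intro A B C D F I
    simp only [Finset.sum_add_distrib, Finset.sum_sub_distrib, Finset.sum_neg_distrib,
      Finset.mul_sum]
    simp only [← Finset.mul_sum, Finset.sum_add_distrib, Finset.sum_neg_distrib]
  trans (1 / 2 : ℝ) * ((-(β γ) + α δ)
      + (-(β γ + j (ad G γ δ)) + (α δ + -j (ad G γ δ)))) + (β (Ad u⁻¹ γ) - α (Ad u⁻¹ δ))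
  · rw [← k5, ← k6, ← k1, ← k2, ← k3, ← k4, e]
    refine Finset.sum_congr rfl fun a _ => ?_
    ring
  · ring

end Brackets

/-! ### The flower bivector: blocks and couplings. -/

section Sharp

variable {E : Type*} [NormedAddCommGroup E] [NormedSpace ℝ E] [FiniteDimensional ℝ E]
  {G : Type*} [TopologicalSpace G] [ChartedSpace E G] [Group G]
  {ι : Type*} [Fintype ι] (J : Module.Basis ι ℝ E) {n g : ℕ}
  {N : Type*} [NormedAddCommGroup N] [NormedSpace ℝ N]
  [LieGroup 𝓘(ℝ, E) ∞ G]

/-- The fundamental vector field of the diagonal action of `G`, by conjugation on the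
`G`-components. -/
def rho (p : Phase E G n g) (ζ : E) : Vec E n g := fun X =>
  (ζ - Ad (p X).1⁻¹ ζ, (p X).2.comp (ad G ζ))

/-- The pairing of a covector of the factor `X` with the fundamental vector fields. -/
def act (p : Phase E G n g) (a : Cov E n g) (X : Loop n g) : E →L[ℝ] ℝ :=
  (a X).1 - (a X).1.comp (Ad (p X).1⁻¹) + (p X).2.comp ((ad G).flip (a X).2)

lemma act_apply (p : Phase E G n g) (a : Cov E n g) (X : Loop n g) (ζ : E) :
    act p a X ζ = (a X).1 ζ - (a X).1 (Ad (p X).1⁻¹ ζ) + (p X).2 (ad G ζ (a X).2) := rfl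

/-- `(1 - Ad(u_X)) γ_X`. -/
def drift (p : Phase E G n g) (a : Cov E n g) (X : Loop n g) : E :=
  (a X).2 - Ad (p X).1 (a X).2

/-- The contraction of a covector with the Poisson bivector of punctures and handles that commute
with one another. -/
def locSharp (p : Phase E G n g) (a : Cov E n g) : Vec E n g
  | Sum.inl i =>
      (Ad (p (lM i)).1⁻¹ (a (lM i)).2 - (a (lM i)).2,
        -(p (lM i)).2.comp (ad G (a (lM i)).2) + (a (lM i)).1
          - (a (lM i)).1.comp (Ad (p (lM i)).1⁻¹))
  | Sum.inr (Sum.inl i) =>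
      (Ad (p (lA i)).1⁻¹ ((a (lA i)).2 + (a (lB i)).2) - (a (lA i)).2,
        -(p (lA i)).2.comp (ad G (a (lA i)).2) + (p (lB i)).2.comp ((ad G).flip (a (lB i)).2)
          + (a (lA i)).1 - (a (lA i)).1.comp (Ad (p (lA i)).1⁻¹)
          + (a (lB i)).1 - (a (lB i)).1.comp (Ad (p (lB i)).1⁻¹)
          + (a (lB i)).1.comp (Ad ((p (lB i)).1⁻¹ * (p (lA i)).1)))
  | Sum.inr (Sum.inr i) =>
      (Ad (p (lB i)).1⁻¹ ((a (lA i)).2 + (a (lB i)).2) - ((a (lA i)).2 + (a (lB i)).2)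
          - Ad ((p (lB i)).1⁻¹ * (p (lA i)).1) (a (lA i)).2,
        -(p (lB i)).2.comp (ad G (a (lB i)).2) - (p (lB i)).2.comp (ad G (a (lA i)).2)
          - (a (lA i)).1.comp (Ad (p (lA i)).1⁻¹)
          + (a (lB i)).1 - (a (lB i)).1.comp (Ad (p (lB i)).1⁻¹))

/-- `∑_{Y > X} act p a Y`. -/
def tailAct (p : Phase E G n g) (a : Cov E n g) (X : Loop n g) : E →L[ℝ] ℝ :=
  ∑ Y, if rank X < rank Y then act p a Y else 0

/-- `∑_{Y < X} drift p a Y`. -/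
def headDrift (p : Phase E G n g) (a : Cov E n g) (X : Loop n g) : E :=
  ∑ Y, if rank Y < rank X then drift p a Y else 0

/-- The contraction of a covector with the Poisson bivector of the flower algebra. -/
def flowerSharp (p : Phase E G n g) (a : Cov E n g) : Vec E n g := fun X =>
  locSharp p a X - rho p (headDrift p a X) X
    + (0, tailAct p a X - (tailAct p a X).comp (Ad (p X).1))

lemma act_eq_pair (p : Phase E G n g) (a : Cov E n g) (X : Loop n g) (ζ : E) :
    (a X).1 (rho p ζ X).1 + (rho p ζ X).2 (a X).2 = act p a X ζ := by
  simp [rho, act_apply]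

lemma tailAct_apply (p : Phase E G n g) (a : Cov E n g) (X : Loop n g) (ζ : E) :
    tailAct p a X ζ = ∑ Y, if rank X < rank Y then act p a Y ζ else 0 := by
  simp only [tailAct, sum_apply]
  refine Finset.sum_congr rfl fun Y _ => ?_
  split_ifs <;> rfl

/-- Head and tail terms are the two halves of one antisymmetric coupling between the drift of the
earlier factor and the action on the later one; exchanging the order of summation in the head term
brings both to the same pairs. -/
lemma pair_flowerSharp (p : Phase E G n g) (a b : Cov E n g) :
    pair b (flowerSharp p a) = pair b (locSharp p a)
      + ∑ X, ∑ Y, if rank X < rank Y then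
          act p a Y (drift p b X) - act p b Y (drift p a X) else 0 := by
  have h1 : ∀ X, (b X).1 (flowerSharp p a X).1 + (flowerSharp p a X).2 (b X).2
      = ((b X).1 (locSharp p a X).1 + (locSharp p a X).2 (b X).2)
        - act p b X (headDrift p a X) + tailAct p a X (drift p b X) := by
    intro X
    rw [← act_eq_pair]
    simp only [flowerSharp, Prod.fst_add, Prod.fst_sub, Prod.snd_add, Prod.snd_sub, map_add,
      map_sub, add_apply, sub_apply, ContinuousLinearMap.comp_apply, drift, map_zero]
    ring
  have h2 : ∑ X, act p b X (headDrift p a X)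
      = ∑ X, ∑ Y, if rank X < rank Y then act p b Y (drift p a X) else 0 := by
    rw [Finset.sum_comm]
    refine Finset.sum_congr rfl fun X _ => ?_
    rw [headDrift, map_sum]
    refine Finset.sum_congr rfl fun Y _ => ?_
    split_ifs <;> simp
  rw [pair_apply, pair_apply]
  simp only [h1, Finset.sum_add_distrib, Finset.sum_sub_distrib, h2, tailAct_apply]
  rw [sub_add, sub_eq_add_neg, ← Finset.sum_sub_distrib, ← Finset.sum_neg_distrib]
  congr 1
  refine Finset.sum_congr rfl fun X _ => ?_
  rw [← Finset.sum_sub_distrib, ← Finset.sum_neg_distrib]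
  refine Finset.sum_congr rfl fun Y _ => ?_
  split_ifs <;> simp

/-- The two factors of a handle are compared only jointly, because `locSharp` mixes them. -/
lemma sum_loop_congr {A : Type*} [AddCommMonoid A] {F F' : Loop n g → A}
    (h1 : ∀ i, F (lM i) = F' (lM i)) (h2 : ∀ i, F (lA i) + F (lB i) = F' (lA i) + F' (lB i)) :
    ∑ X, F X = ∑ X, F' X := by
  simp only [Fintype.sum_sum_type, ← Finset.sum_add_distrib]
  exact congrArg₂ _ (Finset.sum_congr rfl fun i _ => h1 i) (Finset.sum_congr rfl fun i _ => h2 i)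

lemma pair_locSharp_antisymm (p : Phase E G n g) (a b : Cov E n g) :
    pair b (locSharp p a) = -pair a (locSharp p b) := by
  rw [pair_apply, pair_apply, ← Finset.sum_neg_distrib]
  refine sum_loop_congr (fun i => ?_) (fun i => ?_)
  · have s := ad_skew (G := G) (a (lM i)).2 (b (lM i)).2
    simp only [locSharp, add_apply, sub_apply, neg_apply, ContinuousLinearMap.comp_apply, map_add,
      map_sub, s, map_neg]
    ring
  · have s := ad_skew (G := G) (a (lA i)).2 (b (lA i)).2
    have s' := ad_skew (G := G) (a (lB i)).2 (b (lB i)).2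
    simp only [locSharp, add_apply, sub_apply, neg_apply, ContinuousLinearMap.comp_apply, map_add,
      map_sub, s, s', map_neg, ContinuousLinearMap.flip_apply]
    ring

lemma pair_flowerSharp_antisymm (p : Phase E G n g) (a b : Cov E n g) :
    pair b (flowerSharp p a) = -pair a (flowerSharp p b) := by
  rw [pair_flowerSharp, pair_flowerSharp, pair_locSharp_antisymm, neg_add,
    ← Finset.sum_neg_distrib]
  congr 1
  refine Finset.sum_congr rfl fun X _ => ?_
  rw [← Finset.sum_neg_distrib]
  refine Finset.sum_congr rfl fun Y _ => ?_
  split_ifs <;> simp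

/-- Regroup by locality: everything inside one puncture or handle, with the tails taken out of
`flowerAction`, is the pairing with `locSharp`, and the rest is the coupling. -/
lemma flowerBracket_eq {f h : Phase E G n g → ℝ}
    (hf : ContMDiff (phaseModel E n g) 𝓘(ℝ, ℝ) ∞ f) (hh : ContMDiff (phaseModel E n g) 𝓘(ℝ, ℝ) ∞ h)
    (p : Phase E G n g) :
    flowerBracket J f h p = pair (dcov J h p) (flowerSharp p (dcov J f p)) := by
  rw [pair_flowerSharp]
  have ht : ∀ {k : Phase E G n g → ℝ} (_ : ContMDiff (phaseModel E n g) 𝓘(ℝ, ℝ) ∞ k) (X ξ),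
      tailD X ξ k p = ∑ Y, if rank X < rank Y then
        (dcov J k p Y).1 (ξ - Ad (p X).1 ξ) - (dcov J k p Y).1 (Ad (p Y).1⁻¹ (ξ - Ad (p X).1 ξ))
        else 0 := by
    intro k hk X ξ
    simp only [tailD, rightDAt_eq J, leftDAt_eq J hk, sub_eq_add_neg]
  have hl : (∑ X : Loop n g, -(p X).2 (lieBr G (gradAt J f p X) (gradAt J h p X)))
      + (∑ i : Fin g,
      (-(p (lB i)).2 (lieBr G (gradAt J f p (lA i)) (gradAt J h p (lB i)))
        + (p (lB i)).2 (lieBr G (gradAt J h p (lA i)) (gradAt J f p (lB i)))))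
      + (∑ X : Loop n g, ((flowerAction X (gradAt J f p X) h p + tailD X (gradAt J f p X) h p)
          - (flowerAction X (gradAt J h p X) f p + tailD X (gradAt J h p X) f p)))
      = pair (dcov J h p) (locSharp p (dcov J f p)) := by
    simp only [pair_apply, Fintype.sum_sum_type]
    simp only [gradAt_eq, lieBr_eq, flowerAction, rightDAt_eq J, leftDAt_eq J hf, leftDAt_eq J hh]
    set a := dcov J f p
    set b := dcov J h p
    have e : ∀ (A B : Fin n → ℝ) (C D F I K L M : Fin g → ℝ),
        (∀ i, A i + B i = (B i + A i)) → ∀ (R : Fin n → ℝ) (S T : Fin g → ℝ),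
        (∀ i, A i + B i = R i) → (∀ i, C i + D i + F i + I i + K i = S i + T i) →
        (∑ i, A i + (∑ i, C i + ∑ i, D i)) + ∑ i, F i + (∑ i, B i + (∑ i, I i + ∑ i, K i))
          = ∑ i, R i + (∑ i, S i + ∑ i, T i) := by
      intro A B C D F I K L M _ R S T h1 h2
      rw [← Finset.sum_add_distrib (f := S), ← Finset.sum_congr rfl fun i _ => h1 i,
        ← Finset.sum_congr rfl fun i _ => h2 i]
      simp only [Finset.sum_add_distrib]
      ring
    refine e _ _ _ _ _ _ _ (fun _ => 0) (fun _ => 0) (fun i => add_comm _ _) _ _ _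
      (fun i => ?_) (fun i => ?_)
    · simp only [locSharp, add_apply, sub_apply, neg_apply, ContinuousLinearMap.comp_apply, map_add,
        map_sub, map_neg]
      ring
    · simp only [locSharp, add_apply, sub_apply, neg_apply, ContinuousLinearMap.comp_apply, map_add,
        map_sub, map_neg, ContinuousLinearMap.flip_apply]
      ring
  rw [← hl]
  unfold flowerBracket
  -- Evaluated on the drift of X, the tail gives the group-derivative part of `act` and the bracket
  -- of the two momenta gives its `ad` part.
  have h3 : (∑ X : Loop n g, ∑ Y : Loop n g, if rank X < rank Y then
      flowerCross X Y (gradAt J f p X) (gradAt J h p Y) p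
        - flowerCross X Y (gradAt J h p X) (gradAt J f p Y) p else 0)
      = (∑ X, ∑ Y, if rank X < rank Y then
          act p (dcov J f p) Y (drift p (dcov J h p) X)
            - act p (dcov J h p) Y (drift p (dcov J f p) X) else 0)
        + ∑ X : Loop n g, (tailD X (gradAt J f p X) h p - tailD X (gradAt J h p X) f p) := by
    rw [← Finset.sum_add_distrib]
    refine Finset.sum_congr rfl fun X _ => ?_
    rw [ht hf, ht hh, ← Finset.sum_sub_distrib, ← Finset.sum_add_distrib]
    refine Finset.sum_congr rfl fun Y _ => ?_
    split_ifs
    · simp only [flowerCross, lieBr_eq, act_apply, drift, gradAt_eq]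
      ring
    · simp
  rw [h3]
  simp only [Finset.sum_add_distrib, Finset.sum_sub_distrib]
  ring

end Sharp

/-! ### Momentum maps of punctures, handles and terminal segments of them. -/

section Momentum

variable {E : Type*} [NormedAddCommGroup E] [NormedSpace ℝ E] [FiniteDimensional ℝ E]
  {G : Type*} [TopologicalSpace G] [ChartedSpace E G] [Group G]
  {ι : Type*} [Fintype ι] (J : Module.Basis ι ℝ E) {n g : ℕ}
  {N : Type*} [NormedAddCommGroup N] [NormedSpace ℝ N]
  [LieGroup 𝓘(ℝ, E) ∞ G]

lemma rank_lt (X : Loop n g) : rank X < n + g := by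
  rcases X with i | i | i <;> (have := i.2; simp only [rank]; omega)

/-- The number of punctures and handles above `X`. -/
def depth (X : Loop n g) : ℕ := n + g - 1 - rank X

lemma depth_lt (X : Loop n g) : depth X < n + g := by
  have := rank_lt X
  unfold depth
  omega

lemma rank_lt_rank_iff (X Y : Loop n g) : rank X < rank Y ↔ depth Y < depth X := by
  have := rank_lt X
  have := rank_lt Y
  unfold depth
  omega

/-- The holonomy of the puncture or handle with `k` punctures and handles above it. -/
def blockU (p : Phase E G n g) (k : ℕ) : G :=
  if h : k < g then uK p ⟨g - 1 - k, by omega⟩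
  else if h' : k < n + g then uM p ⟨n + g - 1 - k, by omega⟩ else 1

/-- The momentum of the puncture or handle with `k` punctures and handles above it. -/
def blockJ (p : Phase E G n g) (k : ℕ) : E →L[ℝ] ℝ :=
  if h : k < g then jH p ⟨g - 1 - k, by omega⟩
  else if h' : k < n + g then (p (lM ⟨n + g - 1 - k, by omega⟩)).2 else 0

/-- The total momentum of the topmost `k` punctures and handles. -/
def mom (p : Phase E G n g) : ℕ → (E →L[ℝ] ℝ)
  | 0 => 0
  | k + 1 => blockJ p k + coAd (blockU p k) (mom p k)

lemma sum_depth_eq_handle {A : Type*} [AddCommMonoid A] (i : Fin g) (F : Loop n g → A) :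
    (∑ X, if depth X = g - 1 - i.val then F X else 0) = F (lA i) + F (lB i) := by
  have h1 : ∀ j : Fin n, ¬ depth (lM j : Loop n g) = g - 1 - i.val := by
    intro j; simp only [depth, rank]; omega
  have h2 : ∀ j : Fin g, depth (lA j : Loop n g) = g - 1 - i.val ↔ j = i := by
    intro j; simp only [depth, rank, Fin.ext_iff]; omega
  have h3 : ∀ j : Fin g, depth (lB j : Loop n g) = g - 1 - i.val ↔ j = i := by
    intro j; simp only [depth, rank, Fin.ext_iff]; omega
  simp [Fintype.sum_sum_type, h1, h2, h3]

lemma sum_depth_eq_puncture {A : Type*} [AddCommMonoid A] (i : Fin n) (F : Loop n g → A) :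
    (∑ X, if depth X = n + g - 1 - i.val then F X else 0) = F (lM i) := by
  have h1 : ∀ j : Fin n, depth (lM j : Loop n g) = n + g - 1 - i.val ↔ j = i := by
    intro j; simp only [depth, rank, Fin.ext_iff]; omega
  have h2 : ∀ j : Fin g, ¬ depth (lA j : Loop n g) = n + g - 1 - i.val := by
    intro j; simp only [depth, rank]; omega
  have h3 : ∀ j : Fin g, ¬ depth (lB j : Loop n g) = n + g - 1 - i.val := by
    intro j; simp only [depth, rank]; omega
  simp [Fintype.sum_sum_type, h1, h2, h3]

/-- The properties of the derivatives `D` of the momentum and `θ` of the holonomy of a puncture or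
handle that make them a momentum map. -/
structure IsBlock (p : Phase E G n g) (k : ℕ) (u : G) (j : E →L[ℝ] ℝ)
    (D : Vec E n g →L[ℝ] E →L[ℝ] ℝ) (θ : Vec E n g →L[ℝ] E) : Prop where
  zero : ∀ v, (∀ X, depth X = k → v X = 0) → D v = 0 ∧ θ v = 0
  rho : ∀ ζ, D (rho p ζ) = j.comp (ad G ζ) ∧ Ad u (θ (rho p ζ)) = Ad u ζ - ζ
  tail : ∀ P : E →L[ℝ] ℝ, D (fun X => (0, P - P.comp (Ad (p X).1))) = P - P.comp (Ad u) ∧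
    θ (fun X => (0, P - P.comp (Ad (p X).1))) = 0
  loc : ∀ a, D (locSharp p a) = (∑ X, if depth X = k then act p a X else 0) ∧
    Ad u (θ (locSharp p a)) = ∑ X, if depth X = k then drift p a X else 0

lemma exists_isBlock_puncture (p : Phase E G n g) (i : Fin n) :
    ∃ D θ, HasFDerivAt (fun v => (phaseExp p v (lM i)).2) D 0 ∧
      HasLogDerivAt (fun v => (phaseExp p v (lM i)).1) θ 0 ∧
      IsBlock p (n + g - 1 - i.val) (p (lM i)).1 (p (lM i)).2 D θ := by
  have hp := hasPhaseDerivAt_phaseExp p (lM i)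
  refine ⟨_, _, hp.2, hp.1, ?_, ?_, ?_, ?_⟩
  · intro v hv
    have := hv (lM i) (by simp [depth, rank])
    simp [this]
  · intro ζ
    refine ⟨?_, ?_⟩ <;> simp [rho, map_sub, Ad_Ad_inv]
  · intro P
    simp
  · intro a
    rw [sum_depth_eq_puncture, sum_depth_eq_puncture]
    refine ⟨?_, ?_⟩
    · ext η
      have s := ad_skew (G := G) (a (lM i)).2 η
      simp only [ContinuousLinearMap.comp_apply, ContinuousLinearMap.id_apply,
        ContinuousLinearMap.proj_apply, ContinuousLinearMap.coe_snd', locSharp, add_apply,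
        sub_apply, neg_apply, s, act_apply, map_neg]
      ring
    · simp [locSharp, drift, Ad_Ad_inv]

/-- With `u_K` as holonomy and `j^H` as momentum a handle has the same four properties as a
puncture, so the induction on blocks need not distinguish the two. All four are read off from the
explicit derivatives below. -/
lemma exists_isBlock_handle (p : Phase E G n g) (i : Fin g) :
    ∃ D θ, HasFDerivAt (fun v => jH (phaseExp p v) i) D 0 ∧
      HasLogDerivAt (fun v => uK (phaseExp p v) i) θ 0 ∧
      IsBlock p (g - 1 - i.val) (uK p i) (jH p i) D θ := by
  obtain ⟨hA, hjA⟩ := hasPhaseDerivAt_phaseExp p (lA i)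
  obtain ⟨hB, hjB⟩ := hasPhaseDerivAt_phaseExp p (lB i)
  have hh := (hA.inv.mul hB.inv).mul hA
  have hK := ((hB.mul hA.inv).mul hB.inv).mul hA
  have hJ := (hjA.sub (hh.coAd hjA)).add ((hh.coAd hjB).sub ((hB.inv.mul hA).coAd hjB))
  obtain ⟨D, hD, hD'⟩ : ∃ D, HasFDerivAt (fun v => jH (phaseExp p v) i) D 0 ∧ D = _ :=
    ⟨_, hJ, rfl⟩
  obtain ⟨θ, hθ, hθ'⟩ : ∃ θ, HasLogDerivAt (fun v => uK (phaseExp p v) i) θ 0 ∧ θ = _ :=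
    ⟨_, hK, rfl⟩
  -- Applying `Ad (uK p i)` passes to the right logarithmic derivative of the holonomy, the form in
  -- which the block conditions are stated.
  have eθ : ∀ v, Ad (uK p i) (θ v) = Ad (p (lB i)).1 (v (lB i)).1 - Ad (p (lB i)).1 (v (lA i)).1
      - Ad (p (lB i)).1 (Ad (p (lA i)).1⁻¹ (v (lB i)).1 : E)
      + Ad (p (lB i)).1 (Ad (p (lA i)).1⁻¹
        (Ad (p (lB i)).1⁻¹ (Ad (p (lA i)).1 (v (lA i)).1 : E) : E) : E) := fun v => by
    rw [hθ']
    simp only [phaseExp_zero, add_apply, ContinuousLinearMap.comp_apply, neg_apply,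
      ContinuousLinearMap.id_apply, ContinuousLinearMap.proj_apply, ContinuousLinearMap.coe_fst',
      map_add, map_neg, inv_inv, uK, Ad_mul_apply, Ad_Ad_inv, Ad_inv_Ad]
    abel
  have eD : ∀ v η, D v η = (v (lA i)).2 η
      + ((v (lB i)).2 - (v (lA i)).2) (Ad (p (lA i)).1⁻¹
        (Ad (p (lB i)).1⁻¹ (Ad (p (lA i)).1 η : E) : E))
      - (v (lB i)).2 (Ad (p (lB i)).1⁻¹ (Ad (p (lA i)).1 η : E))
      + ((p (lB i)).2 - (p (lA i)).2) (ad G (-(v (lA i)).1 - Ad (p (lA i)).1⁻¹ (v (lB i)).1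
          + Ad (p (lA i)).1⁻¹ (Ad (p (lB i)).1⁻¹ (Ad (p (lA i)).1 (v (lA i)).1 : E) : E))
        (Ad (p (lA i)).1⁻¹ (Ad (p (lB i)).1⁻¹ (Ad (p (lA i)).1 η : E) : E)))
      - (p (lB i)).2 (ad G (-(v (lB i)).1 + Ad (p (lB i)).1⁻¹ (Ad (p (lA i)).1 (v (lA i)).1 : E))
        (Ad (p (lB i)).1⁻¹ (Ad (p (lA i)).1 η : E))) := fun v η => by
    rw [hD']
    simp only [phaseExp_zero, add_apply, sub_apply, ContinuousLinearMap.comp_apply, neg_apply,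
      ContinuousLinearMap.id_apply, ContinuousLinearMap.proj_apply, ContinuousLinearMap.coe_fst',
      ContinuousLinearMap.coe_snd', ContinuousLinearMap.compL_apply,
      ContinuousLinearMap.flip_apply, Ad_ad,
      map_add, map_neg, map_sub, inv_inv, uK, Ad_mul_apply, Ad_Ad_inv, Ad_inv_Ad]
    ring
  clear hA hB hjA hjB hh hK hJ hD' hθ'
  refine ⟨D, θ, hD, hθ, ?_, ?_, ?_, ?_⟩
  · intro v hv
    have h1 := hv (lA i) (by simp [depth, rank]; omega)
    have h2 := hv (lB i) (by simp [depth, rank]; omega)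
    have h3 := eθ v
    simp only [h1, h2, Prod.fst_zero, map_zero, neg_zero, add_zero] at h3
    refine ⟨?_, ?_⟩
    · ext η
      simp [eD, h1, h2]
    · rw [← Ad_inv_Ad (uK p i) (θ v), h3]; simp
  · intro ζ
    refine ⟨?_, ?_⟩
    · ext η
      simp [eD, rho, map_sub, Ad_Ad_inv, Ad_inv_Ad, Ad_mul_apply, jH, coAd_apply, Ad_ad]
      ring
    · rw [eθ]
      simp only [rho, map_sub, Ad_Ad_inv, Ad_inv_Ad, Ad_mul_apply, uK]
      abel
  · intro P
    refine ⟨?_, ?_⟩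
    · ext η
      simp [eD, map_sub, Ad_Ad_inv, Ad_inv_Ad, Ad_mul_apply, uK]
      ring
    · rw [← Ad_inv_Ad (uK p i) (θ _), eθ]
      simp
  · intro a
    rw [sum_depth_eq_handle, sum_depth_eq_handle]
    refine ⟨?_, ?_⟩
    · ext η
      simp only [eD, locSharp, act_apply, map_sub, map_add, map_neg, Ad_Ad_inv, Ad_inv_Ad,
        Ad_mul_apply, Ad_ad, add_apply, sub_apply, neg_apply, ContinuousLinearMap.comp_apply,
        ContinuousLinearMap.flip_apply]
      rw [ad_skew (Ad (p (lA i)).1⁻¹ (Ad (p (lB i)).1⁻¹ (Ad (p (lA i)).1 η : E) : E)) (a (lB i)).2,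
        ad_skew η (a (lA i)).2, map_neg, map_neg]
      ring
    · simp only [eθ, locSharp, drift, map_sub, map_add, map_neg, Ad_Ad_inv, Ad_inv_Ad, Ad_mul_apply]
      abel

lemma exists_isBlock (p : Phase E G n g) {k : ℕ} (hk : k < n + g) :
    ∃ D θ, HasFDerivAt (fun v => blockJ (phaseExp p v) k) D 0 ∧
      HasLogDerivAt (fun v => blockU (phaseExp p v) k) θ 0 ∧
      IsBlock p k (blockU p k) (blockJ p k) D θ := by
  by_cases h : k < g
  · have hi : g - 1 - (⟨g - 1 - k, by omega⟩ : Fin g).val = k := by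
      change g - 1 - (g - 1 - k) = k; omega
    have := exists_isBlock_handle p ⟨g - 1 - k, by omega⟩
    rw [hi] at this
    simpa only [blockJ, blockU, h, dif_pos] using this
  · have hi : n + g - 1 - (⟨n + g - 1 - k, by omega⟩ : Fin n).val = k := by
      change n + g - 1 - (n + g - 1 - k) = k; omega
    have := exists_isBlock_puncture p ⟨n + g - 1 - k, by omega⟩
    rw [hi] at this
    simpa only [blockJ, blockU, uM, h, hk, dif_pos, dif_neg, not_false_eq_true] using this

/-- The properties of the derivative `D` of the total momentum. -/
structure IsMom (p : Phase E G n g) (k : ℕ) (D : Vec E n g →L[ℝ] E →L[ℝ] ℝ) : Prop where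
  zero : ∀ v, (∀ X, depth X < k → v X = 0) → D v = 0
  rho : ∀ ζ, D (rho p ζ) = (mom p k).comp (ad G ζ)
  sharp : ∀ a : Cov E n g, (∀ X, ¬ depth X < k → a X = 0) →
    D (flowerSharp p a) = ∑ X, if depth X < k then act p a X else 0

lemma locSharp_congr (p : Phase E G n g) {a b : Cov E n g} {X : Loop n g}
    (h : ∀ Y, depth Y = depth X → a Y = b Y) : locSharp p a X = locSharp p b X := by
  rcases X with i | i | i
  · simp only [locSharp, h (lM i) rfl]
  · simp only [locSharp, h (lA i) rfl, h (lB i) rfl]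
  · simp only [locSharp, h (lA i) rfl, h (lB i) rfl]

lemma act_eq_zero (p : Phase E G n g) {a : Cov E n g} {X : Loop n g} (h : a X = 0) :
    act p a X = 0 := by
  ext ζ; simp [act_apply, h]

lemma drift_eq_zero (p : Phase E G n g) {a : Cov E n g} {X : Loop n g} (h : a X = 0) :
    drift p a X = 0 := by
  simp [drift, h]

lemma act_congr (p : Phase E G n g) {a b : Cov E n g} {X : Loop n g} (h : a X = b X) :
    act p a X = act p b X := by
  simp only [act, h]

lemma drift_congr (p : Phase E G n g) {a b : Cov E n g} {X : Loop n g} (h : a X = b X) :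
    drift p a X = drift p b X := by
  simp only [drift, h]

lemma rho_sub (p : Phase E G n g) (ζ η : E) : rho p (ζ - η) = rho p ζ - rho p η := by
  ext X : 1
  refine Prod.ext ?_ ?_
  · simp only [rho, map_sub, Pi.sub_apply, Prod.fst_sub]; abel
  · simp only [rho, map_sub, Pi.sub_apply, Prod.snd_sub, ContinuousLinearMap.comp_sub]

lemma rho_zero (p : Phase E G n g) : rho p 0 = 0 := by
  ext X : 1
  refine Prod.ext ?_ ?_ <;> simp [rho]

lemma tailAct_eq (p : Phase E G n g) (a : Cov E n g) (X : Loop n g) :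
    tailAct p a X = ∑ Y, if depth Y < depth X then act p a Y else 0 := by
  simp only [tailAct, rank_lt_rank_iff]

lemma headDrift_eq (p : Phase E G n g) (a : Cov E n g) (X : Loop n g) :
    headDrift p a X = ∑ Y, if depth X < depth Y then drift p a Y else 0 := by
  simp only [headDrift, rank_lt_rank_iff]

/-- The next momentum is `j_k + Ad*(u_k) mom_k`. Contracting a covector with the bivector varies
three things: `j_k`, the twist `u_k`, and `mom_k`. Each variation has an unwanted coupling term, and
these terms cancel in the sum. -/
lemma exists_isMom (p : Phase E G n g) {k : ℕ} (hk : k ≤ n + g) :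
    ∃ D, HasFDerivAt (fun v => mom (phaseExp p v) k) D 0 ∧ IsMom p k D := by
  induction k with
  | zero =>
    refine ⟨0, hasFDerivAt_const _ _, fun _ _ => rfl, fun ζ => ?_, fun a _ => ?_⟩
    · ext; simp [mom]
    · simp
  | succ k ih =>
    obtain ⟨D, hD, hM⟩ := ih (by omega)
    obtain ⟨B, θ, hB, hθ, hb⟩ := exists_isBlock p (k := k) (by omega)
    refine ⟨_, hB.add (hθ.coAd hD), fun v hv => ?_, fun ζ => ?_, fun a ha => ?_⟩
    · have h1 := hM.zero v fun X hX => hv X (by omega)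
      have h2 := hb.zero v fun X hX => hv X (by omega)
      simp [h1, h2]
    · ext η
      have h1 := (hb.rho ζ).2
      have h2 : (ad G) (Ad (blockU p k) (θ (rho p ζ)) : E) = _ := congrArg (ad G) h1
      simp [hM.rho, (hb.rho ζ).1, mom, coAd_apply, Ad_ad, h2]
    -- `P` is the action of `a` on the blocks later than `k`, `c` the drift of block `k`, and `a₂`
    -- the restriction of `a` to the later blocks.
    · set P : E →L[ℝ] ℝ := ∑ X, if depth X < k then act p a X else 0 with hP
      set c : E := ∑ X, if depth X = k then drift p a X else 0 with hc
      set a₂ : Cov E n g := fun X => if depth X < k then a X else 0 with ha₂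
      have htail : ∀ X, depth X ≤ k → ∀ b : Cov E n g, (∀ Y, depth Y < k → b Y = a Y) →
          tailAct p b X = tailAct p a X := by
        intro X hX b hb
        rw [tailAct_eq, tailAct_eq]
        refine Finset.sum_congr rfl fun Y _ => ?_
        split_ifs with h
        · exact act_congr p (hb Y (by omega))
        · rfl
      -- On block `k` the head drift vanishes, since `a` has no support on earlier blocks, and the
      -- tail is `P`.
      have hB' : B (flowerSharp p a) = (∑ X, if depth X = k then act p a X else 0)
          + (P - P.comp (Ad (blockU p k))) ∧
          Ad (blockU p k) (θ (flowerSharp p a)) = c := by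
        have hz := hb.zero (flowerSharp p a
          - (locSharp p a + fun X => (0, P - P.comp (Ad (p X).1)))) fun X hX => by
          have h1 : headDrift p a X = 0 := by
            rw [headDrift_eq]
            refine Finset.sum_eq_zero fun Y _ => ?_
            split_ifs with h
            · exact drift_eq_zero p (ha Y (by omega))
            · rfl
          have h2 : tailAct p a X = P := by rw [tailAct_eq, hX]
          have h3 : rho p 0 X = 0 := by rw [rho_zero]; rfl
          simp only [flowerSharp, Pi.sub_apply, Pi.add_apply, h1, h2, h3]
          abel
        rw [map_sub, map_sub, sub_eq_zero, sub_eq_zero] at hz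
        rw [hz.1, hz.2, map_add, map_add, (hb.tail P).1, (hb.tail P).2, add_zero]
        exact ⟨by rw [(hb.loc a).1], (hb.loc a).2⟩
      -- On the later blocks the head drift of `a` exceeds that of `a₂` by `c`, so the contractions
      -- differ by `-rho p c`, to which equivariance applies.
      have hD' : D (flowerSharp p a) = P - (mom p k).comp (ad G c) := by
        have hz := hM.zero (flowerSharp p a - (flowerSharp p a₂ - rho p c)) fun X hX => by
          have h1 : headDrift p a X = headDrift p a₂ X + c := by
            rw [headDrift_eq, headDrift_eq, hc, ← Finset.sum_add_distrib]
            refine Finset.sum_congr rfl fun Y _ => ?_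
            by_cases hY : depth Y < k
            · rw [drift_congr p (show a₂ Y = a Y by simp [ha₂, hY]), if_neg (by omega : ¬depth Y = k),
                add_zero]
            · rw [drift_eq_zero p (show a₂ Y = 0 by simp [ha₂, hY])]
              by_cases hY' : depth Y = k
              · rw [if_pos (by omega), if_pos hY', ite_self, zero_add]
              · rw [drift_eq_zero p (ha Y (by omega))]
                simp
          have h2 : tailAct p a₂ X = tailAct p a X := htail X (by omega) a₂ fun Y hY => by
            simp [ha₂, hY]
          have h3 : locSharp p a₂ X = locSharp p a X := locSharp_congr p fun Y hY => by
            simp [ha₂, hY, hX]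
          have h4 : rho p (headDrift p a₂ X) X = rho p (headDrift p a X) X - rho p c X := by
            rw [h1, ← Pi.sub_apply, ← rho_sub, add_sub_cancel_right]
          simp only [flowerSharp, Pi.sub_apply, h2, h3, h4]
          abel
        rw [map_sub, map_sub, sub_eq_zero, hM.rho, hM.sharp a₂ fun X hX => by simp [ha₂, hX]] at hz
        rw [hz, hP]
        congr 1
        refine Finset.sum_congr rfl fun X _ => ?_
        split_ifs with h
        · exact act_congr p (by simp [ha₂, h])
        · rfl
      have hs : (∑ X, if depth X < k + 1 then act p a X else 0)
          = (∑ X, if depth X = k then act p a X else 0) + P := by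
        rw [hP, ← Finset.sum_add_distrib]
        refine Finset.sum_congr rfl fun X _ => ?_
        rcases lt_trichotomy (depth X) k with h | h | h
        · rw [if_pos (by omega), if_neg (by omega), if_pos h, zero_add]
        · rw [if_pos (by omega), if_pos h, if_neg (by omega), add_zero]
        · rw [if_neg (by omega), if_neg (by omega), if_neg (by omega), add_zero]
      -- As `Ad(u_k) θ = c`, the variation of the twist cancels `mom ∘ ad c`, while `P ∘ Ad(u_k)`
      -- occurs with both signs.
      have h2 : (ad G) (Ad (blockU p k) (θ (flowerSharp p a)) : E) = _ := congrArg (ad G) hB'.2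
      rw [hs]
      ext η
      simp [hB'.1, hD', Ad_ad, h2]
      ring

end Momentum

/-! ### Removing the tails decouples the blocks. -/

section Decoupling

variable {E : Type*} [NormedAddCommGroup E] [NormedSpace ℝ E] [FiniteDimensional ℝ E]
  {G : Type*} [TopologicalSpace G] [ChartedSpace E G] [Group G]
  {ι : Type*} [Fintype ι] (J : Module.Basis ι ℝ E) {n g : ℕ}
  {N : Type*} [NormedAddCommGroup N] [NormedSpace ℝ N]
  [LieGroup 𝓘(ℝ, E) ∞ G]

lemma pair_single_left (X : Loop n g) (c : (E →L[ℝ] ℝ) × E) (v : Vec E n g) :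
    pair (Pi.single X c) v = c.1 (v X).1 + (v X).2 c.2 := by
  rw [pair_apply, Finset.sum_eq_single X]
  · simp
  · intro Y _ h; simp [h]
  · simp

lemma pair_sub_left (a b : Cov E n g) : pair (a - b) = pair a - pair b := by
  ext v
  simp only [pair_apply, sub_apply, ← Finset.sum_sub_distrib]
  refine Finset.sum_congr rfl fun X _ => ?_
  simp
  ring

lemma cov_apply_eq_zero {a : Cov E n g} {X : Loop n g} (h : ∀ z, pair a (Pi.single X z) = 0) :
    a X = 0 := by
  simp only [pair_single] at h
  refine Prod.ext ?_ ?_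
  · ext x; simpa using h (x, 0)
  · by_contra hne
    obtain ⟨y, hy⟩ := SeparatingDual.exists_ne_zero (R := ℝ) hne
    exact hy (by simpa using h (0, y))

lemma vec_apply_eq {v w : Vec E n g} {X : Loop n g}
    (h : ∀ c, pair (Pi.single X c) v = pair (Pi.single X c) w) : v X = w X := by
  simp only [pair_single_left] at h
  refine Prod.ext ?_ ?_
  · by_contra hne
    obtain ⟨y, hy⟩ := SeparatingDual.exists_separating_of_ne (R := ℝ) hne
    exact hy (by simpa using h (y, 0))
  · ext x; simpa using h (0, x)

lemma locSharp_zero (p : Phase E G n g) : locSharp p 0 = 0 := by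
  ext X : 1
  rcases X with i | i | i <;> refine Prod.ext ?_ ?_ <;> simp [locSharp]

/-- The part of the decoupling that removes the tails. -/
def untail (p : Phase E G n g) : Phase E G n g := fun X =>
  ((p X).1, (p X).2 - (mom p (depth X) - coAd (p X).1 (mom p (depth X))))

/-- A linear map intertwines the bivectors once it does so on the covectors of single factors. -/
lemma sharp_intertwine {S S' : Cov E n g → Vec E n g} {T : Vec E n g →L[ℝ] Vec E n g}
    (hS : ∀ a b, pair b (S a) = -pair a (S b)) (hS' : ∀ a b, pair b (S' a) = -pair a (S' b))
    (h : ∀ X c b, pair b = (pair (Pi.single X c)).comp T → T (S b) = S' (Pi.single X c))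
    (a b : Cov E n g) (hb : pair b = (pair a).comp T) : T (S b) = S' a := by
  -- `S` and `S'` are not assumed linear: antisymmetry moves the test covector `c` of one factor
  -- into the slot where `h` applies.
  ext X : 1
  refine vec_apply_eq fun c => ?_
  obtain ⟨d, hd⟩ := exists_pair_eq ((pair (Pi.single X c)).comp T)
  have h1 : pair (Pi.single X c) (T (S b)) = pair d (S b) := by rw [hd]; rfl
  have h2 : pair b (S d) = pair a (T (S d)) := by rw [hb]; rfl
  rw [h1, hS, h2, h X c d hd, ← hS']

/-- The covector on the right is the pull-back of `(α, γ)` by the shift `j ↦ j - M + Ad*(u) M` with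
`M` held fixed. Pushing its contraction forward again misses the left side by `1 - Ad*` of `ζ ↦ M
[ζ, e]`, where `e = γ - Ad(u) γ`; in `flowerSharp_untail_single` the tail of the full pull-back
supplies this difference. -/
lemma locSharp_untail (p : Phase E G n g) (X Z : Loop n g) (hZ : depth Z = depth X)
    (α : E →L[ℝ] ℝ) (γ : E) (M : E →L[ℝ] ℝ) (hM : mom p (depth X) = M) :
    locSharp (untail p) (Pi.single X (α, γ)) Z =
      ((locSharp p (Pi.single X (α + (M.comp (Ad (p X).1)).comp ((ad G).flip γ), γ)) Z).1,
        (locSharp p (Pi.single X (α + (M.comp (Ad (p X).1)).comp ((ad G).flip γ), γ)) Z).2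
        - ((M.comp ((ad G).flip (γ - Ad (p X).1 γ)))
          - (M.comp ((ad G).flip (γ - Ad (p X).1 γ))).comp (Ad (p Z).1))
        + (M.comp (Ad (p Z).1)).comp (ad G
          (locSharp p (Pi.single X (α + (M.comp (Ad (p X).1)).comp ((ad G).flip γ), γ)) Z).1)) := by
  have hM' : mom p (depth Z) = M := by rw [hZ, hM]
  have m : ∀ x y : E, M (ad G x y) = -M (ad G y x) := fun x y => by rw [ad_skew, map_neg]
  have hh : ∀ i j : Fin g, depth (lA j : Loop n g) = depth (lA i : Loop n g) → i = j := by
    intro i j h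
    simp only [depth, rank] at h
    ext; omega
  have hn : ∀ (i : Fin n) (j : Fin g), depth (lA j : Loop n g) ≠ depth (lM i : Loop n g) := by
    intro i j h
    simp only [depth, rank] at h
    omega
  rcases X with i | i | i <;> rcases Z with j | j | j
  · obtain rfl : i = j := by
      simp only [depth, rank] at hZ
      ext; omega
    refine Prod.ext ?_ ?_
    · simp [locSharp, untail]
    · ext δ
      simp [locSharp, untail, hM, Ad_ad, Ad_Ad_inv, Ad_inv_Ad, Ad_mul_apply, coAd_apply]
      linarith [m δ γ, m (Ad (p (lM i)).1 δ) γ]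
  · exact absurd hZ (hn i j)
  · exact absurd hZ (hn i j)
  · exact absurd hZ.symm (hn j i)
  · obtain rfl := hh i j hZ
    refine Prod.ext ?_ ?_
    · simp [locSharp, untail]
    · ext δ
      simp [locSharp, untail, hM, Ad_ad, Ad_Ad_inv, Ad_inv_Ad, Ad_mul_apply, coAd_apply]
      linarith [m δ γ, m (Ad (p (lA i)).1 δ) γ]
  · obtain rfl := hh i j hZ
    have hM2 : mom p (depth (lA i)) = M := hM
    have hM3 : mom p (depth (lB i)) = M := hM
    refine Prod.ext ?_ ?_
    · simp [locSharp, untail]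
    · ext δ
      simp [locSharp, untail, hM2, hM3, Ad_ad, Ad_Ad_inv, Ad_inv_Ad, Ad_mul_apply, coAd_apply]
      linarith [m δ γ, m (Ad (p (lB i)).1 δ) γ, m (Ad (p (lB i)).1 δ) (Ad (p (lA i)).1 γ)]
  · exact absurd hZ.symm (hn j i)
  · obtain rfl := hh i j hZ
    have hM2 : mom p (depth (lA i)) = M := hM
    have hM3 : mom p (depth (lB i)) = M := hM
    refine Prod.ext ?_ ?_
    · simp [locSharp, untail]
    · ext δ
      simp [locSharp, untail, hM2, hM3, Ad_ad, Ad_Ad_inv, Ad_inv_Ad, Ad_mul_apply, coAd_apply]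
      linarith [m δ γ, m (Ad (p (lA i)).1 δ) γ]
  · obtain rfl := hh i j hZ
    have hM2 : mom p (depth (lA i)) = M := hM
    have hM3 : mom p (depth (lB i)) = M := hM
    refine Prod.ext ?_ ?_
    · simp [locSharp, untail]
    · ext δ
      simp [locSharp, untail, hM2, hM3, Ad_ad, Ad_Ad_inv, Ad_inv_Ad, Ad_mul_apply, coAd_apply]
      linarith [m δ γ, m (Ad (p (lB i)).1 δ) γ]

/-- The heart of the decoupling. The pull-back `b` of a covector of the factor X lives on the block
of X and on later blocks. Its contraction has to vanish on later factors, agree with the local one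
on the block of X, and be annihilated on earlier factors by the derivative of their own tails; each
of the three comes from one property of the momentum maps. -/
lemma flowerSharp_untail_single (p : Phase E G n g) (X : Loop n g) (c : (E →L[ℝ] ℝ) × E)
    (D : Loop n g → Vec E n g →L[ℝ] E →L[ℝ] ℝ) (hD : ∀ X, IsMom p (depth X) (D X))
    {T : Vec E n g →L[ℝ] Vec E n g}
    (hT : ∀ v X, T v X = ((v X).1, (v X).2 - (D X v - (D X v).comp (Ad (p X).1))
      + ((mom p (depth X)).comp (Ad (p X).1)).comp (ad G (v X).1)))
    (b : Cov E n g) (hb : pair b = (pair (Pi.single X c)).comp T) :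
    T (flowerSharp p b) = locSharp (untail p) (Pi.single X c) := by
  obtain ⟨α, γ⟩ := c
  set M := mom p (depth X) with hM
  set e : E := γ - Ad (p X).1 γ with he
  set b₀ : Cov E n g := Pi.single X (α + (M.comp (Ad (p X).1)).comp ((ad G).flip γ), γ) with hb₀
  have hb₀X : ∀ Y, Y ≠ X → b₀ Y = 0 := fun Y h => by simp [hb₀, h]
  -- `b₀` is the pull-back with frozen tail; the remainder is the variation of the tail momentum
  -- evaluated on `e`.
  have hb₁ : ∀ v, pair (b - b₀) v = -D X v e := by
    intro v
    rw [pair_sub_left, hb]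
    simp [pair_single_left, hT, hb₀, he]
    ring
  have hsupp : ∀ Y, ¬ depth Y < depth X → b Y = b₀ Y := by
    intro Y hY
    rw [← sub_eq_zero]
    refine cov_apply_eq_zero (a := b - b₀) fun z => ?_
    rw [hb₁, (hD X).zero, zero_apply, neg_zero]
    intro Z hZ
    have : Z ≠ Y := by rintro rfl; exact hY hZ
    simp [this]
  have hlow : ∀ Y, depth X < depth Y → b Y = 0 := by
    intro Y hY
    rw [hsupp Y (by omega), hb₀X]
    rintro rfl
    omega
  have hhead : ∀ Y, ¬ depth Y < depth X → headDrift p b Y = 0 := by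
    intro Y hY
    rw [headDrift_eq]
    refine Finset.sum_eq_zero fun Z _ => ?_
    split_ifs with h
    · exact drift_eq_zero p (hlow Z (by omega))
    · rfl
  -- Test with a covector `d` of a later factor: the coupling of `b₀` to `d` and the momentum-map
  -- property of `D X` both produce `tailAct p d X e`, with opposite signs.
  have htop : ∀ Y, depth Y < depth X → flowerSharp p b Y = 0 := by
    intro Y hY
    refine vec_apply_eq (w := 0) fun c => ?_
    rw [map_zero]
    set d : Cov E n g := Pi.single Y c with hd
    have hdz : ∀ Z, ¬ depth Z < depth X → d Z = 0 := by
      intro Z hZ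
      have : Z ≠ Y := by rintro rfl; exact hZ hY
      simp [hd, this]
    have h0 : pair b₀ (flowerSharp p d) = tailAct p d X e := by
      have h1 : locSharp p d X = 0 := by
        rw [locSharp_congr p (b := 0) fun Z hZ => hdz Z (by omega), locSharp_zero]; rfl
      have h2 : headDrift p d X = 0 := by
        rw [headDrift_eq]
        refine Finset.sum_eq_zero fun Z _ => ?_
        split_ifs with h
        · exact drift_eq_zero p (hdz Z (by omega))
        · rfl
      rw [hb₀, pair_single_left]
      simp [flowerSharp, h1, h2, rho_zero, he]
    have h3 := hb₁ (flowerSharp p d)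
    rw [pair_sub_left, sub_apply, h0, (hD X).sharp d hdz, ← tailAct_eq] at h3
    rw [pair_flowerSharp_antisymm, sub_eq_iff_eq_add.1 h3]
    simp
  ext Z : 1
  rw [hT]
  rcases lt_trichotomy (depth Z) (depth X) with h | h | h
  · have h1 : D Z (flowerSharp p b) = 0 := (hD Z).zero _ fun Y hY => htop Y (by omega)
    have h2 : locSharp (untail p) (Pi.single X (α, γ)) Z = 0 := by
      rw [locSharp_congr (untail p) (b := 0) fun Y hY => by
        have : Y ≠ X := by rintro rfl; omega
        simp [this], locSharp_zero]
      rfl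
    rw [h1, h2, htop Z h]
    simp
  · have h1 : D Z (flowerSharp p b) = 0 := (hD Z).zero _ fun Y hY => htop Y (by omega)
    have h2 : locSharp p b Z = locSharp p b₀ Z :=
      locSharp_congr p fun Y hY => hsupp Y (by omega)
    -- On the later blocks `b` is the remainder `b - b₀`, so its pairing with the action is given by
    -- equivariance of the tail momentum.
    have h3 : tailAct p b Z = -M.comp ((ad G).flip e) := by
      ext ζ
      have h4 : pair (b - b₀) (rho p ζ) = tailAct p b Z ζ := by
        rw [pair_apply, tailAct_eq, sum_apply]
        refine Finset.sum_congr rfl fun Y _ => ?_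
        rw [act_eq_pair]
        split_ifs with hY
        · have : Y ≠ X := by rintro rfl; omega
          rw [act_congr p (b := b) (by simp [hb₀X Y this])]
        · rw [act_eq_zero]
          simp [hsupp Y (by omega)]
      rw [← h4, hb₁, (hD X).rho]
      simp [hM]
    rw [locSharp_untail p X Z h α γ M hM.symm, h1]
    simp only [flowerSharp, h2, h3, hhead Z (by omega), rho_zero, h, ← hM]
    refine Prod.ext ?_ ?_
    · simp [hb₀]
    · ext δ
      simp [hb₀, he]
      ring
  -- An earlier factor sees `b` only through its tail, and the variation of the momentum of Z
  -- removes precisely that.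
  · have h1 : D Z (flowerSharp p b) = tailAct p b Z := by
      rw [tailAct_eq, (hD Z).sharp b fun Y hY => hlow Y (by omega)]
    have h2 : locSharp p b Z = 0 := by
      rw [locSharp_congr p (b := 0) fun Y hY => hlow Y (by omega), locSharp_zero]
      rfl
    have h3 : locSharp (untail p) (Pi.single X (α, γ)) Z = 0 := by
      rw [locSharp_congr (untail p) (b := 0) fun Y hY => by
        have : Y ≠ X := by rintro rfl; omega
        simp [this], locSharp_zero]
      rfl
    rw [h1, h3]
    simp [flowerSharp, h2, hhead Z (by omega), rho_zero]

lemma exists_untail_deriv (p : Phase E G n g) :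
    ∃ T : Vec E n g →L[ℝ] Vec E n g, HasPhaseDerivAt (fun v => untail (phaseExp p v)) T 0 ∧
      ∀ a b, pair b = (pair a).comp T → T (flowerSharp p b) = locSharp (untail p) a := by
  choose D hD hD' using fun X : Loop n g => exists_isMom p (depth_lt X).le
  have hJ : ∀ X : Loop n g, ∃ S : Vec E n g →L[ℝ] E →L[ℝ] ℝ,
      HasFDerivAt (fun v => (untail (phaseExp p v) X).2) S 0 ∧
      ∀ v, S v = (v X).2 - (D X v - (D X v).comp (Ad (p X).1))
        + ((mom p (depth X)).comp (Ad (p X).1)).comp (ad G (v X).1) := fun X => by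
    refine ⟨_, ((hasPhaseDerivAt_phaseExp p X).2).sub
      ((hD X).sub ((hasPhaseDerivAt_phaseExp p X).1.coAd (hD X))), fun v => ?_⟩
    ext δ
    simp [Ad_ad]
    ring
  choose S hS hS' using hJ
  refine ⟨ContinuousLinearMap.pi fun X =>
    ((ContinuousLinearMap.fst ℝ E (E →L[ℝ] ℝ)).comp (ContinuousLinearMap.proj (R := ℝ)
      (φ := fun _ : Loop n g => E × (E →L[ℝ] ℝ)) X)).prod (S X),
    fun X => ⟨(hasPhaseDerivAt_phaseExp p X).1, hS X⟩, ?_⟩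
  refine sharp_intertwine (fun a b => pair_flowerSharp_antisymm p a b)
    (fun a b => pair_locSharp_antisymm _ a b) fun X c b hb => ?_
  exact flowerSharp_untail_single p X c D hD' (fun v X => Prod.ext rfl (hS' X v)) b hb

end Decoupling

/-! ### Splitting the handles, and the factorisation of `L ∘ κ`. -/

section Handles

variable {E : Type*} [NormedAddCommGroup E] [NormedSpace ℝ E] [FiniteDimensional ℝ E]
  {G : Type*} [TopologicalSpace G] [ChartedSpace E G] [Group G]
  {ι : Type*} [Fintype ι] (J : Module.Basis ι ℝ E) {n g : ℕ}
  {N : Type*} [NormedAddCommGroup N] [NormedSpace ℝ N]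
  [LieGroup 𝓘(ℝ, E) ∞ G]

/-- The contraction of a covector with the bivector of `(H*)ⁿ × (T*G)^{2g}`. -/
def decSharp (p : Phase E G n g) (a : Cov E n g) : Vec E n g
  | Sum.inl i =>
      (Ad (p (lM i)).1⁻¹ (a (lM i)).2 - (a (lM i)).2,
        -(p (lM i)).2.comp (ad G (a (lM i)).2) + (a (lM i)).1
          - (a (lM i)).1.comp (Ad (p (lM i)).1⁻¹))
  | Sum.inr (Sum.inl i) =>
      (-(a (lA i)).2, -(p (lA i)).2.comp (ad G (a (lA i)).2) + (a (lA i)).1)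
  | Sum.inr (Sum.inr i) =>
      (Ad (p (lB i)).1⁻¹ (a (lB i)).2,
        -(p (lB i)).2.comp (ad G (a (lB i)).2) - (a (lB i)).1.comp (Ad (p (lB i)).1⁻¹))

lemma pair_decSharp_antisymm (p : Phase E G n g) (a b : Cov E n g) :
    pair b (decSharp p a) = -pair a (decSharp p b) := by
  rw [pair_apply, pair_apply, ← Finset.sum_neg_distrib]
  refine Finset.sum_congr rfl fun X _ => ?_
  have s := ad_skew (G := G) (a X).2 (b X).2
  rcases X with i | i | i <;>
  · simp only [decSharp, add_apply, sub_apply, neg_apply, ContinuousLinearMap.comp_apply, map_add,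
      map_sub, s, map_neg]
    ring

lemma decoupledBracket_eq {f h : Phase E G n g → ℝ}
    (hf : ContMDiff (phaseModel E n g) 𝓘(ℝ, ℝ) ∞ f) (hh : ContMDiff (phaseModel E n g) 𝓘(ℝ, ℝ) ∞ h)
    (p : Phase E G n g) :
    decoupledBracket J f h p = pair (dcov J h p) (decSharp p (dcov J f p)) := by
  rw [pair_apply, Fintype.sum_sum_type, Fintype.sum_sum_type, ← Finset.sum_add_distrib]
  refine congrArg₂ _ (Finset.sum_congr rfl fun i _ => ?_) (Finset.sum_congr rfl fun i _ => ?_)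
  · rw [dualBracket_slice J hf hh]
    simp only [punctureForm, decSharp, add_apply, sub_apply, neg_apply,
      ContinuousLinearMap.comp_apply, map_add, map_sub, map_neg]
    ring
  · have hR : ∀ (k l : Phase E G n g → ℝ), rightD (fibGrad J (slice k p (lA i)) (p (lA i)))
        (slice l p (lA i)) (p (lA i)) = (dcov J l p (lA i)).1 (dcov J k p (lA i)).2 :=
      fun k l => rightDAt_eq J l p (lA i) _
    have hL : ∀ (k l : Phase E G n g → ℝ), ContMDiff (phaseModel E n g) 𝓘(ℝ, ℝ) ∞ l →
        leftD (fibGrad J (slice k p (lB i)) (p (lB i))) (slice l p (lB i)) (p (lB i))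
          = -(dcov J l p (lB i)).1 (Ad (p (lB i)).1⁻¹ (dcov J k p (lB i)).2) :=
      fun k l hl => leftDAt_eq J hl p (lB i) _
    have hg : ∀ (k : Phase E G n g → ℝ) X, fibGrad J (slice k p X) (p X) = (dcov J k p X).2 :=
      fun k X => rfl
    rw [cotangentBracketR, cotangentBracketL, hR, hR, hL _ _ hf, hL _ _ hh]
    simp only [hg, lieBr_eq, decSharp, add_apply, sub_apply, neg_apply,
      ContinuousLinearMap.comp_apply, map_add, map_sub, map_neg]
    ring

/-- The decoupling of the two copies of `T*G` in each handle. -/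
def splitHandles (p : Phase E G n g) : Phase E G n g
  | Sum.inl i => p (lM i)
  | Sum.inr (Sum.inl i) => ((p (lA i)).1, (p (lA i)).2 - (p (lB i)).2)
  | Sum.inr (Sum.inr i) => ((p (lB i)).1⁻¹ * (p (lA i)).1,
      (p (lB i)).2 + coAd (p (lA i)).1⁻¹ ((p (lA i)).2 - (p (lB i)).2))

lemma exists_splitHandles_deriv (p : Phase E G n g) :
    ∃ S : Vec E n g →L[ℝ] Vec E n g, HasPhaseDerivAt (fun v => splitHandles (phaseExp p v)) S 0 ∧
      ∀ a b, pair b = (pair a).comp S → S (locSharp p b) = decSharp (splitHandles p) a := by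
  have hc : ∀ X : Loop n g, ∃ (S : Vec E n g →L[ℝ] E) (S' : Vec E n g →L[ℝ] E →L[ℝ] ℝ),
      HasLogDerivAt (fun v => (splitHandles (phaseExp p v) X).1) S 0 ∧
      HasFDerivAt (fun v => (splitHandles (phaseExp p v) X).2) S' 0 ∧ ∀ v, (S v, S' v) =
      match X with
      | Sum.inl i => v (lM i)
      | Sum.inr (Sum.inl i) => ((v (lA i)).1, (v (lA i)).2 - (v (lB i)).2)
      | Sum.inr (Sum.inr i) =>
        ((v (lA i)).1 - Ad (p (lA i)).1⁻¹ (Ad (p (lB i)).1 (v (lB i)).1 : E),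
          (v (lB i)).2 + ((v (lA i)).2 - (v (lB i)).2).comp (Ad (p (lA i)).1⁻¹)
          - (((p (lA i)).2 - (p (lB i)).2).comp (Ad (p (lA i)).1⁻¹)).comp
            (ad G (Ad (p (lA i)).1 (v (lA i)).1))) := by
    intro X
    rcases X with i | i | i
    · have h := hasPhaseDerivAt_phaseExp p (lM i)
      exact ⟨_, _, h.1, h.2, fun v => rfl⟩
    · have hA := hasPhaseDerivAt_phaseExp p (lA i)
      have hB := hasPhaseDerivAt_phaseExp p (lB i)
      exact ⟨_, _, hA.1, hA.2.sub hB.2, fun v => rfl⟩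
    · have hA := hasPhaseDerivAt_phaseExp p (lA i)
      have hB := hasPhaseDerivAt_phaseExp p (lB i)
      refine ⟨_, _, hB.1.inv.mul hA.1,
        hB.2.add (hA.1.inv.coAd (hA.2.sub hB.2)), fun v => Prod.ext ?_ ?_⟩
      · simp
        abel
      · ext δ
        simp [Ad_ad]
        ring
  choose S S' hS1 hS2 hS using hc
  refine ⟨ContinuousLinearMap.pi fun X => (S X).prod (S' X), fun X => ⟨hS1 X, hS2 X⟩, fun a b hb => ?_⟩
  have hv : ∀ v X, ContinuousLinearMap.pi (fun X => (S X).prod (S' X)) v X = (S X v, S' X v) := fun v X => rfl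
  -- The transpose of the derivative, written out; it determines `b` because the pairing is
  -- non-degenerate.
  obtain rfl : b = fun X => match X with
      | Sum.inl i => a (lM i)
      | Sum.inr (Sum.inl i) =>
        ((a (lA i)).1 + (a (lB i)).1 - ((p (lA i)).2 - (p (lB i)).2).comp
          ((ad G).flip (Ad (p (lA i)).1⁻¹ (a (lB i)).2)),
          (a (lA i)).2 + Ad (p (lA i)).1⁻¹ (a (lB i)).2)
      | Sum.inr (Sum.inr i) =>
        (-(a (lB i)).1.comp ((Ad (p (lA i)).1⁻¹ : E →L[ℝ] E).comp (Ad (p (lB i)).1)),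
          (a (lB i)).2 - (a (lA i)).2 - Ad (p (lA i)).1⁻¹ (a (lB i)).2) := by
    refine pair_injective (hb.trans ?_)
    ext v
    rw [ContinuousLinearMap.comp_apply, pair_apply, pair_apply]
    refine sum_loop_congr (fun i => ?_) (fun i => ?_)
    · simp only [hv, hS]
    · simp only [hv, hS, add_apply, sub_apply, neg_apply, ContinuousLinearMap.comp_apply, map_add,
        map_sub, map_neg, Ad_ad, Ad_inv_Ad, ContinuousLinearMap.flip_apply]
      ring
  ext X : 1
  rw [hv, hS]
  rcases X with i | i | i
  · rfl
  · refine Prod.ext ?_ ?_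
    · simp only [locSharp, decSharp, map_add, map_sub, map_neg]
      abel
    · ext δ
      simp only [locSharp, decSharp, splitHandles, add_apply, sub_apply, neg_apply,
        ContinuousLinearMap.comp_apply, map_add,
        map_sub, map_neg, Ad_ad, Ad_inv_Ad, Ad_Ad_inv, ContinuousLinearMap.flip_apply, Ad_mul_apply]
      have m : ∀ (k : E →L[ℝ] ℝ) (x y : E), k (ad G x y) = -k (ad G y x) := fun k x y => by
        rw [ad_skew, map_neg]
      linarith [m (p (lB i)).2 δ (a (lB i)).2, m (p (lB i)).2 δ (a (lA i)).2,
        m (p (lA i)).2 δ (Ad (p (lA i)).1⁻¹ (a (lB i)).2)]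
  · refine Prod.ext ?_ ?_
    · simp only [locSharp, decSharp, splitHandles, map_add, map_sub, map_neg,
        Ad_mul_apply, mul_inv_rev, inv_inv, Ad_inv_Ad, Ad_Ad_inv]
      abel
    · ext δ
      simp only [locSharp, decSharp, splitHandles, add_apply, sub_apply, neg_apply,
        ContinuousLinearMap.comp_apply, map_add, mul_inv_rev, inv_inv, coAd_apply,
        map_sub, map_neg, Ad_ad, Ad_inv_Ad, Ad_Ad_inv, ContinuousLinearMap.flip_apply, Ad_mul_apply]
      have m : ∀ (k : E →L[ℝ] ℝ) (x y : E), k (ad G x y) = -k (ad G y x) := fun k x y => by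
        rw [ad_skew, map_neg]
      linarith [m (p (lB i)).2 (Ad (p (lA i)).1⁻¹ δ) (a (lB i)).2,
        m (p (lB i)).2 (Ad (p (lA i)).1⁻¹ δ) (a (lA i)).2,
        m (p (lB i)).2 (Ad (p (lA i)).1⁻¹ δ) (Ad (p (lA i)).1⁻¹ (a (lB i)).2)]

lemma descProd_eq_one {m : ℕ} (u : Fin m → G) {lo hi : ℕ} (h : hi ≤ lo) :
    descProd u lo hi = 1 := by
  have : (List.finRange m).filter (fun k => decide (lo ≤ k.val ∧ k.val < hi)) = [] := by
    rw [List.filter_eq_nil_iff]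
    intro k _
    simp
    omega
  rw [descProd, this]
  simp

/-- Both index lists are strictly increasing with the same members, hence equal. -/
lemma descProd_succ {m : ℕ} (u : Fin m → G) {lo hi : ℕ} (h : lo < hi) (hm : lo < m) :
    descProd u lo hi = descProd u (lo + 1) hi * u ⟨lo, hm⟩ := by
  have : (List.finRange m).filter (fun k => decide (lo ≤ k.val ∧ k.val < hi))
      = ⟨lo, hm⟩ :: (List.finRange m).filter (fun k => decide (lo + 1 ≤ k.val ∧ k.val < hi)) := by
    have hs : ∀ P : Fin m → Bool, ((List.finRange m).filter P).Pairwise (· < ·) := fun P =>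
      (List.pairwise_lt_finRange m).filter P
    have hs2 : (⟨lo, hm⟩ :: (List.finRange m).filter
        (fun k => decide (lo + 1 ≤ k.val ∧ k.val < hi)) : List (Fin m)).Pairwise (· < ·) := by
      rw [List.pairwise_cons]
      refine ⟨fun k hk => ?_, hs _⟩
      simp at hk
      exact Fin.lt_def.2 (by simpa using (by omega : lo < k.val))
    refine List.Perm.eq_of_pairwise (fun a b _ _ h1 h2 => absurd (h1.trans h2) (lt_irrefl _))
      (hs _) hs2 ?_
    rw [List.perm_ext_iff_of_nodup ((hs _).imp fun h => ne_of_lt h) (hs2.imp fun h => ne_of_lt h)]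
    intro k
    simp [Fin.ext_iff]
    omega
  rw [descProd, descProd, this]
  simp

/-- `∑_{k ≥ m} Ad*(u_{k-1} ⋯ u_m) j_k`. -/
def momTail {l : ℕ} (u : Fin l → G) (j : Fin l → E →L[ℝ] ℝ) (m : ℕ) : E →L[ℝ] ℝ :=
  ∑ k : Fin l, if m ≤ k.val then coAd (descProd u m k.val) (j k) else 0

lemma coAd_sum {κ : Type*} (s : Finset κ) (u : G) (j : κ → E →L[ℝ] ℝ) :
    coAd u (∑ k ∈ s, j k) = ∑ k ∈ s, coAd u (j k) := by
  ext x
  simp [coAd_apply, sum_apply]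

lemma coAd_zero (u : G) : coAd u (0 : E →L[ℝ] ℝ) = 0 := by
  ext x; simp [coAd_apply]

/-- All products for `k > m` end in the factor `u_m`, and `coAd` reverses products, so `Ad*(u_m)`
can be pulled out of the sum. -/
lemma momTail_succ {l : ℕ} (u : Fin l → G) (j : Fin l → E →L[ℝ] ℝ) {m : ℕ} (hm : m < l) :
    momTail u j m = j ⟨m, hm⟩ + coAd (u ⟨m, hm⟩) (momTail u j (m + 1)) := by
  have h0 : j ⟨m, hm⟩ = ∑ k : Fin l, if k = ⟨m, hm⟩ then j k else 0 := by simp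
  rw [momTail, momTail, coAd_sum, h0, ← Finset.sum_add_distrib]
  refine Finset.sum_congr rfl fun k _ => ?_
  rcases lt_trichotomy k.val m with h | h | h
  · have : k ≠ ⟨m, hm⟩ := by rintro rfl; simp at h
    rw [if_neg (by omega), if_neg this, if_neg (by omega), coAd_zero, add_zero]
  · have : k = ⟨m, hm⟩ := Fin.ext h
    rw [if_pos (by omega), if_pos this, if_neg (by omega), coAd_zero, add_zero,
      descProd_eq_one _ (by omega), coAd_one]
  · have : k ≠ ⟨m, hm⟩ := by rintro rfl; simp at h
    rw [if_pos (by omega), if_neg this, if_pos (by omega), zero_add, descProd_succ u h hm, coAd_mul]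

/-- The explicit sums in the decoupling map obey the recursion that defines `mom`; the index is
reversed because `mom` counts blocks from the last one. -/
lemma mom_eq_handles (p : Phase E G n g) {k : ℕ} (hk : k ≤ g) :
    mom p k = momTail (uK p) (jH p) (g - k) := by
  induction k with
  | zero =>
    refine (Finset.sum_eq_zero fun i _ => if_neg ?_).symm
    omega
  | succ k ih =>
    rw [mom, ih (by omega), momTail_succ (m := g - (k + 1)) _ _ (by omega)]
    have h1 : g - 1 - k = g - (k + 1) := by omega
    have h2 : g - (k + 1) + 1 = g - k := by omega
    rw [h2, blockJ, blockU, dif_pos (by omega), dif_pos (by omega)]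
    simp only [h1]

lemma mom_eq_punctures (p : Phase E G n g) {k : ℕ} (hk : k ≤ n) :
    mom p (g + k) = momTail (uM p) (fun i => (p (lM i)).2) (n - k)
      + coAd (descProd (uM p) (n - k) n) (mom p g) := by
  induction k with
  | zero =>
    have : momTail (uM p) (fun i => (p (lM i)).2) (n - 0) = 0 :=
      Finset.sum_eq_zero fun i _ => if_neg (by omega)
    rw [this, descProd_eq_one _ (by omega), coAd_one, zero_add, add_zero]
  | succ k ih =>
    rw [← add_assoc, mom, ih (by omega), momTail_succ (m := n - (k + 1)) _ _ (by omega),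
      descProd_succ (lo := n - (k + 1)) _ (by omega) (by omega), coAd_mul]
    have h1 : n + g - 1 - (g + k) = n - (k + 1) := by omega
    have h2 : n - (k + 1) + 1 = n - k := by omega
    have h3 : ¬ g + k < g := by omega
    have h4 : g + k < n + g := by omega
    rw [h2, blockJ, blockU, dif_neg h3, dif_neg h3, dif_pos h4, dif_pos h4, coAd_add, ← add_assoc]
    simp only [h1, uM]

lemma tailK_eq_mom (p : Phase E G n g) (i : Fin g) : tailK p i = mom p (depth (lA i : Loop n g)) := by
  have h : depth (lA i : Loop n g) = g - (i.val + 1) := by simp only [depth, rank]; omega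
  rw [h, mom_eq_handles p (by omega)]
  have h2 : g - (g - (i.val + 1)) = i.val + 1 := by omega
  rw [h2, tailK, momTail]
  refine Finset.sum_congr rfl fun k _ => ?_
  simp only [Fin.lt_def, Nat.succ_le_iff]

lemma tailM_eq_mom (p : Phase E G n g) (i : Fin n) : tailM p i = mom p (depth (lM i : Loop n g)) := by
  have h : depth (lM i : Loop n g) = g + (n - (i.val + 1)) := by simp only [depth, rank]; omega
  rw [h, mom_eq_punctures p (by omega)]
  have h2 : n - (n - (i.val + 1)) = i.val + 1 := by omega
  rw [h2, tailM, momTail, mom_eq_handles p le_rfl, Nat.sub_self, momTail, coAd_sum]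
  refine congrArg₂ _ (Finset.sum_congr rfl fun k _ => ?_) (Finset.sum_congr rfl fun k _ => ?_)
  · simp only [Fin.lt_def, Nat.succ_le_iff]
  · rw [if_pos (Nat.zero_le _), coAd_mul]

/-- The map `κ` performs two operations at once, and composition with `L` separates them. In the
second handle component `Ad*(u_A⁻¹)` undoes the `Ad*(u_A)` that removing the tail puts into `j^A`,
and the resulting tail momentum cancels the one subtracted from `j^B`. -/
lemma handleMap_decouplingMap (p : Phase E G n g) :
    handleMap (decouplingMap p) = splitHandles (untail p) := by
  ext X : 1
  rcases X with i | i | i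
  · simp only [handleMap, decouplingMap, splitHandles, untail, tailM_eq_mom]
  · refine Prod.ext rfl ?_
    simp only [handleMap, decouplingMap, splitHandles, untail, tailK_eq_mom]
    have : depth (lB i : Loop n g) = depth (lA i : Loop n g) := rfl
    rw [this]
    abel
  · refine Prod.ext rfl ?_
    simp only [handleMap, decouplingMap, splitHandles, untail, tailK_eq_mom]
    have : depth (lB i : Loop n g) = depth (lA i : Loop n g) := rfl
    rw [this]
    ext x
    simp [coAd_apply, Ad_mul_apply, Ad_Ad_inv]
    ring

lemma contMDiff_coAd {EM : Type*} [NormedAddCommGroup EM] [NormedSpace ℝ EM]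
    {HM : Type*} [TopologicalSpace HM] {IM : ModelWithCorners ℝ EM HM}
    {M : Type*} [TopologicalSpace M] [ChartedSpace HM M] {u : M → G} {j : M → E →L[ℝ] ℝ}
    (hu : ContMDiff IM 𝓘(ℝ, E) ∞ u) (hj : ContMDiff IM 𝓘(ℝ, E →L[ℝ] ℝ) ∞ j) :
    ContMDiff IM 𝓘(ℝ, E →L[ℝ] ℝ) ∞ (fun m => coAd (u m) (j m)) :=
  hj.clm_comp (contMDiff_Ad.comp hu)

lemma contMDiff_uK (i : Fin g) :
    ContMDiff (phaseModel E n g) 𝓘(ℝ, E) ∞ (fun p : Phase E G n g => uK p i) := by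
  have hA := contMDiff_phase_fst (E := E) (G := G) (lA i : Loop n g)
  have hB := contMDiff_phase_fst (E := E) (G := G) (lB i : Loop n g)
  exact ((hB.mul hA.inv).mul hB.inv).mul hA

lemma contMDiff_jH (i : Fin g) :
    ContMDiff (phaseModel E n g) 𝓘(ℝ, E →L[ℝ] ℝ) ∞ (fun p : Phase E G n g => jH p i) := by
  have hA := contMDiff_phase_fst (E := E) (G := G) (lA i : Loop n g)
  have hB := contMDiff_phase_fst (E := E) (G := G) (lB i : Loop n g)
  have jA := contMDiff_phase_snd (E := E) (G := G) (lA i : Loop n g)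
  have jB := contMDiff_phase_snd (E := E) (G := G) (lB i : Loop n g)
  have hh := (hA.inv.mul hB.inv).mul hA
  exact (jA.sub (contMDiff_coAd hh jA)).add
    ((contMDiff_coAd hh jB).sub (contMDiff_coAd (hB.inv.mul hA) jB))

lemma contMDiff_mom (k : ℕ) :
    ContMDiff (phaseModel E n g) 𝓘(ℝ, E →L[ℝ] ℝ) ∞ (fun p : Phase E G n g => mom p k) := by
  induction k with
  | zero => exact contMDiff_const
  | succ k ih =>
    refine ContMDiff.add (f := fun p : Phase E G n g => blockJ p k) ?_ (contMDiff_coAd ?_ ih)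
    · by_cases h : k < g
      · simp only [blockJ, dif_pos h]
        exact contMDiff_jH _
      · by_cases h' : k < n + g
        · simp only [blockJ, dif_neg h, dif_pos h']
          exact contMDiff_phase_snd _
        · simp only [blockJ, dif_neg h, dif_neg h']
          exact contMDiff_const
    · by_cases h : k < g
      · simp only [blockU, dif_pos h]
        exact contMDiff_uK _
      · by_cases h' : k < n + g
        · simp only [blockU, dif_neg h, dif_pos h']
          exact contMDiff_phase_fst _
        · simp only [blockU, dif_neg h, dif_neg h']
          exact contMDiff_const

lemma contMDiff_untail :
    ContMDiff (phaseModel E n g) (phaseModel E n g) ∞ (untail : Phase E G n g → Phase E G n g) :=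
  fun p => contMDiffAt_phase_of (fun X => contMDiff_phase_fst X p) fun X =>
    (((contMDiff_phase_snd X).sub ((contMDiff_mom (depth X)).sub
      (contMDiff_coAd (contMDiff_phase_fst X) (contMDiff_mom (depth X))))) p)

lemma contMDiff_splitHandles :
    ContMDiff (phaseModel E n g) (phaseModel E n g) ∞
      (splitHandles : Phase E G n g → Phase E G n g) := by
  intro p
  refine contMDiffAt_phase_of (fun X => ?_) (fun X => ?_)
  · rcases X with i | i | i
    · exact contMDiff_phase_fst (lM i) p
    · exact contMDiff_phase_fst (lA i) p
    · exact ((contMDiff_phase_fst (lB i)).inv.mul (contMDiff_phase_fst (lA i))) p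
  · rcases X with i | i | i
    · exact contMDiff_phase_snd (lM i) p
    · exact ((contMDiff_phase_snd (lA i)).sub (contMDiff_phase_snd (lB i))) p
    · exact ((contMDiff_phase_snd (lB i)).add (contMDiff_coAd (contMDiff_phase_fst (lA i)).inv
        ((contMDiff_phase_snd (lA i)).sub (contMDiff_phase_snd (lB i))))) p

lemma pair_dcov_comp {Φ : Phase E G n g → Phase E G n g}
    (hΦ : ContMDiff (phaseModel E n g) (phaseModel E n g) ∞ Φ) {f : Phase E G n g → ℝ}
    (hf : ContMDiff (phaseModel E n g) 𝓘(ℝ, ℝ) ∞ f) (p : Phase E G n g)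
    {T : Vec E n g →L[ℝ] Vec E n g} (hT : HasPhaseDerivAt (fun v => Φ (phaseExp p v)) T 0) :
    pair (dcov J (f ∘ Φ) p) = (pair (dcov J f (Φ p))).comp T := by
  rw [← fderiv_comp_phaseExp J (hf.comp hΦ)]
  have := (hasFDerivAt_comp_phase J hf hT).fderiv
  rw [phaseExp_zero] at this
  exact this

/-- Decoupling is a Poisson map. -/
theorem flowerBracket_decoupling {f h : Phase E G n g → ℝ}
    (hf : ContMDiff (phaseModel E n g) 𝓘(ℝ, ℝ) ∞ f)
    (hh : ContMDiff (phaseModel E n g) 𝓘(ℝ, ℝ) ∞ h) :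
    flowerBracket J ((f ∘ handleMap) ∘ decouplingMap) ((h ∘ handleMap) ∘ decouplingMap) =
        (decoupledBracket J f h ∘ handleMap) ∘ decouplingMap := by
  have e : ∀ {Z : Type} (k : Phase E G n g → Z),
      (k ∘ handleMap) ∘ decouplingMap = (k ∘ splitHandles) ∘ untail := fun k => by
    funext p
    simp only [Function.comp_apply, handleMap_decouplingMap]
  rw [e, e, e]
  have hf' := hf.comp contMDiff_splitHandles
  have hh' := hh.comp contMDiff_splitHandles
  funext p
  obtain ⟨T, hT, hT'⟩ := exists_untail_deriv p
  obtain ⟨S, hS, hS'⟩ := exists_splitHandles_deriv (untail p)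
  rw [flowerBracket_eq J (hf'.comp contMDiff_untail) (hh'.comp contMDiff_untail),
    pair_dcov_comp J contMDiff_untail hh' p hT, ContinuousLinearMap.comp_apply,
    hT' _ _ (pair_dcov_comp J contMDiff_untail hf' p hT),
    pair_dcov_comp J contMDiff_splitHandles hh _ hS, ContinuousLinearMap.comp_apply,
    hS' _ _ (pair_dcov_comp J contMDiff_splitHandles hf _ hS)]
  exact (decoupledBracket_eq J hf hh _).symm

end Handles

/-! ### The flower algebra under pull-back, and the inverse of the decoupling. -/

section Algebra

variable {E : Type*} [NormedAddCommGroup E] [NormedSpace ℝ E] [FiniteDimensional ℝ E]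
  {G : Type*} [TopologicalSpace G] [ChartedSpace E G] [Group G] {n g : ℕ}
  [LieGroup 𝓘(ℝ, E) ∞ G]

/-- Elements of the flower algebra are smooth. -/
lemma contMDiff_of_mem_flowerAlgebra {f : Phase E G n g → ℝ} (hf : f ∈ flowerAlgebra E G n g) :
    ContMDiff (phaseModel E n g) 𝓘(ℝ, ℝ) ∞ f := by
  induction hf using Algebra.adjoin_induction with
  | mem f hf =>
    rcases hf with ⟨X, ξ, rfl⟩ | ⟨F, hF, rfl⟩
    · exact (contMDiff_phase_snd X).clm_apply contMDiff_const
    · refine hF.comp fun p => ?_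
      exact contMDiffAt_pi_of fun X => contMDiff_phase_fst X p
  | algebraMap r => exact contMDiff_const
  | add f h _ _ hf hh => exact hf.add hh
  | mul f h _ _ hf hh => exact hf.mul hh

/-- A `G`-valued smooth function of the `G`-components. -/
def IsBase (u : Phase E G n g → G) : Prop :=
  ∃ F : (Loop n g → G) → G,
    ContMDiff (ModelWithCorners.pi fun _ : Loop n g => 𝓘(ℝ, E)) 𝓘(ℝ, E) ∞ F ∧
    u = fun p => F (fun X => (p X).1)

/-- A `𝔤*`-valued function with coordinates in the flower algebra. -/
def IsPoly (φ : Phase E G n g → E →L[ℝ] ℝ) : Prop :=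
  ∀ ξ, (fun p => φ p ξ) ∈ flowerAlgebra E G n g

lemma isBase_fst (X : Loop n g) : IsBase (fun p : Phase E G n g => (p X).1) :=
  ⟨fun u => u X, contMDiff_apply_pi X, rfl⟩

lemma isBase_one : IsBase (fun _ : Phase E G n g => (1 : G)) :=
  ⟨fun _ => 1, contMDiff_const, rfl⟩

lemma IsBase.mul {u v : Phase E G n g → G} (hu : IsBase u) (hv : IsBase v) :
    IsBase (fun p => u p * v p) := by
  obtain ⟨F, hF, rfl⟩ := hu
  obtain ⟨F', hF', rfl⟩ := hv
  exact ⟨_, hF.mul hF', rfl⟩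

lemma IsBase.inv {u : Phase E G n g → G} (hu : IsBase u) : IsBase (fun p => (u p)⁻¹) := by
  obtain ⟨F, hF, rfl⟩ := hu
  exact ⟨_, hF.inv, rfl⟩

lemma isPoly_snd (X : Loop n g) : IsPoly (fun p : Phase E G n g => (p X).2) := fun ξ =>
  Algebra.subset_adjoin (Or.inl ⟨X, ξ, rfl⟩)

lemma isPoly_zero : IsPoly (fun _ : Phase E G n g => (0 : E →L[ℝ] ℝ)) := fun _ =>
  (flowerAlgebra E G n g).zero_mem

lemma IsPoly.add {φ ψ : Phase E G n g → E →L[ℝ] ℝ} (h : IsPoly φ) (h' : IsPoly ψ) :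
    IsPoly (fun p => φ p + ψ p) := fun ξ => (flowerAlgebra E G n g).add_mem (h ξ) (h' ξ)

lemma IsPoly.sub {φ ψ : Phase E G n g → E →L[ℝ] ℝ} (h : IsPoly φ) (h' : IsPoly ψ) :
    IsPoly (fun p => φ p - ψ p) := fun ξ => (flowerAlgebra E G n g).sub_mem (h ξ) (h' ξ)

/-- In a basis, `⟨Ad*(u) φ, ξ⟩ = ∑ₐ φ(Jₐ) ⟨P^a, Ad(u) ξ⟩`: elements of the algebra times smooth
functions of the group components. -/
lemma IsPoly.coAd {φ : Phase E G n g → E →L[ℝ] ℝ} {u : Phase E G n g → G} (h : IsPoly φ)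
    (hu : IsBase u) : IsPoly (fun p => Flower.coAd (u p) (φ p)) := by
  intro ξ
  obtain ⟨F, hF, rfl⟩ := hu
  have e : (fun p : Phase E G n g => Flower.coAd (F fun X => (p X).1) (φ p) ξ)
      = ∑ a, (fun p : Phase E G n g => φ p (Module.finBasis ℝ E a))
        * (fun p : Phase E G n g =>
          dualP (Module.finBasis ℝ E) a (Flower.Ad (F fun X => (p X).1) ξ : E)) := by
    funext p
    simp only [Finset.sum_apply, Pi.mul_apply, coAd_apply]
    refine (sum_coord_mul (Module.finBasis ℝ E) (φ p).toLinearMap _).symm.trans ?_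
    exact Finset.sum_congr rfl fun a _ => mul_comm _ _
  rw [e]
  refine (flowerAlgebra E G n g).sum_mem fun a _ => (flowerAlgebra E G n g).mul_mem (h _) ?_
  refine Algebra.subset_adjoin (Or.inr ⟨fun u => dualP (Module.finBasis ℝ E) a
    (Flower.Ad (F u) ξ : E), ?_, rfl⟩)
  exact contMDiff_const.clm_apply ((contMDiff_Ad.comp hF).clm_apply contMDiff_const)

/-- Pulling back the flower algebra. -/
lemma comp_mem_flowerAlgebra {Φ : Phase E G n g → Phase E G n g}
    (hu : ∀ X, IsBase (fun p => (Φ p X).1)) (hj : ∀ X, IsPoly (fun p => (Φ p X).2))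
    {f : Phase E G n g → ℝ} (hf : f ∈ flowerAlgebra E G n g) :
    f ∘ Φ ∈ flowerAlgebra E G n g := by
  induction hf using Algebra.adjoin_induction with
  | mem f hf =>
    rcases hf with ⟨X, ξ, rfl⟩ | ⟨F, hF, rfl⟩
    · exact hj X ξ
    · choose U hU hU' using hu
      refine Algebra.subset_adjoin (Or.inr ⟨fun u => F fun X => U X u, ?_, ?_⟩)
      · exact hF.comp fun u => contMDiffAt_pi_of fun X => hU X u
      · funext p
        exact congrArg F (funext fun X => congrFun (hU' X) p)
  | algebraMap r => exact (flowerAlgebra E G n g).algebraMap_mem r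
  | add f h _ _ hf hh => exact (flowerAlgebra E G n g).add_mem hf hh
  | mul f h _ _ hf hh => exact (flowerAlgebra E G n g).mul_mem hf hh

section Blocks

variable {Φ : Phase E G n g → Phase E G n g}

lemma isBase_blockU (hu : ∀ X, IsBase (fun p => (Φ p X).1)) (k : ℕ) :
    IsBase (fun p => blockU (Φ p) k) := by
  by_cases h : k < g
  · simp only [blockU, dif_pos h, uK]
    exact (((hu _).mul (hu _).inv).mul (hu _).inv).mul (hu _)
  · by_cases h' : k < n + g
    · simp only [blockU, dif_neg h, dif_pos h', uM]
      exact hu _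
    · simp only [blockU, dif_neg h, dif_neg h']
      exact isBase_one

lemma isPoly_blockJ (hu : ∀ X, IsBase (fun p => (Φ p X).1)) (hj : ∀ X, IsPoly (fun p => (Φ p X).2))
    (k : ℕ) : IsPoly (fun p => blockJ (Φ p) k) := by
  by_cases h : k < g
  · simp only [blockJ, dif_pos h, jH]
    have hh := ((hu (lA ⟨g - 1 - k, by omega⟩)).inv.mul (hu (lB ⟨g - 1 - k, by omega⟩)).inv).mul
      (hu (lA ⟨g - 1 - k, by omega⟩))
    exact ((hj _).sub ((hj _).coAd hh)).add
      (((hj _).coAd hh).sub ((hj _).coAd ((hu _).inv.mul (hu _))))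
  · by_cases h' : k < n + g
    · simp only [blockJ, dif_neg h, dif_pos h']
      exact hj _
    · simp only [blockJ, dif_neg h, dif_neg h']
      exact isPoly_zero

end Blocks

lemma isPoly_mom (k : ℕ) : IsPoly (fun p : Phase E G n g => mom p k) := by
  induction k with
  | zero => exact isPoly_zero
  | succ k ih =>
    exact (isPoly_blockJ (Φ := id) isBase_fst isPoly_snd k).add
      (ih.coAd (isBase_blockU (Φ := id) isBase_fst k))

/-- Adding the tail `M`. -/
def addTail (p : Phase E G n g) (M : E →L[ℝ] ℝ) : Phase E G n g := fun X =>
  ((p X).1, (p X).2 + (M - coAd (p X).1 M))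

/-- The total momentum as a function of the decoupled variables. -/
def momInv (p : Phase E G n g) : ℕ → (E →L[ℝ] ℝ)
  | 0 => 0
  | k + 1 => blockJ (addTail p (momInv p k)) k + coAd (blockU p k) (momInv p k)

/-- The inverse of `untail`. -/
def retail (p : Phase E G n g) : Phase E G n g := fun X => addTail p (momInv p (depth X)) X

lemma isPoly_momInv (k : ℕ) : IsPoly (fun p : Phase E G n g => momInv p k) := by
  induction k with
  | zero => exact isPoly_zero
  | succ k ih =>
    exact (isPoly_blockJ (Φ := fun p => addTail p (momInv p k)) isBase_fst
      (fun X => (isPoly_snd X).add (ih.sub (ih.coAd (isBase_fst X)))) k).add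
      (ih.coAd (isBase_blockU (Φ := id) isBase_fst k))

lemma blockJ_congr {p q : Phase E G n g} {k : ℕ} (h : ∀ X, depth X = k → p X = q X) :
    blockJ p k = blockJ q k := by
  by_cases hk : k < g
  · have h1 := h (lA ⟨g - 1 - k, by omega⟩) (by simp only [depth, rank]; omega)
    have h2 := h (lB ⟨g - 1 - k, by omega⟩) (by simp only [depth, rank]; omega)
    simp only [blockJ, dif_pos hk, jH, h1, h2]
  · by_cases h' : k < n + g
    · have h1 := h (lM ⟨n + g - 1 - k, by omega⟩) (by simp only [depth, rank]; omega)
      simp only [blockJ, dif_neg hk, dif_pos h', h1]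
    · simp only [blockJ, dif_neg hk, dif_neg h']

lemma blockU_congr {p q : Phase E G n g} (h : ∀ X, (p X).1 = (q X).1) (k : ℕ) :
    blockU p k = blockU q k := by
  simp only [blockU, uK, uM, h]

/-- The tails can be recovered from decoupled data by recursion: the holonomies involve only the
unchanged group components, and the momenta of block `k` are restored using nothing but the total
momentum of the later blocks. -/
lemma mom_retail (p : Phase E G n g) (k : ℕ) : mom (retail p) k = momInv p k := by
  induction k with
  | zero => rfl
  | succ k ih =>
    rw [mom, momInv, ih, blockU_congr (q := p) fun X => rfl]
    congr 1
    refine blockJ_congr fun X hX => ?_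
    rw [retail, hX]

lemma momInv_untail (p : Phase E G n g) (k : ℕ) : momInv (untail p) k = mom p k := by
  induction k with
  | zero => rfl
  | succ k ih =>
    rw [mom, momInv, ih, blockU_congr (q := p) fun X => rfl]
    congr 1
    refine blockJ_congr fun X hX => ?_
    refine Prod.ext rfl ?_
    simp only [addTail, untail, hX]
    abel

lemma untail_retail (p : Phase E G n g) : untail (retail p) = p := by
  ext X : 1
  refine Prod.ext rfl ?_
  simp only [untail, mom_retail]
  simp only [retail, addTail]
  abel

lemma retail_untail (p : Phase E G n g) : retail (untail p) = p := by
  ext X : 1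
  refine Prod.ext rfl ?_
  simp only [retail, addTail, momInv_untail]
  simp only [untail]
  abel

/-- The inverse of `splitHandles`. -/
def joinHandles (p : Phase E G n g) : Phase E G n g
  | Sum.inl i => p (lM i)
  | Sum.inr (Sum.inl i) => ((p (lA i)).1,
      (p (lA i)).2 + ((p (lB i)).2 - coAd (p (lA i)).1⁻¹ (p (lA i)).2))
  | Sum.inr (Sum.inr i) => ((p (lA i)).1 * (p (lB i)).1⁻¹,
      (p (lB i)).2 - coAd (p (lA i)).1⁻¹ (p (lA i)).2)

lemma splitHandles_joinHandles (p : Phase E G n g) : splitHandles (joinHandles p) = p := by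
  ext X : 1
  rcases X with i | i | i
  · rfl
  · refine Prod.ext rfl ?_
    simp only [splitHandles, joinHandles]
    abel
  · refine Prod.ext ?_ ?_
    · simp [splitHandles, joinHandles]
    · simp [splitHandles, joinHandles]

lemma joinHandles_splitHandles (p : Phase E G n g) : joinHandles (splitHandles p) = p := by
  ext X : 1
  rcases X with i | i | i
  · rfl
  · refine Prod.ext rfl ?_
    simp only [splitHandles, joinHandles]
    abel
  · refine Prod.ext ?_ ?_
    · simp [splitHandles, joinHandles]
    · simp [splitHandles, joinHandles]

/-- The pull-back by the decoupling is a bijection of the flower algebra. -/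
theorem bijOn_decoupling :
    Set.BijOn (fun f : Phase E G n g → ℝ => (f ∘ handleMap) ∘ decouplingMap)
      (flowerAlgebra E G n g) (flowerAlgebra E G n g) := by
  have e : (fun f : Phase E G n g → ℝ => (f ∘ handleMap) ∘ decouplingMap)
      = fun f => (f ∘ splitHandles) ∘ untail := by
    funext f p
    simp only [Function.comp_apply, handleMap_decouplingMap]
  rw [e]
  refine Set.InvOn.bijOn (f' := fun f => (f ∘ retail) ∘ joinHandles) ⟨fun f _ => ?_, fun f _ => ?_⟩
    (fun f hf => ?_) (fun f hf => ?_)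
  · funext p
    simp only [Function.comp_apply, splitHandles_joinHandles, untail_retail]
  · funext p
    simp only [Function.comp_apply, joinHandles_splitHandles, retail_untail]
  · refine comp_mem_flowerAlgebra (Φ := untail) (fun X => isBase_fst X) (fun X => ?_)
      (comp_mem_flowerAlgebra (Φ := splitHandles) (fun X => ?_) (fun X => ?_) hf)
    · exact (isPoly_snd X).sub ((isPoly_mom _).sub ((isPoly_mom _).coAd (isBase_fst X)))
    · rcases X with i | i | i
      · exact isBase_fst _
      · exact isBase_fst _
      · exact (isBase_fst (lB i)).inv.mul (isBase_fst (lA i))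
    · rcases X with i | i | i
      · exact isPoly_snd _
      · exact (isPoly_snd _).sub (isPoly_snd _)
      · exact (isPoly_snd _).add (((isPoly_snd _).sub (isPoly_snd _)).coAd (isBase_fst _).inv)
  · refine comp_mem_flowerAlgebra (Φ := joinHandles) (fun X => ?_) (fun X => ?_)
      (comp_mem_flowerAlgebra (Φ := retail) (fun X => isBase_fst X) (fun X => ?_) hf)
    · rcases X with i | i | i
      · exact isBase_fst _
      · exact isBase_fst _
      · exact (isBase_fst (lA i)).mul (isBase_fst (lB i)).inv
    · have h : ∀ i, IsPoly (fun p : Phase E G n g =>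
          (p (lB i)).2 - coAd (p (lA i)).1⁻¹ (p (lA i)).2) := fun i =>
        (isPoly_snd _).sub ((isPoly_snd _).coAd (isBase_fst _).inv)
      rcases X with i | i | i
      · exact isPoly_snd _
      · exact (isPoly_snd _).add (h i)
      · exact h i
    · exact (isPoly_snd X).add ((isPoly_momInv _).sub ((isPoly_momInv _).coAd (isBase_fst X)))

end Algebra

/-! ### Local solutions of the equation for a prescribed logarithmic derivative. -/

section Flows

variable {E : Type*} [NormedAddCommGroup E] [NormedSpace ℝ E] [FiniteDimensional ℝ E]
  {G : Type*} [TopologicalSpace G] [ChartedSpace E G] [Group G]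
  {N : Type*} [NormedAddCommGroup N] [NormedSpace ℝ N]
  [LieGroup 𝓘(ℝ, E) ∞ G]

/-! ### Curves in `G` with prescribed logarithmic derivative -/

lemma eventually_leftCoframe_comp_leftFrame :
    ∀ᶠ s in 𝓝 (0 : E), (leftCoframe E G s).comp (leftFrame E G s) = ContinuousLinearMap.id ℝ E := by
  filter_upwards [eventually_leftFrame_comp_leftCoframe (E := E) (G := G)] with s hs
  have h2 : (leftFrame E G s).toLinearMap ∘ₗ (leftCoframe E G s).toLinearMap = LinearMap.id := by
    ext x; exact DFunLike.congr_fun hs x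
  rw [LinearMap.comp_eq_id_comm] at h2
  ext x
  exact DFunLike.congr_fun h2 x

lemma eventually_continuousAt_expC : ∀ᶠ s in 𝓝 (0 : E), ContinuousAt (expC G) s := by
  have hM : IsManifold 𝓘(ℝ, E) 1 G := IsManifold.of_le (n := ∞) (by norm_cast)
  have h : ContMDiffAt 𝓘(ℝ, E) 𝓘(ℝ, E) 1 (expC G : E → G) 0 := contMDiffAt_expC.of_le (by norm_cast)
  filter_upwards [(contMDiffAt_iff_contMDiffAt_nhds (by norm_cast)).1 h] with s hs
  exact hs.continuousAt

/-- The logarithmic derivative of `expC ∘ r` is the coframe applied to the derivative of `r`, and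
the coframe inverts the frame. -/
lemma hasLogDerivAt_expC_comp : ∀ᶠ s in 𝓝 (0 : E), ∀ (r : N → E) (r' : N →L[ℝ] E) (m : N),
    r m = s → HasFDerivAt r ((leftFrame E G s).comp r') m →
      HasLogDerivAt (fun m => expC G (r m)) r' m := by
  filter_upwards [eventually_leftCoframe_comp_leftFrame (E := E) (G := G),
    eventually_continuousAt_expC (E := E) (G := G),
    eventually_hasFDerivAt_chartDiv (E := E) (G := G)] with s h1 h2 h3
  rintro r r' m rfl hr
  refine ⟨ContinuousAt.comp (g := expC G) h2 hr.continuousAt, ?_⟩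
  have h := HasFDerivAt.comp m (g := fun t => chartDiv E G (r m, t)) h3 hr
  rw [← ContinuousLinearMap.comp_assoc, h1, ContinuousLinearMap.id_comp] at h
  exact h

/-- Picard-Lindelöf for `r' = leftFrame(r) c(t)`. The interval is short because the frame is
controlled only near the origin of the chart. -/
lemma exists_hasDerivAt_leftFrame {c : ℝ → E} (hc : Continuous c) (t₀ : ℝ) :
    ∃ (ε : ℝ) (r : ℝ → E), 0 < ε ∧ r t₀ = 0 ∧ ∀ t ∈ Ioo (t₀ - ε) (t₀ + ε),
      HasDerivAt r (leftFrame E G (r t) (c t)) t := by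
  obtain ⟨K, s, hs, hl⟩ := ((contDiffAt_leftFrame (E := E) (G := G)).of_le
    (m := 1) (by norm_cast)).exists_lipschitzOnWith
  obtain ⟨a, ha, has⟩ := Metric.nhds_basis_closedBall.mem_iff.mp hs
  obtain ⟨C, hC⟩ := (isCompact_Icc (a := t₀ - 1) (b := t₀ + 1)).exists_bound_of_continuousOn
    hc.continuousOn
  have hC0 : 0 ≤ C := (norm_nonneg _).trans (hC t₀ (by simp))
  lift C to NNReal using hC0
  lift a to NNReal using ha.le
  -- On the ball of radius `a` the frame has norm at most `K a + 1`, being `K`-Lipschitz and the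
  -- identity at `0`. The last `+ 1` keeps `L` positive, so that `a / L` is a legitimate time bound.
  set L : NNReal := (K * a + 1) * C + 1 with hL
  have hLp : (0 : ℝ) < L := by simp only [hL]; positivity
  set ε : ℝ := min 1 (a / L) with hε
  have hεp : 0 < ε := lt_min one_pos (div_pos ha hLp)
  have hsub : ∀ t ∈ Icc (t₀ - ε) (t₀ + ε), ‖c t‖ ≤ C := fun t ht =>
    hC t ⟨by linarith [ht.1, min_le_left 1 ((a : ℝ) / L)], by linarith [ht.2, min_le_left 1 ((a : ℝ) / L)]⟩
  have hP : IsPicardLindelof (fun t x => leftFrame E G x (c t)) (tmin := t₀ - ε) (tmax := t₀ + ε)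
      ⟨t₀, by constructor <;> linarith⟩ (0 : E) a 0 L (K * C) := by
    refine ⟨fun t ht => ?_, fun x _ => ?_, fun t ht x hx => ?_, ?_⟩
    · refine LipschitzOnWith.of_dist_le_mul fun x hx y hy => ?_
      rw [dist_eq_norm, dist_eq_norm, ← sub_apply]
      refine (ContinuousLinearMap.le_opNorm _ _).trans ?_
      have h1 := hl.dist_le_mul x (has hx) y (has hy)
      rw [dist_eq_norm, dist_eq_norm] at h1
      calc _ ≤ (K * ‖x - y‖) * C := mul_le_mul h1 (hsub t ht) (norm_nonneg _) (by positivity)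
        _ = _ := by push_cast; ring
    · exact ((leftFrame E G x).continuous.comp hc).continuousOn
    · have h1 := hl.dist_le_mul x (has hx) 0 (has (by simp))
      rw [dist_eq_norm, dist_eq_norm, sub_zero] at h1
      have hx' : ‖x‖ ≤ a := by simpa using hx
      have h2 : ‖leftFrame E G x‖ ≤ K * a + 1 := by
        have h4 : ‖leftFrame E G (0 : E)‖ ≤ 1 := by
          rw [leftFrame_zero]; exact ContinuousLinearMap.norm_id_le
        have h5 := norm_le_norm_sub_add (leftFrame E G x) (leftFrame E G 0)
        have h6 : (K : ℝ) * ‖x‖ ≤ K * a := mul_le_mul_of_nonneg_left hx' K.2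
        linarith
      refine (ContinuousLinearMap.le_opNorm _ _).trans ?_
      have := mul_le_mul h2 (hsub t ht) (norm_nonneg _) (by positivity)
      simp only [hL]; push_cast; linarith
    · have h1 : max (t₀ + ε - t₀) (t₀ - (t₀ - ε)) = ε := by simp
      have h2 : L * ε ≤ a := by
        calc L * ε ≤ L * (a / L) := mul_le_mul_of_nonneg_left (min_le_right _ _) hLp.le
          _ = a := by field_simp
      simpa [h1] using h2
  obtain ⟨r, hr0, hr⟩ := hP.exists_eq_forall_mem_Icc_hasDerivWithinAt₀
  exact ⟨ε, r, hεp, hr0, fun t ht => (hr t ⟨ht.1.le, ht.2.le⟩).hasDerivAt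
    (Icc_mem_nhds ht.1 ht.2)⟩

lemma exists_hasLogDerivAt {c : ℝ → E} (hc : Continuous c) (t₀ : ℝ) :
    ∃ (ε : ℝ) (r : ℝ → E), 0 < ε ∧ r t₀ = 0 ∧ HasStrictDerivAt r (c t₀) t₀ ∧
      ∀ t ∈ Ioo (t₀ - ε) (t₀ + ε),
      HasLogDerivAt (fun t => expC G (r t)) ((1 : ℝ →L[ℝ] ℝ).smulRight (c t)) t := by
  obtain ⟨ε, r, hε, hr0, hr⟩ := exists_hasDerivAt_leftFrame (G := G) hc t₀
  have hmem : Ioo (t₀ - ε) (t₀ + ε) ∈ 𝓝 t₀ := Ioo_mem_nhds (by linarith) (by linarith)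
  have hcont : ContinuousAt r t₀ := (hr t₀ (mem_of_mem_nhds hmem)).continuousAt
  have hcont' := hcont.tendsto
  rw [hr0] at hcont'
  obtain ⟨δ, hδ, hδ'⟩ := Metric.eventually_nhds_iff_ball.1
    (hcont' (hasLogDerivAt_expC_comp (N := ℝ) (E := E) (G := G)))
  refine ⟨min ε δ, r, lt_min hε hδ, hr0, ?_, fun t ht => ?_⟩
  -- Continuity of the derivative upgrades it to a strict one, as required by
  -- `mem_nhds_one_of_curves`.
  · have h := hasStrictDerivAt_of_hasDerivAt_of_continuousAt
      (f' := fun t => leftFrame E G (r t) (c t)) (x := t₀) (eventually_of_mem hmem hr) ?_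
    · simpa [hr0, leftFrame_zero] using h
    · have h1 : ContinuousAt (leftFrame E G) (r t₀) := by
        rw [hr0]; exact contDiffAt_leftFrame.continuousAt
      exact (ContinuousAt.comp (g := leftFrame E G) h1 hcont).clm_apply hc.continuousAt
  · have ht1 : t ∈ Ioo (t₀ - ε) (t₀ + ε) :=
      ⟨by linarith [ht.1, min_le_left ε δ], by linarith [ht.2, min_le_left ε δ]⟩
    have ht2 : t ∈ Metric.ball t₀ δ := by
      rw [Real.ball_eq_Ioo]
      exact ⟨by linarith [ht.1, min_le_right ε δ], by linarith [ht.2, min_le_right ε δ]⟩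
    refine hδ' t ht2 r _ t rfl ((hr t ht1).hasFDerivAt.congr_fderiv ?_)
    ext; simp

end Flows

/-! ### A connected group is generated by curves through the identity. -/

section Generation

variable {E : Type*} [NormedAddCommGroup E] [NormedSpace ℝ E] [FiniteDimensional ℝ E]
  {G : Type*} [TopologicalSpace G] [ChartedSpace E G] [Group G]
  [LieGroup 𝓘(ℝ, E) ∞ G]

/-! ### Generation of a connected group by one-parameter curves -/

lemma hasStrictFDerivAt_chartMul : HasStrictFDerivAt (chartMul E G)
    (ContinuousLinearMap.fst ℝ E E + ContinuousLinearMap.snd ℝ E E) 0 := by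
  have h := (contDiffAt_chartMul (E := E) (G := G)).hasStrictFDerivAt (by simp)
  have h2 := hasFDerivAt_logC_conj_mul (E := E) (1 : G)
  have h3 : HasFDerivAt (chartMul E G)
      (ContinuousLinearMap.fst ℝ E E + ContinuousLinearMap.snd ℝ E E) 0 := by
    refine (h2.congr_fderiv ?_).congr_of_eventuallyEq ?_
    · ext <;> simp [Ad_one]
    · exact Eventually.of_forall fun p => by simp [chartMul]
  rwa [h3.fderiv] at h

lemma eventually_expC_chartMul :
    ∀ᶠ p in 𝓝 (0 : E × E), expC G (chartMul E G p) = expC G p.1 * expC G p.2 := by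
  haveI : IsTopologicalGroup G := topologicalGroup_of_lieGroup 𝓘(ℝ, E) ∞
  have h1 : ContinuousAt (fun p : E × E => expC G p.1 * expC G p.2) 0 :=
    (ContinuousAt.comp (x := (0 : E × E)) (f := Prod.fst) (g := expC G) continuousAt_expC
      continuousAt_fst).mul
      (ContinuousAt.comp (x := (0 : E × E)) (f := Prod.snd) (g := expC G) continuousAt_expC
      continuousAt_snd)
  have h2 : Tendsto (fun p : E × E => expC G p.1 * expC G p.2) (𝓝 0) (𝓝 1) := by
    simpa using h1.tendsto
  exact h2 (eventually_expC_logC (E := E) (G := G))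

/-- Multiply curves in `S` tangent to a basis, each with its own time parameter. In the chart the
product map is strictly differentiable at the origin with surjective derivative, hence open there,
so its values in `S` fill a neighbourhood of `1`. -/
lemma mem_nhds_one_of_curves (S : Submonoid G) (h : ∀ ξ : E, ∃ r : ℝ → E, r 0 = 0 ∧
    HasStrictDerivAt r ξ 0 ∧ ∀ᶠ t in 𝓝 0, expC G (r t) ∈ S) : (S : Set G) ∈ 𝓝 1 := by
  set J := Module.finBasis ℝ E
  set κ := Fin (Module.finrank ℝ E)
  have key : ∀ l : List κ, ∃ P : (κ → ℝ) → E, P 0 = 0 ∧ HasStrictFDerivAt P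
      (l.map fun a => (ContinuousLinearMap.proj (R := ℝ) (φ := fun _ : κ => ℝ) a).smulRight
        (J a)).sum 0 ∧ ∀ᶠ t in 𝓝 0, expC G (P t) ∈ S := by
    intro l
    induction l with
    | nil => exact ⟨fun _ => 0, rfl, hasStrictFDerivAt_const _ _, by simp [S.one_mem]⟩
    | cons a l ih =>
      obtain ⟨P, hP0, hP, hPS⟩ := ih
      obtain ⟨r, hr0, hr, hrS⟩ := h (J a)
      have ht : Tendsto (fun t : κ → ℝ => t a) (𝓝 0) (𝓝 0) :=
        (continuous_apply a).tendsto' _ _ rfl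
      have hr' : HasStrictFDerivAt (fun t : κ → ℝ => r (t a))
          ((ContinuousLinearMap.proj (R := ℝ) (φ := fun _ : κ => ℝ) a).smulRight (J a)) 0 := by
        have h1 := hr.hasStrictFDerivAt.comp (0 : κ → ℝ) (f := fun t : κ → ℝ => t a)
          (ContinuousLinearMap.proj (R := ℝ) (φ := fun _ : κ => ℝ) a).hasStrictFDerivAt
        refine h1.congr_fderiv ?_
        ext; simp
      have hpair := hr'.prodMk hP
      have h00 : (r ((0 : κ → ℝ) a), P 0) = 0 := by simp [hr0, hP0]
      have ht2 := hpair.continuousAt.tendsto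
      simp only [h00] at ht2
      refine ⟨fun t => chartMul E G (r (t a), P t), by simp [hr0, hP0, chartMul], ?_, ?_⟩
      · have h2 := HasStrictFDerivAt.comp (0 : κ → ℝ) (g := chartMul E G)
          (by rw [h00]; exact hasStrictFDerivAt_chartMul) hpair
        refine h2.congr_fderiv ?_
        ext; simp
      · filter_upwards [ht2 (eventually_expC_chartMul (E := E) (G := G)), ht hrS, hPS]
          with t h1 h2 h3
        have h1' : expC G (chartMul E G (r (t a), P t)) = expC G (r (t a)) * expC G (P t) := h1
        rw [h1']
        exact S.mul_mem h2 h3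
  obtain ⟨P, hP0, hP, hPS⟩ := key Finset.univ.toList
  have hsurj : (List.map (fun a => (ContinuousLinearMap.proj (R := ℝ)
      (φ := fun _ : κ => ℝ) a).smulRight (J a)) Finset.univ.toList).sum.range = ⊤ := by
    rw [Finset.sum_map_toList]
    refine LinearMap.range_eq_top.2 fun x => ⟨fun a => J.repr x a, ?_⟩
    simp [sum_apply, J.sum_repr x]
  have hmap := hP.map_nhds_eq_of_surj hsurj
  rw [hP0] at hmap
  have h1 : ∀ᶠ x in 𝓝 (0 : E), expC G x ∈ S := by
    rw [← hmap]; exact hPS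
  have h2 : Tendsto (logC : G → E) (𝓝 1) (𝓝 0) := by
    simpa using (continuousAt_logC (E := E) (G := G)).tendsto
  filter_upwards [h2 h1, eventually_expC_logC (E := E) (G := G)] with v hv hv'
  have hv2 : expC G (logC v : E) ∈ S := hv
  rwa [hv'] at hv2

/-- The invertible part of `S` is a subgroup that is still a neighbourhood of `1`, hence open and
closed. -/
lemma submonoid_eq_top_of_mem_nhds [ConnectedSpace G] [IsTopologicalGroup G] {S : Submonoid G}
    (hS : (S : Set G) ∈ 𝓝 1) (v : G) : v ∈ S := by
  let U : Subgroup G :=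
    { carrier := {v | v ∈ S ∧ v⁻¹ ∈ S}
      mul_mem' := fun {a b} ha hb => ⟨S.mul_mem ha.1 hb.1, by
        rw [mul_inv_rev]; exact S.mul_mem hb.2 ha.2⟩
      one_mem' := ⟨S.one_mem, by simp [S.one_mem]⟩
      inv_mem' := fun {a} ha => ⟨ha.2, by simpa using ha.1⟩ }
  have hU : (U : Set G) ∈ 𝓝 1 := by
    have h2 : Tendsto (fun v : G => v⁻¹) (𝓝 1) (𝓝 1) := by
      simpa using (continuous_inv (G := G)).tendsto 1
    exact inter_mem hS (h2 hS)
  have hopen : IsOpen (U : Set G) := U.isOpen_of_mem_nhds hU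
  have huniv := IsClopen.eq_univ ⟨U.isClosed_of_isOpen hopen, hopen⟩ ⟨1, U.one_mem⟩
  have hv : v ∈ (U : Set G) := huniv ▸ mem_univ v
  exact hv.1

end Generation

/-! ### Trajectories sweep out products of conjugacy classes. -/

section Reachability

variable {E : Type*} [NormedAddCommGroup E] [NormedSpace ℝ E] [FiniteDimensional ℝ E]
  {G : Type*} [TopologicalSpace G] [ChartedSpace E G] [Group G]
  {ι : Type*} [Fintype ι] (J : Module.Basis ι ℝ E) {n g : ℕ}
  [LieGroup 𝓘(ℝ, E) ∞ G]

/-! ### Hamiltonian vectors -/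

lemma isHamiltonianAt_triv {f : Phase E G n g → ℝ}
    (hf : ContMDiff (phaseModel E n g) 𝓘(ℝ, ℝ) ∞ f) (p : Phase E G n g) :
    IsHamiltonianAt (phaseModel E n g) (decoupledBracket J) f p
      (triv p (decSharp p (dcov J f p)) : Vec E n g) := by
  intro h hh
  rw [decoupledBracket_eq J hf hh]
  have h1 := (hh.mdifferentiableAt (x := p) (by simp)).hasMFDerivAt
  rw [pair_dcov J h1]
  rfl

/-- Smooth functions realise every covector at `p`, so they distinguish tangent vectors there and a
Hamiltonian vector is unique. -/
lemma isHamiltonianAt_iff [T2Space G] {f : Phase E G n g → ℝ}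
    (hf : ContMDiff (phaseModel E n g) 𝓘(ℝ, ℝ) ∞ f) (p : Phase E G n g) (V : Vec E n g) :
    IsHamiltonianAt (phaseModel E n g) (decoupledBracket J) f p V
      ↔ V = triv p (decSharp p (dcov J f p)) := by
  constructor
  · intro hV
    by_contra hne
    obtain ⟨l, hl⟩ := SeparatingDual.exists_separating_of_ne (R := ℝ) hne
    obtain ⟨h, hh, hh'⟩ := exists_contMDiff_hasMFDerivAt (I := phaseModel E n g) p l
    have h1 := (hV h hh).trans (isHamiltonianAt_triv J hf p h hh).symm
    rw [hh'.mfderiv] at h1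
    exact hl h1
  · rintro rfl
    exact isHamiltonianAt_triv J hf p

lemma dcov_eq_of_hasFDerivAt {f : Phase E G n g → ℝ}
    (hf : ContMDiff (phaseModel E n g) 𝓘(ℝ, ℝ) ∞ f) {p : Phase E G n g} {a : Cov E n g}
    (h : HasFDerivAt (fun v => f (phaseExp p v)) (pair a) 0) : dcov J f p = a :=
  pair_injective ((fderiv_comp_phaseExp J hf p).symm.trans h.fderiv)

lemma pair_single_apply (X : Loop n g) (c : (E →L[ℝ] ℝ) × E) (v : Vec E n g) :
    pair (Pi.single X c) v = c.1 (v X).1 + (v X).2 c.2 := by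
  rw [pair_apply, Finset.sum_eq_single X]
  · simp
  · intro Y _ h; simp [h]
  · simp

lemma contMDiff_momentum (X : Loop n g) (ξ : E) :
    ContMDiff (phaseModel E n g) 𝓘(ℝ, ℝ) ∞ (fun p : Phase E G n g => (p X).2 ξ) :=
  (contMDiff_phase_snd X).clm_apply contMDiff_const

lemma dcov_momentum (X : Loop n g) (ξ : E) (p : Phase E G n g) :
    dcov J (fun p : Phase E G n g => (p X).2 ξ) p = Pi.single X (0, ξ) := by
  refine dcov_eq_of_hasFDerivAt J (contMDiff_momentum X ξ) ?_
  have h := ((hasPhaseDerivAt_phaseExp p X).2.clm_apply (hasFDerivAt_const ξ (0 : Vec E n g)))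
  refine h.congr_fderiv (ContinuousLinearMap.ext fun v => ?_)
  rw [pair_single_apply]
  simp

/-- The trivialised differential of a function of `u_X` is the same along the whole fibre over `u`,
not only at one point; `reach_shift` relies on this to keep the Hamiltonian vector constant. -/
lemma exists_dcov_base [T2Space G] (X : Loop n g) (u : G) (α : E →L[ℝ] ℝ) :
    ∃ f : Phase E G n g → ℝ, ContMDiff (phaseModel E n g) 𝓘(ℝ, ℝ) ∞ f ∧
      ∀ p : Phase E G n g, (p X).1 = u → dcov J f p = Pi.single X (α, 0) := by
  haveI : IsManifold 𝓘(ℝ, E) ∞ G := inferInstance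
  obtain ⟨F, hF, hF'⟩ := exists_contMDiff_hasMFDerivAt (I := 𝓘(ℝ, E)) u
    (α.comp (leftDivD u) : E →L[ℝ] ℝ)
  have hs := hF.comp (contMDiff_phase_fst (n := n) (g := g) X)
  refine ⟨fun p => F (p X).1, hs, ?_⟩
  rintro p rfl
  refine dcov_eq_of_hasFDerivAt J hs ?_
  have key : ∀ w, w = (p X).1 → HasMFDerivAt 𝓘(ℝ, E) 𝓘(ℝ, ℝ) F w
      (α.comp (leftDivD w) : E →L[ℝ] ℝ) := by
    rintro w rfl; exact hF'
  have h := (HasMFDerivAt.comp (0 : Vec E n g) (key _ (by simp [phaseExp]))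
    (hasPhaseDerivAt_phaseExp p X).1.hasMFDerivAt).hasFDerivAt
  refine h.congr_fderiv (ContinuousLinearMap.ext fun v : Vec E n g => ?_)
  have e : α (v X).1 = pair (Pi.single X (α, 0)) v := by rw [pair_single_apply]; simp
  have := DFunLike.congr_fun (leftDivD_comp_leftMulD (E := E) (phaseExp p (0 : Vec E n g) X).1) (v X).1
  exact (congrArg α this).trans e

/-! ### Trajectories -/

lemma hamiltonianStep_of_curve {f : Phase E G n g → ℝ}
    (hf : ContMDiff (phaseModel E n g) 𝓘(ℝ, ℝ) ∞ f) {γ : ℝ → Phase E G n g} {T : ℝ} (hT : 0 ≤ T)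
    (h : ∀ t ∈ Icc 0 T, HasPhaseDerivAt γ
      ((1 : ℝ →L[ℝ] ℝ).smulRight (decSharp (γ t) (dcov J f (γ t)))) t) :
    HamiltonianStep (phaseModel E n g) (decoupledBracket J) (γ 0) (γ T) := by
  refine ⟨f, hf, fun x => (triv x (decSharp x (dcov J f x)) : Vec E n g),
    fun x => isHamiltonianAt_triv J hf x, γ, T, hT, fun t ht => ?_, rfl, rfl⟩
  have h1 := (h t ht).hasMFDerivAt.hasMFDerivWithinAt (s := Icc 0 T)
  have h2 : (triv (γ t)).comp ((1 : ℝ →L[ℝ] ℝ).smulRight (decSharp (γ t) (dcov J f (γ t))))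
      = (1 : ℝ →L[ℝ] ℝ).smulRight (triv (γ t) (decSharp (γ t) (dcov J f (γ t)))) := by
    ext1; simp
  rw [h2] at h1
  exact h1

/-- The action of `G` on a factor of `(H*)ⁿ × (T*G)^{2g}` that lifts conjugation on a puncture
and right or left multiplication on a handle. -/
def slotMove : Loop n g → G → G × (E →L[ℝ] ℝ) → G × (E →L[ℝ] ℝ)
  | Sum.inl _, v, z => (v * z.1 * v⁻¹, coAd v⁻¹ z.2)
  | Sum.inr (Sum.inl _), v, z => (z.1 * v⁻¹, coAd v⁻¹ z.2)
  | Sum.inr (Sum.inr _), v, z => (v * z.1, coAd v⁻¹ z.2)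

lemma slotMove_mul (X : Loop n g) (v w : G) (z : G × (E →L[ℝ] ℝ)) :
    slotMove X (v * w) z = slotMove X v (slotMove X w z) := by
  rcases X with i | i | i <;> simp [slotMove, coAd_mul, mul_assoc]

lemma slotMove_one (X : Loop n g) (z : G × (E →L[ℝ] ℝ)) : slotMove X 1 z = z := by
  rcases X with i | i | i <;> simp [slotMove, coAd_one]

/-- The flow of `j_ξ^X`. That `Ad(w)` fixes `ξ` is the property of one-parameter groups by which the
velocity at the moved point is again the contraction of the constant covector `(0, ξ)`. -/
lemma hasPhaseDerivAt_slotMove (p : Phase E G n g) (X : Loop n g) {w : ℝ → G} {ξ : E} {t : ℝ}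
    (h : HasLogDerivAt w ((1 : ℝ →L[ℝ] ℝ).smulRight ξ) t) (hξ : Ad (w t) ξ = ξ) :
    HasPhaseDerivAt (fun s => Function.update p X (slotMove X (w s) (p X)))
      ((1 : ℝ →L[ℝ] ℝ).smulRight (decSharp (Function.update p X (slotMove X (w t) (p X)))
        (Pi.single X (0, ξ)))) t := by
  have hξ' : Ad (w t)⁻¹ ξ = ξ := by
    conv_lhs => rw [← hξ]
    exact Ad_inv_Ad _ _
  have hj : HasFDerivAt (fun s => coAd (w s)⁻¹ (p X).2)
      ((1 : ℝ →L[ℝ] ℝ).smulRight (-(coAd (w t)⁻¹ (p X).2).comp (ad G ξ))) t := by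
    have := h.inv.coAd (hasFDerivAt_const (p X).2 t)
    refine this.congr_fderiv ?_
    ext x
    simp [coAd_apply, hξ]
  have hz : ∃ T : ℝ →L[ℝ] E, HasLogDerivAt (fun s => (slotMove X (w s) (p X)).1) T t ∧
      T 1 = (decSharp (Function.update p X (slotMove X (w t) (p X))) (Pi.single X (0, ξ)) X).1 := by
    rcases X with i | i | i
    · refine ⟨_, (h.mul_const (p (lM i)).1).mul h.inv, ?_⟩
      simp [decSharp, slotMove, Ad_mul_apply, hξ, hξ', mul_inv_rev]
      abel
    · refine ⟨_, (h.inv.const_mul (p (lA i)).1), ?_⟩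
      simp [decSharp, slotMove, hξ]
    · refine ⟨_, (h.mul_const (p (lB i)).1), ?_⟩
      simp [decSharp, slotMove, Ad_mul_apply, hξ', mul_inv_rev]
  obtain ⟨T, hT, hT1⟩ := hz
  have hj' : HasFDerivAt (fun s => (slotMove X (w s) (p X)).2)
      ((1 : ℝ →L[ℝ] ℝ).smulRight (-(coAd (w t)⁻¹ (p X).2).comp (ad G ξ))) t := by
    rcases X with i | i | i <;> exact hj
  have hmain := hasPhaseDerivAt_update p X hT hj'
  have he : ((ContinuousLinearMap.single ℝ (fun _ : Loop n g => E × (E →L[ℝ] ℝ)) X).comp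
        (T.prod ((1 : ℝ →L[ℝ] ℝ).smulRight (-(coAd (w t)⁻¹ (p X).2).comp (ad G ξ)))))
      = (1 : ℝ →L[ℝ] ℝ).smulRight (decSharp (Function.update p X (slotMove X (w t) (p X)))
        (Pi.single X (0, ξ))) := by
    ext1
    ext1 Y
    by_cases hY : Y = X
    · subst hY
      have h2 : (decSharp (Function.update p Y (slotMove Y (w t) (p Y))) (Pi.single Y (0, ξ)) Y).2
          = -(coAd (w t)⁻¹ (p Y).2).comp (ad G ξ) := by
        rcases Y with i | i | i <;> simp [decSharp, slotMove]
      simp [hT1, ← h2]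
    · have h2 : decSharp (Function.update p X (slotMove X (w t) (p X))) (Pi.single X (0, ξ)) Y = 0 := by
        rcases Y with i | i | i <;> simp [decSharp, hY]
      simp [hY, h2]
  rw [he] at hmain
  exact hmain

variable (n g) in
/-- The group elements whose action on the factor `X` is realised by Hamiltonian trajectories. -/
def reachSubmonoid (X : Loop n g) : Submonoid G where
  carrier := {v | ∀ p : Phase E G n g, Relation.ReflTransGen
    (HamiltonianStep (phaseModel E n g) (decoupledBracket J)) p
      (Function.update p X (slotMove X v (p X)))}
  one_mem' := fun p => by rw [slotMove_one, Function.update_eq_self]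
  mul_mem' := fun {v w} hv hw p => by
    refine (hw p).trans ?_
    have := hv (Function.update p X (slotMove X w (p X)))
    rwa [Function.update_self, Function.update_idem, ← slotMove_mul] at this

lemma expC_mem_reachSubmonoid (X : Loop n g) {r : ℝ → E} {ξ : E} (hr0 : r 0 = 0) {T : ℝ}
    (hT : 0 ≤ T) (h : ∀ t ∈ Icc 0 T, HasLogDerivAt (fun t => expC G (r t))
      ((1 : ℝ →L[ℝ] ℝ).smulRight ξ) t) : expC G (r T) ∈ reachSubmonoid (G := G) J n g X := by
  intro p
  -- The derivative of `Ad(w) ξ` is `Ad(w) [ξ, ξ] = 0`.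
  have hAd : ∀ t ∈ Icc 0 T, Ad (expC G (r t)) ξ = ξ := by
    have hd : ∀ t ∈ Icc 0 T, HasDerivAt (fun t => Ad (expC G (r t)) ξ) 0 t := by
      intro t ht
      have := ((h t ht).Ad.clm_apply (hasFDerivAt_const ξ t)).hasDerivAt
      simpa [ad_self] using this
    intro t ht
    have := constant_of_derivWithin_zero
      (f := fun t => Ad (expC G (r t)) ξ) (a := 0) (b := T)
      (fun t ht => (hd t ht).differentiableAt.differentiableWithinAt)
      (fun t ht => (hd t ⟨ht.1, ht.2.le⟩).hasDerivWithinAt.derivWithin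
        (uniqueDiffOn_Icc (ht.1.trans_lt ht.2) t ⟨ht.1, ht.2.le⟩)) t ht
    simpa [hr0, Ad_one] using this
  refine Relation.ReflTransGen.single ?_
  have := hamiltonianStep_of_curve J (contMDiff_momentum X ξ)
    (γ := fun t => Function.update p X (slotMove X (expC G (r t)) (p X))) hT (fun t ht => by
      rw [dcov_momentum]
      exact hasPhaseDerivAt_slotMove p X (h t ht) (hAd t ht))
  simpa [hr0, slotMove_one] using this

lemma reach_slotMove [ConnectedSpace G] (X : Loop n g) (v : G) (p : Phase E G n g) :
    Relation.ReflTransGen (HamiltonianStep (phaseModel E n g) (decoupledBracket J)) p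
      (Function.update p X (slotMove X v (p X))) := by
  haveI : IsTopologicalGroup G := topologicalGroup_of_lieGroup 𝓘(ℝ, E) ∞
  refine submonoid_eq_top_of_mem_nhds (S := reachSubmonoid J n g X)
    (mem_nhds_one_of_curves (E := E) _ fun ξ => ?_) v p
  obtain ⟨ε, r, hε, hr0, hr, h⟩ := exists_hasLogDerivAt (G := G)
    (continuous_const (y := ξ) : Continuous fun _ : ℝ => ξ) 0
  refine ⟨r, hr0, hr, ?_⟩
  filter_upwards [Ioo_mem_nhds (neg_lt_zero.2 hε) hε] with T hT
  rcases le_total 0 T with h0 | h0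
  · exact expC_mem_reachSubmonoid J X hr0 h0 fun t ht =>
      h t ⟨by linarith [ht.1], by linarith [ht.2, hT.2]⟩
  -- For negative times the reversed curve, with logarithmic derivative `-ξ`, is used.
  · have := expC_mem_reachSubmonoid J X (G := G) (r := fun t => r (-t)) (ξ := -ξ) (T := -T)
      (by simpa using hr0) (by linarith) fun t ht => by
        have h1 := HasLogDerivAt.comp_clm (A := -ContinuousLinearMap.id ℝ ℝ) (n₀ := t)
          (h (-t) ⟨by linarith [ht.2, hT.1], by linarith [ht.1]⟩)
        refine h1.congr_fderiv ?_
        ext; simp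
    simpa using this

/-- A function of `u_X` does not move `u_X`, and the fibre component of its Hamiltonian vector
depends only on `u_X`; the trajectory is therefore a straight line in the fibre. -/
lemma reach_shift [T2Space G] (X : Loop n g) (α : E →L[ℝ] ℝ) (p : Phase E G n g) :
    Relation.ReflTransGen (HamiltonianStep (phaseModel E n g) (decoupledBracket J)) p
      (Function.update p X ((p X).1, (p X).2 + (decSharp p (Pi.single X (α, 0)) X).2)) := by
  obtain ⟨f, hf, hf'⟩ := exists_dcov_base (n := n) (g := g) J X (p X).1 α
  set y := (decSharp p (Pi.single X (α, 0)) X).2 with hy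
  refine Relation.ReflTransGen.single ?_
  have := hamiltonianStep_of_curve J hf (T := 1)
    (γ := fun t => Function.update p X ((p X).1, (p X).2 + t • y)) zero_le_one (fun t _ => by
      rw [hf' _ (by simp)]
      have hd : HasFDerivAt (fun t : ℝ => (p X).2 + t • y) ((1 : ℝ →L[ℝ] ℝ).smulRight y) t := by
        have h1 : HasFDerivAt (fun t : ℝ => t • y) ((1 : ℝ →L[ℝ] ℝ).smulRight y) t :=
          ((1 : ℝ →L[ℝ] ℝ).smulRight y).hasFDerivAt
        exact h1.const_add _
      have h1 := hasPhaseDerivAt_update p X (z := fun t : ℝ => ((p X).1, (p X).2 + t • y))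
        (hasLogDerivAt_const (p X).1 t) hd
      have he : ((ContinuousLinearMap.single ℝ (fun _ : Loop n g => E × (E →L[ℝ] ℝ)) X).comp
          ((0 : ℝ →L[ℝ] E).prod ((1 : ℝ →L[ℝ] ℝ).smulRight y)))
          = (1 : ℝ →L[ℝ] ℝ).smulRight (decSharp (Function.update p X ((p X).1, (p X).2 + t • y))
            (Pi.single X (α, 0))) := by
        ext1
        ext1 Y
        by_cases hY : Y = X
        · subst hY
          have h2 : decSharp (Function.update p Y ((p Y).1, (p Y).2 + t • y))
              (Pi.single Y (α, 0)) Y = (0, y) := by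
            rw [hy]
            rcases Y with i | i | i <;> simp [decSharp]
          simp [h2]
        · have h2 : decSharp (Function.update p X ((p X).1, (p X).2 + t • y))
              (Pi.single X (α, 0)) Y = 0 := by
            rcases Y with i | i | i <;> simp [decSharp, hY]
          simp [hY, h2]
      rw [he] at h1
      exact h1)
  simpa using this

/-! ### Conjugacy classes of `H` -/

lemma ofH_toH (z : G × (E →L[ℝ] ℝ)) : ofH (toH z) = z := by
  have := ofH_toH_mul z 1 (0 : E →L[ℝ] ℝ)
  have h1 : mkH (1 : G) (0 : E →L[ℝ] ℝ) = 1 := rfl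
  rw [h1, mul_one] at this
  rw [this]
  refine Prod.ext (mul_one _) ?_
  ext x
  simp [coAd_apply, Ad_one_apply]

lemma toH_ofH (h : SemiH E G) : toH (ofH h) = h := by
  refine SemidirectProduct.ext ?_ rfl
  change Multiplicative.ofAdd (-coAd h.right⁻¹ (-coAd h.right (Multiplicative.toAdd h.left))) = h.left
  have : -coAd h.right⁻¹ (-coAd h.right (Multiplicative.toAdd h.left))
      = Multiplicative.toAdd h.left := by
    ext x; simp [coAd_apply, Ad_Ad_inv]
  rw [this]; rfl

lemma mkH_inv (v : G) (x : E →L[ℝ] ℝ) : (mkH v x)⁻¹ = mkH v⁻¹ (-coAd v x) := by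
  refine inv_eq_of_mul_eq_one_right (SemidirectProduct.ext ?_ (mul_inv_cancel v))
  change Multiplicative.ofAdd (x + coAd v⁻¹ (-coAd v x)) = 1
  have : x + coAd v⁻¹ (-coAd v x) = 0 := by
    ext y; simp [coAd_apply, Ad_Ad_inv]
  rw [this]; rfl

lemma ofH_conj (v : G) (x : E →L[ℝ] ℝ) (z : G × (E →L[ℝ] ℝ)) :
    ofH (mkH v x * toH z * (mkH v x)⁻¹)
      = (v * z.1 * v⁻¹, coAd v⁻¹ z.2 + x - coAd (v * z.1 * v⁻¹) x) := by
  rw [← toH_ofH (mkH v x * toH z), ofH_mul_toH, mkH_inv, ofH_toH_mul]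
  refine Prod.ext rfl ?_
  ext y
  simp [coAd_apply, Ad_mul_apply, Ad_Ad_inv]
  ring

lemma isConj_toH_iff {z z' : G × (E →L[ℝ] ℝ)} : IsConj (toH z) (toH z') ↔
    ∃ (v : G) (x : E →L[ℝ] ℝ), z' = (v * z.1 * v⁻¹, coAd v⁻¹ z.2 + x - coAd (v * z.1 * v⁻¹) x) := by
  rw [isConj_iff]
  constructor
  · rintro ⟨c, hc⟩
    refine ⟨c.right, Multiplicative.toAdd c.left, ?_⟩
    rw [← ofH_conj, ← ofH_toH z', ← hc]
    rfl
  · rintro ⟨v, x, rfl⟩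
    refine ⟨mkH v x, ?_⟩
    rw [← ofH_conj, toH_ofH]

/-- The points of the factor `X` that can be reached from `z`. -/
def SameLeaf : Loop n g → G × (E →L[ℝ] ℝ) → G × (E →L[ℝ] ℝ) → Prop
  | Sum.inl _, z, z' => IsConj (toH z) (toH z')
  | Sum.inr _, _, _ => True

/-- On a puncture, conjugation by `(v, x)` is the group move by `v` followed by the shift `x -
Ad*(u) x`, which is the one generated by `α = -Ad*(u) x`. On a handle the group move reaches any `u`
and the shifts reach any momentum. -/
lemma exists_slotMove_shift {X : Loop n g} {z z' : G × (E →L[ℝ] ℝ)} (h : SameLeaf X z z') :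
    ∃ (v : G) (α : E →L[ℝ] ℝ), ∀ p : Phase E G n g, p X = slotMove X v z →
      z' = ((p X).1, (p X).2 + (decSharp p (Pi.single X (α, 0)) X).2) := by
  rcases X with i | i | i
  · obtain ⟨v, x, rfl⟩ := isConj_toH_iff.1 h
    refine ⟨v, -coAd (v * z.1 * v⁻¹) x, fun p hp => ?_⟩
    refine Prod.ext (by simp [hp, slotMove]) ?_
    ext y
    simp [hp, slotMove, decSharp, coAd_apply, Ad_mul_apply, Ad_Ad_inv, Ad_inv_Ad]
    ring
  · refine ⟨z'.1⁻¹ * z.1, z'.2 - coAd (z'.1⁻¹ * z.1)⁻¹ z.2, fun p hp => ?_⟩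
    refine Prod.ext (by simp [hp, slotMove]) ?_
    simp [hp, slotMove, decSharp]
  · refine ⟨z'.1 * z.1⁻¹, -coAd z'.1 (z'.2 - coAd (z'.1 * z.1⁻¹)⁻¹ z.2), fun p hp => ?_⟩
    refine Prod.ext (by simp [hp, slotMove]) ?_
    ext y
    simp [hp, slotMove, decSharp, coAd_apply, Ad_mul_apply, Ad_Ad_inv]

lemma reach_update [T2Space G] [ConnectedSpace G] (p : Phase E G n g) (X : Loop n g)
    {z : G × (E →L[ℝ] ℝ)} (h : SameLeaf X (p X) z) :
    Relation.ReflTransGen (HamiltonianStep (phaseModel E n g) (decoupledBracket J)) p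
      (Function.update p X z) := by
  obtain ⟨v, α, hv⟩ := exists_slotMove_shift h
  refine (reach_slotMove J X v p).trans ?_
  have := reach_shift J X α (Function.update p X (slotMove X v (p X)))
  rwa [← hv _ (Function.update_self ..), Function.update_idem] at this

lemma reach_of_sameLeaf [T2Space G] [ConnectedSpace G] {p q : Phase E G n g}
    (h : ∀ X, SameLeaf X (p X) (q X)) :
    Relation.ReflTransGen (HamiltonianStep (phaseModel E n g) (decoupledBracket J)) p q := by
  have key : ∀ s : Finset (Loop n g), Relation.ReflTransGen
      (HamiltonianStep (phaseModel E n g) (decoupledBracket J)) p (s.piecewise q p) := by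
    intro s
    induction s using Finset.induction_on with
    | empty => rw [Finset.piecewise_empty]
    | insert X s hX ih =>
      rw [Finset.piecewise_insert]
      refine ih.trans (reach_update J _ X ?_)
      rw [Finset.piecewise_eq_of_notMem _ _ _ hX]
      exact h X
  simpa using key Finset.univ

end Reachability

/-! ### Trajectories stay in conjugacy classes; the leaves. -/

section Invariance

variable {E : Type*} [NormedAddCommGroup E] [NormedSpace ℝ E] [FiniteDimensional ℝ E]
  {G : Type*} [TopologicalSpace G] [ChartedSpace E G] [Group G]
  {ι : Type*} [Fintype ι] (J : Module.Basis ι ℝ E) {n g : ℕ}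
  {N : Type*} [NormedAddCommGroup N] [NormedSpace ℝ N]
  [LieGroup 𝓘(ℝ, E) ∞ G]

/-! ### From manifold derivatives to logarithmic derivatives -/

lemma hasMFDerivAt_logC :
    HasMFDerivAt 𝓘(ℝ, E) 𝓘(ℝ, E) (logC : G → E) 1 (ContinuousLinearMap.id ℝ E) := by
  have hM : IsManifold 𝓘(ℝ, E) 1 G := IsManifold.of_le (n := ∞) (by norm_cast)
  have h := (mdifferentiableAt_extChartAt (I := 𝓘(ℝ, E)) (mem_chart_source E (1 : G))).hasMFDerivAt
  have h2 := mfderiv_extChartAt_self (E := E) (1 : G)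
  have h3 : HasMFDerivAt 𝓘(ℝ, E) 𝓘(ℝ, E) (extChartAt 𝓘(ℝ, E) (1 : G)) 1
    (ContinuousLinearMap.id ℝ E) := h2 ▸ h
  have h4 := h3.sub (hasMFDerivAt_const (I := 𝓘(ℝ, E)) (I' := 𝓘(ℝ, E))
    (extChartAt 𝓘(ℝ, E) (1 : G) 1) (1 : G))
  have e : (ContinuousLinearMap.id ℝ E - 0 : E →L[ℝ] E) = ContinuousLinearMap.id ℝ E := sub_zero _
  exact e ▸ h4

lemma hasLogDerivAt_of_hasMFDerivAt {Φ : N → G} {T : N →L[ℝ] E} {n₀ : N}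
    (h : HasMFDerivAt 𝓘(ℝ, N) 𝓘(ℝ, E) Φ n₀ ((leftMulD (Φ n₀)).comp T : N →L[ℝ] E)) :
    HasLogDerivAt Φ T n₀ := by
  refine ⟨h.1, ?_⟩
  have key : ∀ w : G, w = 1 → HasMFDerivAt 𝓘(ℝ, E) 𝓘(ℝ, E) (logC : G → E) w
      (ContinuousLinearMap.id ℝ E) := by
    rintro w rfl; exact hasMFDerivAt_logC
  have hdiv : HasMFDerivAt 𝓘(ℝ, E) 𝓘(ℝ, E) (fun v : G => (Φ n₀)⁻¹ * v) (Φ n₀)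
      (leftDivD (Φ n₀) : E →L[ℝ] E) :=
    ((contMDiff_mul_left' _).mdifferentiableAt (by simp)).hasMFDerivAt
  have h1 := (HasMFDerivAt.comp n₀ (HasMFDerivAt.comp (Φ n₀) (key _ (by simp)) hdiv) h).hasFDerivAt
  refine h1.congr_fderiv (ContinuousLinearMap.ext fun x : N => ?_)
  exact DFunLike.congr_fun (leftDivD_comp_leftMulD (E := E) (Φ n₀)) (T x)

lemma hasPhaseDerivAt_of_hasMFDerivAt {Φ : N → Phase E G n g} {T : N →L[ℝ] Vec E n g} {n₀ : N}
    (h : HasMFDerivAt 𝓘(ℝ, N) (phaseModel E n g) Φ n₀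
      ((triv (Φ n₀)).comp T : N →L[ℝ] Vec E n g)) : HasPhaseDerivAt Φ T n₀ := by
  intro X
  have h1 := HasMFDerivAt.comp n₀ (hasMFDerivAt_apply
    (IF := fun _ : Loop n g => (𝓘(ℝ, E)).prod 𝓘(ℝ, E →L[ℝ] ℝ)) (Φ n₀) X) h
  have h2 := HasMFDerivAt.comp n₀ (hasMFDerivAt_fst (I := 𝓘(ℝ, E)) (I' := 𝓘(ℝ, E →L[ℝ] ℝ))
    (Φ n₀ X)) h1
  have h3 := HasMFDerivAt.comp n₀ (hasMFDerivAt_snd (I := 𝓘(ℝ, E)) (I' := 𝓘(ℝ, E →L[ℝ] ℝ))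
    (Φ n₀ X)) h1
  exact ⟨hasLogDerivAt_of_hasMFDerivAt h2, h3.hasFDerivAt⟩

/-! ### Constancy -/

/-- Derivatives are required only in the open interval because an integral curve on a closed
interval has merely one-sided ones at the ends. -/
lemma eq_of_hasDerivAt_zero {φ : ℝ → ℝ} {a b : ℝ} (hab : a ≤ b) (hc : ContinuousOn φ (Icc a b))
    (hd : ∀ t ∈ Ioo a b, HasDerivAt φ 0 t) : φ a = φ b := by
  rcases hab.eq_or_lt with rfl | hlt
  · rfl
  · obtain ⟨c, -, hc'⟩ := exists_hasDerivAt_eq_slope φ (fun _ => 0) hlt hc hd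
    rw [eq_comm, div_eq_zero_iff] at hc'
    rcases hc' with h | h <;> linarith

lemma exists_contMDiff_ne [T2Space G] {u v : G} (h : u ≠ v) :
    ∃ F : G → ℝ, ContMDiff 𝓘(ℝ, E) 𝓘(ℝ, ℝ) ∞ F ∧ F u ≠ F v := by
  haveI : IsManifold 𝓘(ℝ, E) ∞ G := inferInstance
  obtain ⟨b, -, hb⟩ := (SmoothBumpFunction.nhds_basis_support (I := 𝓘(ℝ, E)) (c := u)
    (s := {v}ᶜ) (isOpen_compl_singleton.mem_nhds h)).mem_iff.1
    (isOpen_compl_singleton.mem_nhds h)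
  refine ⟨b, b.contMDiff, ?_⟩
  have hv : b v = 0 := by
    by_contra hne
    exact hb hne rfl
  rw [hv, b.eq_one]
  exact one_ne_zero

/-- A smooth function separating the two end points would be constant along the curve. -/
lemma eq_of_hasLogDerivAt_zero [T2Space G] {u : ℝ → G} {a b : ℝ} (hab : a ≤ b)
    (hc : ContinuousOn u (Icc a b))
    (hd : ∀ t ∈ Ioo a b, HasLogDerivAt u (0 : ℝ →L[ℝ] E) t) : u a = u b := by
  by_contra hne
  obtain ⟨F, hF, hF'⟩ := exists_contMDiff_ne (E := E) hne
  refine hF' (eq_of_hasDerivAt_zero (φ := fun t => F (u t)) hab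
    (hF.continuous.comp_continuousOn hc) fun t ht => ?_)
  let k : E →L[ℝ] ℝ := mfderiv 𝓘(ℝ, E) 𝓘(ℝ, ℝ) F (u t)
  have h : HasFDerivAt (fun t => F (u t)) (k.comp ((leftMulD (u t)).comp (0 : ℝ →L[ℝ] E))) t :=
    (HasMFDerivAt.comp t (hF.mdifferentiableAt (x := u t) (by simp)).hasMFDerivAt
      (hd t ht).hasMFDerivAt).hasFDerivAt
  simpa using h.hasDerivAt

/-! ### Conjugacy classes are preserved by Hamiltonian trajectories -/

/-- Conjugating by the solution `w` of `w⁻¹ w' = -γ` freezes the group component, while the momentum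
retains only a velocity in the image of `1 - Ad*(u⁻¹)` for the now constant `u`. Its total
displacement lies in that fixed subspace, and such displacements are conjugations by elements of
`𝔤*`. -/
lemma isConj_of_twisted_curve [T2Space G] {z : ℝ → G × (E →L[ℝ] ℝ)} {w : ℝ → G} {γ : ℝ → E}
    {α : ℝ → E →L[ℝ] ℝ} {a b : ℝ} (hab : a ≤ b)
    (hz1 : ContinuousOn (fun t => (z t).1) (Icc a b)) (hz2 : ContinuousOn (fun t => (z t).2) (Icc a b))
    (hw : ∀ t ∈ Icc a b, HasLogDerivAt w ((1 : ℝ →L[ℝ] ℝ).smulRight (-γ t)) t)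
    (h1 : ∀ t ∈ Ioo a b, HasLogDerivAt (fun t => (z t).1)
      ((1 : ℝ →L[ℝ] ℝ).smulRight (Ad (z t).1⁻¹ (γ t) - γ t)) t)
    (h2 : ∀ t ∈ Ioo a b, HasFDerivAt (fun t => (z t).2) ((1 : ℝ →L[ℝ] ℝ).smulRight
      (-(z t).2.comp (ad G (γ t)) + α t - (α t).comp (Ad (z t).1⁻¹))) t) :
    IsConj (toH (z a)) (toH (z b)) := by
  haveI : IsTopologicalGroup G := topologicalGroup_of_lieGroup 𝓘(ℝ, E) ∞
  have hwc : ContinuousOn w (Icc a b) := fun t ht => (hw t ht).1.continuousWithinAt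
  set u₁ : ℝ → G := fun t => w t * (z t).1 * (w t)⁻¹ with hu
  set j₁ : ℝ → E →L[ℝ] ℝ := fun t => coAd (w t)⁻¹ (z t).2 with hj
  have hu₁ : ∀ t ∈ Icc a b, u₁ a = u₁ t := fun t ht => by
    refine eq_of_hasLogDerivAt_zero (E := E) ht.1
      (((hwc.mul hz1).mul hwc.inv).mono (Icc_subset_Icc_right ht.2)) fun s hs => ?_
    have hs' : s ∈ Ioo a b := ⟨hs.1, hs.2.trans_le ht.2⟩
    have hws := hw s ⟨hs'.1.le, hs'.2.le⟩
    refine ((hws.mul (h1 s hs')).mul hws.inv).congr_fderiv ?_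
    ext
    simp only [inv_inv, ContinuousLinearMap.add_comp, add_apply, neg_apply,
      ContinuousLinearMap.comp_apply, ContinuousLinearMap.smulRight_apply, one_apply, one_smul,
      map_add, map_sub, map_neg, Ad_inv_Ad, zero_apply, one_apply_eq_self]
    abel
  have hconj : ∀ t, IsConj (toH (z t)) (toH (u₁ t, j₁ t)) := fun t =>
    isConj_toH_iff.2 ⟨w t, 0, by simp [hu, hj, coAd_zero]⟩
  have hjd : ∀ t ∈ Ioo a b, HasFDerivAt j₁ ((1 : ℝ →L[ℝ] ℝ).smulRight
      ((α t).comp (Ad (w t)⁻¹) - ((α t).comp (Ad (w t)⁻¹)).comp (Ad (u₁ a)⁻¹))) t := by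
    intro t ht
    have hwt := hw t ⟨ht.1.le, ht.2.le⟩
    refine (hwt.inv.coAd (h2 t ht)).congr_fderiv ?_
    rw [hu₁ t ⟨ht.1.le, ht.2.le⟩]
    ext x
    simp [hu, Ad_mul_apply, Ad_inv_Ad, Ad_ad]
    ring
  have hjc : ContinuousOn j₁ (Icc a b) :=
    hz2.clm_comp ((contMDiff_Ad (E := E) (G := G)).continuous.comp_continuousOn hwc.inv)
  let R : (E →L[ℝ] ℝ) →ₗ[ℝ] E →L[ℝ] ℝ :=
    { toFun := fun β => β - β.comp (Ad (u₁ a)⁻¹)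
      map_add' := fun β β' => by ext x; simp; ring
      map_smul' := fun c β => by ext x; simp; ring }
  -- Otherwise some functional vanishing on the image would separate the displacement from it,
  -- although its composite with `j₁` has zero derivative.
  have hR : j₁ b - j₁ a ∈ LinearMap.range R := by
    by_contra hne
    obtain ⟨ℓ, hℓ, hker⟩ := Submodule.exists_le_ker_of_notMem hne
    let ℓ' : (E →L[ℝ] ℝ) →L[ℝ] ℝ := LinearMap.toContinuousLinearMap ℓ
    have h0 := eq_of_hasDerivAt_zero (φ := fun t => ℓ' (j₁ t)) hab
      (ℓ'.continuous.comp_continuousOn hjc) fun t ht => by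
        have h3 := (ℓ'.hasFDerivAt.comp t (hjd t ht)).hasDerivAt
        have h4 : ℓ' (R ((α t).comp (Ad (w t)⁻¹))) = 0 := hker ⟨_, rfl⟩
        refine h3.congr_deriv (Eq.trans ?_ h4)
        simp [R]
    apply hℓ
    rw [map_sub, sub_eq_zero]
    exact h0.symm
  obtain ⟨β, hβ⟩ := hR
  refine (hconj a).trans (IsConj.trans ?_ (hconj b).symm)
  -- For `x = -Ad*(u⁻¹) β` one has `x - Ad*(u) x = β - Ad*(u⁻¹) β`.
  refine isConj_toH_iff.2 ⟨1, -β.comp (Ad (u₁ a)⁻¹), ?_⟩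
  refine Prod.ext (by simp [hu₁ b ⟨hab, le_rfl⟩]) ?_
  have hβ' : β - β.comp (Ad (u₁ a)⁻¹) = j₁ b - j₁ a := hβ
  have e : j₁ b = j₁ a + (β - β.comp (Ad (u₁ a)⁻¹)) := by rw [hβ']; abel
  change j₁ b = _
  rw [e]
  ext x
  simp [coAd_apply, Ad_one_apply, Ad_inv_Ad]
  ring

lemma isConj_of_hamiltonianStep [T2Space G] {p q : Phase E G n g}
    (h : HamiltonianStep (phaseModel E n g) (decoupledBracket J) p q) (i : Fin n) :
    IsConj (toH (p (lM i))) (toH (q (lM i))) := by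
  obtain ⟨f, hf, V, hV, γ, T, hT, hγ, rfl, rfl⟩ := h
  have hcont : ContinuousOn γ (Icc 0 T) := fun t ht => (hγ t ht).1
  have hd : ∀ t ∈ Ioo 0 T, HasPhaseDerivAt γ
      ((1 : ℝ →L[ℝ] ℝ).smulRight (decSharp (γ t) (dcov J f (γ t)))) t := by
    intro t ht
    refine hasPhaseDerivAt_of_hasMFDerivAt ?_
    have h1 := (hγ t ⟨ht.1.le, ht.2.le⟩).hasMFDerivAt (Icc_mem_nhds ht.1 ht.2)
    have hVt : V (γ t) = (triv (γ t) (decSharp (γ t) (dcov J f (γ t))) : Vec E n g) :=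
      (isHamiltonianAt_iff J hf (γ t) _).1 (hV (γ t))
    rw [hVt] at h1
    have h2 : (triv (γ t)).comp ((1 : ℝ →L[ℝ] ℝ).smulRight (decSharp (γ t) (dcov J f (γ t))))
        = (1 : ℝ →L[ℝ] ℝ).smulRight (triv (γ t) (decSharp (γ t) (dcov J f (γ t)))) := by
      ext1; simp
    rw [h2]
    exact h1
  -- Projecting the time to `[0, T]` extends the coefficient continuously to all of `ℝ`, as the
  -- existence theorem demands.
  set c : ℝ → E := fun t => -(dcov J f (γ (projIcc 0 T hT t)) (lM i)).2 with hc
  have hcc : Continuous c := by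
    refine (((contMDiff_dcov_snd J hf (lM i)).continuous.comp ?_)).neg
    exact (continuousOn_iff_continuous_domRestrict.1 hcont).comp continuous_projIcc
  have hceq : ∀ t ∈ Icc 0 T, c t = -(dcov J f (γ t) (lM i)).2 := fun t ht => by
    simp only [hc, projIcc_of_mem hT ht]
  have hz1 : ContinuousOn (fun t => (γ t (lM i)).1) (Icc 0 T) :=
    (contMDiff_phase_fst (E := E) (G := G) (lM i)).continuous.comp_continuousOn hcont
  have hz2 : ContinuousOn (fun t => (γ t (lM i)).2) (Icc 0 T) :=
    (contMDiff_phase_snd (E := E) (G := G) (lM i)).continuous.comp_continuousOn hcont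
  have hstep : ∀ a b, 0 ≤ a → a ≤ b → b ≤ T → ∀ r : ℝ → E,
      (∀ t ∈ Icc a b, HasLogDerivAt (fun t => expC G (r t)) ((1 : ℝ →L[ℝ] ℝ).smulRight (c t)) t) →
      IsConj (toH (γ a (lM i))) (toH (γ b (lM i))) := by
    intro a b ha hab hb r hr
    have hsub : Icc a b ⊆ Icc 0 T := Icc_subset_Icc ha hb
    refine isConj_of_twisted_curve (z := fun t => γ t (lM i)) (w := fun t => expC G (r t))
      (γ := fun t => (dcov J f (γ t) (lM i)).2) (α := fun t => (dcov J f (γ t) (lM i)).1) hab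
      (hz1.mono hsub) (hz2.mono hsub) (fun t ht => ?_) (fun t ht => ?_) (fun t ht => ?_)
    · rw [← hceq t (hsub ht)]
      exact hr t ht
    · refine (hd t ⟨ha.trans_lt ht.1, ht.2.trans_le hb⟩ (lM i)).1.congr_fderiv ?_
      ext; simp [decSharp]
    · refine (hd t ⟨ha.trans_lt ht.1, ht.2.trans_le hb⟩ (lM i)).2.congr_fderiv ?_
      ext; simp [decSharp]
  -- The gauge curve exists only for short times; conjugacy is an equivalence relation, so its local
  -- validity propagates over the connected interval.
  refine isPreconnected_Icc.induction₂ (fun s t => IsConj (toH (γ s (lM i))) (toH (γ t (lM i))))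
    (fun s hs => ?_) (fun _ _ _ _ _ _ => IsConj.trans) (fun _ _ _ _ => IsConj.symm)
    (left_mem_Icc.2 hT) (right_mem_Icc.2 hT)
  obtain ⟨ε, r, hε, -, -, hr⟩ := exists_hasLogDerivAt (G := G) hcc s
  filter_upwards [self_mem_nhdsWithin, mem_nhdsWithin_of_mem_nhds
    (Ioo_mem_nhds (show s - ε < s by linarith) (show s < s + ε by linarith))] with t ht hts
  rcases le_total s t with h | h
  · exact hstep s t hs.1 h ht.2 r fun x hx => hr x ⟨by linarith [hx.1], by linarith [hx.2, hts.2]⟩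
  · exact (hstep t s ht.1 h hs.2 r fun x hx =>
      hr x ⟨by linarith [hx.1, hts.1], by linarith [hx.2]⟩).symm

/-! ### The leaves -/

lemma reach_iff [T2Space G] [ConnectedSpace G] {p q : Phase E G n g} :
    Relation.ReflTransGen (HamiltonianStep (phaseModel E n g) (decoupledBracket J)) p q
      ↔ ∀ i : Fin n, IsConj (toH (p (lM i))) (toH (q (lM i))) := by
  constructor
  · intro h i
    induction h with
    | refl => exact IsConj.refl _
    | tail _ h ih => exact ih.trans (isConj_of_hamiltonianStep J h i)
  · intro h
    refine reach_of_sameLeaf J fun X => ?_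
    rcases X with i | X
    · exact h i
    · trivial

lemma isSymplecticLeaf_iff [T2Space G] [ConnectedSpace G] (S : Set (Phase E G n g)) :
    IsSymplecticLeaf (phaseModel E n g) (decoupledBracket J) S ↔
      ∃ C : Fin n → ConjClasses (SemiH E G), S = conjProduct C := by
  constructor
  · rintro ⟨p, rfl⟩
    refine ⟨fun i => ConjClasses.mk (toH (p (lM i))), ?_⟩
    ext q
    simp only [mem_ofPred_eq, reach_iff, conjProduct, ConjClasses.mem_carrier_iff_mk_eq,
      ConjClasses.mk_eq_mk_iff_isConj]
    exact forall_congr' fun i => isConj_comm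
  · rintro ⟨C, rfl⟩
    have h := fun i => ConjClasses.exists_rep (C i)
    choose c hc using h
    refine ⟨fun X => match X with
      | Sum.inl i => ofH (c i)
      | Sum.inr _ => (1, 0), ?_⟩
    ext q
    simp only [mem_ofPred_eq, reach_iff, conjProduct, ConjClasses.mem_carrier_iff_mk_eq, toH_ofH]
    refine forall_congr' fun i => ?_
    rw [← hc i, ConjClasses.mk_eq_mk_iff_isConj]
    exact isConj_comm

end Invariance

/-! ### Parametrised leaves and their symplectic structure. -/

section Symplectic

variable {E : Type*} [NormedAddCommGroup E] [NormedSpace ℝ E] [FiniteDimensional ℝ E]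
  {G : Type*} [TopologicalSpace G] [ChartedSpace E G] [Group G]
  {ι : Type*} [Fintype ι] (J : Module.Basis ι ℝ E) {n g : ℕ}
  {N : Type*} [NormedAddCommGroup N] [NormedSpace ℝ N]
  [LieGroup 𝓘(ℝ, E) ∞ G]

/-! ### The parametrisation of the leaves -/

lemma conjMap_puncture (gμ : Fin n → G) (s : Fin n → (E →L[ℝ] ℝ)) (p : Phase E G n g) (i : Fin n) :
    conjMap gμ s p (lM i) = ((p (lM i)).1 * gμ i * (p (lM i)).1⁻¹,
      coAd (p (lM i)).1⁻¹ (coAd (gμ i) (s i)) + (p (lM i)).2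
        - coAd ((p (lM i)).1 * gμ i * (p (lM i)).1⁻¹) (p (lM i)).2) := by
  have h : mkH (gμ i) (-s i) = toH (gμ i, coAd (gμ i) (s i)) := by
    have : coAd (gμ i)⁻¹ (coAd (gμ i) (s i)) = s i := by ext x; simp [coAd_apply, Ad_Ad_inv]
    simp only [toH, this]
  change ofH (mkH (p (lM i)).1 (p (lM i)).2 * mkH (gμ i) (-s i)
    * (mkH (p (lM i)).1 (p (lM i)).2)⁻¹) = _
  rw [h, ofH_conj]

lemma contMDiff_conjMap (gμ : Fin n → G) (s : Fin n → (E →L[ℝ] ℝ)) :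
    ContMDiff (phaseModel E n g) (phaseModel E n g) ∞
      (conjMap gμ s : Phase E G n g → Phase E G n g) := by
  have hu : ∀ i : Fin n, ContMDiff (phaseModel E n g) 𝓘(ℝ, E) ∞
      (fun p : Phase E G n g => (p (lM i)).1 * gμ i * (p (lM i)).1⁻¹) := fun i =>
    ((contMDiff_phase_fst _).mul contMDiff_const).mul (contMDiff_phase_fst _).inv
  intro p
  refine contMDiffAt_phase_of (fun X => ?_) (fun X => ?_)
  · rcases X with i | X
    · simp only [conjMap_puncture]
      exact hu i p
    · exact contMDiff_phase_fst _ p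
  · rcases X with i | X
    · simp only [conjMap_puncture]
      exact (((contMDiff_coAd (contMDiff_phase_fst _).inv contMDiff_const).add
        (contMDiff_phase_snd _)).sub (contMDiff_coAd (hu i) (contMDiff_phase_snd _))) p
    · exact contMDiff_phase_snd _ p

lemma range_conjMap (gμ : Fin n → G) (s : Fin n → (E →L[ℝ] ℝ)) :
    Set.range (conjMap gμ s : Phase E G n g → Phase E G n g) =
      conjProduct (fun i => ConjClasses.mk (mkH (gμ i) (-s i))) := by
  ext q
  simp only [conjProduct, mem_ofPred_eq, ConjClasses.mem_carrier_iff_mk_eq,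
    ConjClasses.mk_eq_mk_iff_isConj]
  constructor
  · rintro ⟨p, rfl⟩ i
    refine IsConj.symm (isConj_iff.2 ⟨mkH (p (lM i)).1 (p (lM i)).2, ?_⟩)
    exact (toH_ofH _).symm
  · intro h
    have h' := fun i => isConj_iff.1 (h i).symm
    choose c hc using h'
    refine ⟨fun X => match X with
      | Sum.inl i => ((c i).right, Multiplicative.toAdd (c i).left)
      | Sum.inr X => q (Sum.inr X), funext fun X => ?_⟩
    rcases X with i | X
    · exact (congrArg ofH (hc i)).trans (ofH_toH _)
    · rfl

/-- A covector whose contraction with the bivector at `conjMap gμ s p` is the image of the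
left-trivialised vector `v` at `p`. -/
def leafCov (gμ : Fin n → G) (p : Phase E G n g) (v : Vec E n g) : Cov E n g
  | Sum.inl i =>
      (-((v (lM i)).2 + (p (lM i)).2.comp (ad G (Ad (p (lM i)).1 (v (lM i)).1))).comp
          (Ad ((p (lM i)).1 * gμ i * (p (lM i)).1⁻¹)),
        Ad (p (lM i)).1 (v (lM i)).1)
  | Sum.inr (Sum.inl i) =>
      ((v (lA i)).2 - (p (lA i)).2.comp (ad G (v (lA i)).1), -(v (lA i)).1)
  | Sum.inr (Sum.inr i) =>
      (-((v (lB i)).2 + (p (lB i)).2.comp (ad G (Ad (p (lB i)).1 (v (lB i)).1))).comp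
          (Ad (p (lB i)).1),
        Ad (p (lB i)).1 (v (lB i)).1)

/-- The images of tangent vectors under `conjMap` are contractions of explicit covectors; this gives
their tangency to the leaf and also evaluates the symplectic form on them. -/
lemma exists_conjMap_deriv (gμ : Fin n → G) (s : Fin n → (E →L[ℝ] ℝ)) (p : Phase E G n g) :
    ∃ S : Vec E n g →L[ℝ] Vec E n g,
      HasPhaseDerivAt (fun v => conjMap gμ s (phaseExp p v)) S 0 ∧
      ∀ v, S v = decSharp (conjMap gμ s p) (leafCov gμ p v) := by
  have hc : ∀ X : Loop n g, ∃ (S : Vec E n g →L[ℝ] E) (S' : Vec E n g →L[ℝ] E →L[ℝ] ℝ),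
      HasLogDerivAt (fun v => (conjMap gμ s (phaseExp p v) X).1) S 0 ∧
      HasFDerivAt (fun v => (conjMap gμ s (phaseExp p v) X).2) S' 0 ∧
      ∀ v, (S v, S' v) = decSharp (conjMap gμ s p) (leafCov gμ p v) X := by
    intro X
    have h := hasPhaseDerivAt_phaseExp p X
    rcases X with i | i | i
    · simp only [conjMap_puncture]
      have hu := (h.1.mul_const (gμ i)).mul h.1.inv
      refine ⟨_, _, hu, ((h.1.inv.coAd (hasFDerivAt_const (coAd (gμ i) (s i)) _)).add h.2).sub
        (hu.coAd h.2), fun v => ?_⟩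
      simp only [decSharp, leafCov, conjMap_puncture]
      refine Prod.ext ?_ ?_
      · simp [Ad_mul_apply, Ad_inv_Ad]
        abel
      · ext x
        simp [coAd_apply, Ad_mul_apply, Ad_inv_Ad, Ad_Ad_inv, Ad_ad]
        ring
    · refine ⟨_, _, h.1, h.2, fun v => ?_⟩
      simp only [decSharp, leafCov]
      refine Prod.ext (by simp) ?_
      ext x
      simp [conjMap]
    · refine ⟨_, _, h.1, h.2, fun v => ?_⟩
      simp only [decSharp, leafCov]
      refine Prod.ext (by simp [conjMap, Ad_inv_Ad]) ?_
      ext x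
      simp [conjMap, Ad_Ad_inv]
  choose S S' hS1 hS2 hS using hc
  exact ⟨ContinuousLinearMap.pi fun X => (S X).prod (S' X), fun X => ⟨hS1 X, hS2 X⟩,
    fun v => funext fun X => hS X v⟩

lemma leafCov_surjective (gμ : Fin n → G) (p : Phase E G n g) :
    Function.Surjective (leafCov gμ p) := by
  intro a
  refine ⟨fun X => match X with
    | Sum.inl i => (Ad (p (lM i)).1⁻¹ (a (lM i)).2,
        -(a (lM i)).1.comp (Ad ((p (lM i)).1 * gμ i * (p (lM i)).1⁻¹)⁻¹)
          - (p (lM i)).2.comp (ad G (a (lM i)).2))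
    | Sum.inr X => decSharp p a (Sum.inr X), funext fun X => ?_⟩
  rcases X with i | i | i
  · refine Prod.ext ?_ (by simp [leafCov, Ad_Ad_inv])
    ext x
    simp [leafCov, Ad_mul_apply, Ad_Ad_inv, Ad_inv_Ad]
  · refine Prod.ext ?_ (by simp [leafCov, decSharp])
    ext x
    simp [leafCov, decSharp]
  · refine Prod.ext ?_ (by simp [leafCov, decSharp, Ad_Ad_inv])
    ext x
    simp [leafCov, decSharp, Ad_Ad_inv, Ad_inv_Ad]

lemma mfderiv_conjMap_triv (gμ : Fin n → G) (s : Fin n → (E →L[ℝ] ℝ)) (p : Phase E G n g)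
    (v : Vec E n g) :
    (mfderiv (phaseModel E n g) (phaseModel E n g) (conjMap gμ s) p (triv p v : Vec E n g) :
      Vec E n g) = triv (conjMap gμ s p) (decSharp (conjMap gμ s p) (leafCov gμ p v)) := by
  obtain ⟨S, hS, hS'⟩ := exists_conjMap_deriv gμ s p
  let A : Vec E n g →L[ℝ] Vec E n g :=
    mfderiv (phaseModel E n g) (phaseModel E n g) (conjMap gμ s) p
  have hA : HasMFDerivAt (phaseModel E n g) (phaseModel E n g) (conjMap gμ s) p A :=
    ((contMDiff_conjMap gμ s).mdifferentiableAt (x := p) (by simp)).hasMFDerivAt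
  have key : ∀ q, q = p → HasMFDerivAt (phaseModel E n g) (phaseModel E n g) (conjMap gμ s) q A := by
    rintro q rfl; exact hA
  have h1 : HasMFDerivAt 𝓘(ℝ, Vec E n g) (phaseModel E n g) (fun v => conjMap gμ s (phaseExp p v))
      0 (A.comp ((triv (phaseExp p 0)).comp (ContinuousLinearMap.id ℝ (Vec E n g)))) :=
    HasMFDerivAt.comp 0 (key _ (by simp)) (hasPhaseDerivAt_phaseExp p).hasMFDerivAt
  have h2 := DFunLike.congr_fun (hasMFDerivAt_unique h1 hS.hasMFDerivAt) v
  rw [← hS']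
  have h3 : A (triv (phaseExp p 0) v) = triv (conjMap gμ s (phaseExp p 0)) (S v) := h2
  rwa [phaseExp_zero] at h3

lemma mem_leafTangent_iff [T2Space G] (q : Phase E G n g) (V : Vec E n g) :
    (V : TangentSpace (phaseModel E n g) q) ∈ leafTangent (phaseModel E n g) (decoupledBracket J) q
      ↔ ∃ a, V = triv q (decSharp q a) := by
  constructor
  · rintro ⟨f, hf, hV⟩
    exact ⟨_, (isHamiltonianAt_iff J hf q V).1 hV⟩
  · rintro ⟨a, rfl⟩
    obtain ⟨f, hf, rfl⟩ := exists_dcov_eq J q a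
    exact ⟨f, hf, isHamiltonianAt_triv J hf q⟩

lemma range_mfderiv_conjMap [T2Space G] (gμ : Fin n → G) (s : Fin n → (E →L[ℝ] ℝ))
    (p : Phase E G n g) :
    Set.range (mfderiv (phaseModel E n g) (phaseModel E n g) (conjMap gμ s) p) =
      leafTangent (phaseModel E n g) (decoupledBracket J) (conjMap gμ s p) := by
  ext V
  refine Iff.trans ?_ (mem_leafTangent_iff J (conjMap gμ s p) V).symm
  constructor
  · rintro ⟨w, rfl⟩
    refine ⟨leafCov gμ p (trivInv p w), ?_⟩
    refine Eq.trans ?_ (mfderiv_conjMap_triv gμ s p (trivInv p w))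
    exact congrArg (fun v : Vec E n g => (mfderiv (phaseModel E n g) (phaseModel E n g)
      (conjMap gμ s) p v : Vec E n g)) (triv_trivInv p w).symm
  · rintro ⟨a, rfl⟩
    obtain ⟨v, rfl⟩ := leafCov_surjective gμ p a
    exact ⟨triv p v, mfderiv_conjMap_triv gμ s p v⟩

/-! ### The symplectic structure -/

open Classical in
/-- The symplectic structure of the leaves. -/
def leafForm (q : Phase E G n g) (V W : TangentSpace (phaseModel E n g) q) : ℝ :=
  if h : ∃ a : Cov E n g, V = (triv q (decSharp q a) : Vec E n g) then
    pair h.choose (trivInv q W) else 0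

/-- By antisymmetry the value depends on `a` only through its contraction, so the choice made in
`leafForm` is harmless. -/
lemma leafForm_triv (q : Phase E G n g) (a b : Cov E n g) :
    leafForm q (triv q (decSharp q a) : Vec E n g) (triv q (decSharp q b) : Vec E n g)
      = pair a (decSharp q b) := by
  have h : ∃ a' : Cov E n g, triv q (decSharp q a) = triv q (decSharp q a') := ⟨a, rfl⟩
  have h1 : decSharp q a = decSharp q h.choose := by
    have := congrArg (trivInv q) h.choose_spec
    simpa using this
  have h2 : leafForm q (triv q (decSharp q a) : Vec E n g) (triv q (decSharp q b) : Vec E n g)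
      = pair h.choose (trivInv q (triv q (decSharp q b))) := dif_pos h
  rw [h2, trivInv_triv, pair_decSharp_antisymm, ← h1, ← pair_decSharp_antisymm]

lemma isLeafwiseSymplecticForm_leafForm [T2Space G] :
    IsLeafwiseSymplecticForm (phaseModel E n g) (decoupledBracket J)
      (leafForm : (q : Phase E G n g) → _) := by
  refine ⟨fun q f h hf hh V W hV hW => ?_, fun q V hV h => ?_⟩
  · rw [(isHamiltonianAt_iff J hf q V).1 hV, (isHamiltonianAt_iff J hh q W).1 hW]
    rw [leafForm_triv, decoupledBracket_eq J hh hf]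
  · obtain ⟨a, rfl⟩ := (mem_leafTangent_iff J q V).1 hV
    -- A non-zero contraction is detected by some covector `b`, whose own contraction is a tangent
    -- vector pairing non-trivially with it.
    have h0 : decSharp q a = 0 := by
      by_contra hne
      obtain ⟨l, hl⟩ := SeparatingDual.exists_separating_of_ne (R := ℝ) hne
      obtain ⟨b, rfl⟩ := exists_pair_eq l
      have hb := h (triv q (decSharp q b) : Vec E n g) ((mem_leafTangent_iff J q _).2 ⟨b, rfl⟩)
      rw [leafForm_triv, pair_decSharp_antisymm, neg_eq_zero] at hb
      exact hl (by rw [hb, map_zero])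
    rw [h0]
    exact map_zero (triv q)

end Symplectic

/-! ### The exterior derivative of the potential. -/

section Potential

variable {E : Type*} [NormedAddCommGroup E] [NormedSpace ℝ E] [FiniteDimensional ℝ E]
  {G : Type*} [TopologicalSpace G] [ChartedSpace E G] [Group G]
  {n g : ℕ}
  {N : Type*} [NormedAddCommGroup N] [NormedSpace ℝ N]
  [LieGroup 𝓘(ℝ, E) ∞ G]

/-! ### The differential of the symplectic potential -/

lemma extDeriv_ofSubsingleton {ϑ : N → N →L[ℝ] ℝ} {ϑ' : N →L[ℝ] N →L[ℝ] ℝ} {z : N}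
    (h : HasFDerivAt ϑ ϑ' z) (a b : N) :
    extDeriv (fun y => ContinuousAlternatingMap.ofSubsingleton ℝ N ℝ (0 : Fin 1) (ϑ y)) z ![a, b]
      = ϑ' a b - ϑ' b a := by
  have h1 : HasFDerivAt
      (fun y => ContinuousAlternatingMap.ofSubsingleton ℝ N ℝ (0 : Fin 1) (ϑ y)) _ z :=
    ((ContinuousAlternatingMap.ofSubsingletonLIE (ι := Fin 1) (𝕜 := ℝ) (E := N) (F := ℝ)
      0).toContinuousLinearEquiv.toContinuousLinearMap.hasFDerivAt).comp z h
  have h2 : ∀ c d : N, fderiv ℝ (fun y => ϑ y c) z d = ϑ' d c := fun c d => by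
    have h3 := h.clm_apply (hasFDerivAt_const c z)
    rw [h3.fderiv]
    simp
  rw [extDeriv_apply h1.differentiableAt]
  simp [Fin.sum_univ_two, h2, sub_eq_add_neg, Fin.removeNth, Fin.succAbove]

/-- `d⟨μ, θ⟩ = ⟨dμ ∧ θ⟩ + ⟨μ, dθ⟩`, with `dθ` given by the Maurer-Cartan equation. -/
lemma curl_clm_comp {μ : N → E →L[ℝ] ℝ} {μ' : N →L[ℝ] E →L[ℝ] ℝ} {c : N → G}
    {θ : N → N →L[ℝ] E} {z : N} (hμ : HasFDerivAt μ μ' z)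
    (hθ : ∀ᶠ z in 𝓝 z, HasLogDerivAt c (θ z) z)
    (hr : ContDiffAt ℝ 2 (fun y => (logC ((c z)⁻¹ * c y) : E)) z) :
    ∃ ϑ' : N →L[ℝ] N →L[ℝ] ℝ, HasFDerivAt (fun y => (μ y).comp (θ y)) ϑ' z ∧
      ∀ a b, ϑ' a b - ϑ' b a
        = μ' a (θ z b) - μ' b (θ z a) - μ z (ad G (θ z a) (θ z b)) := by
  obtain ⟨θ', hθ', h⟩ := maurerCartan hθ hr
  refine ⟨_, hμ.clm_comp hθ', fun a b => ?_⟩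
  have h2 := congrArg (μ z) (h a b)
  simp only [map_sub, map_neg] at h2
  simp
  linarith

lemma leftMC_eq (X : Loop n g) (p : Phase E G n g) :
    (leftMC X p : Vec E n g →L[ℝ] E) = (leftDivD (p X).1).comp
      ((ContinuousLinearMap.fst ℝ E (E →L[ℝ] ℝ)).comp (ContinuousLinearMap.proj X)) := by
  have h1 := HasMFDerivAt.comp p (hasMFDerivAt_fst (I := 𝓘(ℝ, E)) (I' := 𝓘(ℝ, E →L[ℝ] ℝ)) (p X))
    (hasMFDerivAt_apply (IF := fun _ : Loop n g => (𝓘(ℝ, E)).prod 𝓘(ℝ, E →L[ℝ] ℝ)) p X)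
  have hdiv : HasMFDerivAt 𝓘(ℝ, E) 𝓘(ℝ, E) (fun v : G => (p X).1⁻¹ * v) (p X).1
      (leftDivD (p X).1 : E →L[ℝ] E) :=
    ((contMDiff_mul_left' _).mdifferentiableAt (by simp)).hasMFDerivAt
  exact (HasMFDerivAt.comp p hdiv h1).mfderiv

lemma rightMC_eq (X : Loop n g) (p : Phase E G n g) :
    (rightMC X p : Vec E n g →L[ℝ] E) = (Ad (p X).1).comp ((leftDivD (p X).1).comp
      ((ContinuousLinearMap.fst ℝ E (E →L[ℝ] ℝ)).comp (ContinuousLinearMap.proj X))) := by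
  have h1 := HasMFDerivAt.comp p (hasMFDerivAt_fst (I := 𝓘(ℝ, E)) (I' := 𝓘(ℝ, E →L[ℝ] ℝ)) (p X))
    (hasMFDerivAt_apply (IF := fun _ : Loop n g => (𝓘(ℝ, E)).prod 𝓘(ℝ, E →L[ℝ] ℝ)) p X)
  have hdiv : HasMFDerivAt 𝓘(ℝ, E) 𝓘(ℝ, E) (fun v : G => (p X).1⁻¹ * v) (p X).1
      (leftDivD (p X).1 : E →L[ℝ] E) :=
    ((contMDiff_mul_left' _).mdifferentiableAt (by simp)).hasMFDerivAt
  have key : ∀ w : G, w = 1 → HasMFDerivAt 𝓘(ℝ, E) 𝓘(ℝ, E)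
      (fun v : G => (p X).1 * v * (p X).1⁻¹) w (Ad (p X).1 : E →L[ℝ] E) := by
    rintro w rfl
    exact ((contMDiff_conj _).mdifferentiableAt (by simp)).hasMFDerivAt
  have h2 := HasMFDerivAt.comp p (HasMFDerivAt.comp (p X).1 (key _ (by simp)) hdiv) h1
  have he : (fun q : Phase E G n g => (q X).1 * (p X).1⁻¹)
      = ((fun v : G => (p X).1 * v * (p X).1⁻¹) ∘ fun v : G => (p X).1⁻¹ * v) ∘
        (Prod.fst ∘ fun q : Phase E G n g => q X) := by
    funext q; simp
  rw [← he] at h2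
  exact h2.mfderiv

/-- Writing `⟨dv v⁻¹, j'⟩ = ⟨v⁻¹ dv, Ad*(v) j'⟩` leaves only left forms to differentiate, and
`Ad*(v) j' = Ad*(g_μ) s + Ad*(v) x - Ad*(v g_μ) x` contains no inverses. -/
lemma curl_puncture (gμ : Fin n → G) (s : Fin n → (E →L[ℝ] ℝ)) {Φ : N → Phase E G n g}
    {T : N → N →L[ℝ] Vec E n g} {z : N} (i : Fin n)
    (hT : ∀ᶠ z in 𝓝 z, HasPhaseDerivAt Φ (T z) z)
    (hr : ContDiffAt ℝ 2 (fun y => (logC ((Φ z (lM i)).1⁻¹ * (Φ y (lM i)).1) : E)) z) :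
    ∃ ϑ' : N →L[ℝ] N →L[ℝ] ℝ, HasFDerivAt (fun y =>
      (coAd (Φ y (lM i)).1 (conjMap gμ s (Φ y) (lM i)).2).comp
        ((ContinuousLinearMap.fst ℝ E (E →L[ℝ] ℝ)).comp ((ContinuousLinearMap.proj (lM i)).comp
          (T y)))) ϑ' z ∧
      ∀ a b, -(ϑ' a b - ϑ' b a) =
        (leafCov gμ (Φ z) (T z a) (lM i)).1
            (decSharp (conjMap gμ s (Φ z)) (leafCov gμ (Φ z) (T z b)) (lM i)).1
          + (decSharp (conjMap gμ s (Φ z)) (leafCov gμ (Φ z) (T z b)) (lM i)).2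
            (leafCov gμ (Φ z) (T z a) (lM i)).2 := by
  have hμ : ∀ y, coAd (Φ y (lM i)).1 (conjMap gμ s (Φ y) (lM i)).2
      = coAd (gμ i) (s i) + coAd (Φ y (lM i)).1 (Φ y (lM i)).2
        - coAd ((Φ y (lM i)).1 * gμ i) (Φ y (lM i)).2 := fun y => by
    rw [conjMap_puncture]
    ext x
    simp [coAd_apply, Ad_mul_apply, Ad_inv_Ad]
  simp only [hμ]
  have h := hT.self_of_nhds (lM i)
  obtain ⟨ϑ', h1, h2⟩ := curl_clm_comp (((h.1.coAd h.2).const_add (coAd (gμ i) (s i))).sub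
    ((h.1.mul_const (gμ i)).coAd h.2)) (hT.mono fun y hy => (hy (lM i)).1) hr
  refine ⟨ϑ', h1, fun a b => ?_⟩
  rw [h2]
  -- The two sides differ only in the orientation of some brackets; these instances of antisymmetry
  -- align them.
  have m : ∀ (k : E →L[ℝ] ℝ) (x y : E), k (ad G x y) = -k (ad G y x) := fun k x y => by
    rw [ad_skew, map_neg]
  have m1 := m (Φ z (lM i)).2 (Ad (Φ z (lM i)).1 (T z a (lM i)).1) (Ad (Φ z (lM i)).1 (T z b (lM i)).1)
  have m2 := m (s i) (Ad (gμ i) (T z a (lM i)).1) (Ad (gμ i) (T z b (lM i)).1)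
  have m3 := m (Φ z (lM i)).2 (Ad (Φ z (lM i)).1 (Ad (gμ i) (T z a (lM i)).1 : E))
    (Ad (Φ z (lM i)).1 (Ad (gμ i) (T z b (lM i)).1 : E))
  have m4 := m (Φ z (lM i)).2 (Ad (Φ z (lM i)).1 (T z a (lM i)).1)
    (Ad (Φ z (lM i)).1 (Ad (gμ i) (T z b (lM i)).1 : E))
  have m5 := m (Φ z (lM i)).2 (Ad (Φ z (lM i)).1 (T z b (lM i)).1)
    (Ad (Φ z (lM i)).1 (Ad (gμ i) (T z a (lM i)).1 : E))
  simp [decSharp, leafCov, conjMap_puncture, coAd_apply, Ad_mul_apply, Ad_inv_Ad, Ad_Ad_inv, Ad_ad]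
  linarith

lemma curl_handle_left (gμ : Fin n → G) (s : Fin n → (E →L[ℝ] ℝ)) {Φ : N → Phase E G n g}
    {T : N → N →L[ℝ] Vec E n g} {z : N} (i : Fin g)
    (hT : ∀ᶠ z in 𝓝 z, HasPhaseDerivAt Φ (T z) z)
    (hr : ContDiffAt ℝ 2 (fun y => (logC ((Φ z (lA i)).1⁻¹ * (Φ y (lA i)).1) : E)) z) :
    ∃ ϑ' : N →L[ℝ] N →L[ℝ] ℝ, HasFDerivAt (fun y =>
      ((Φ y (lA i)).2).comp
        ((ContinuousLinearMap.fst ℝ E (E →L[ℝ] ℝ)).comp ((ContinuousLinearMap.proj (lA i)).comp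
          (T y)))) ϑ' z ∧
      ∀ a b, ϑ' a b - ϑ' b a =
        (leafCov gμ (Φ z) (T z a) (lA i)).1
            (decSharp (conjMap gμ s (Φ z)) (leafCov gμ (Φ z) (T z b)) (lA i)).1
          + (decSharp (conjMap gμ s (Φ z)) (leafCov gμ (Φ z) (T z b)) (lA i)).2
            (leafCov gμ (Φ z) (T z a) (lA i)).2 := by
  have h := hT.self_of_nhds (lA i)
  obtain ⟨ϑ', h1, h2⟩ := curl_clm_comp h.2 (hT.mono fun y hy => (hy (lA i)).1) hr
  refine ⟨ϑ', h1, fun a b => ?_⟩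
  rw [h2]
  simp [decSharp, leafCov, conjMap]
  ring

lemma curl_handle_right (gμ : Fin n → G) (s : Fin n → (E →L[ℝ] ℝ)) {Φ : N → Phase E G n g}
    {T : N → N →L[ℝ] Vec E n g} {z : N} (i : Fin g)
    (hT : ∀ᶠ z in 𝓝 z, HasPhaseDerivAt Φ (T z) z)
    (hr : ContDiffAt ℝ 2 (fun y => (logC ((Φ z (lB i)).1⁻¹ * (Φ y (lB i)).1) : E)) z) :
    ∃ ϑ' : N →L[ℝ] N →L[ℝ] ℝ, HasFDerivAt (fun y =>
      (coAd (Φ y (lB i)).1 (Φ y (lB i)).2).comp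
        ((ContinuousLinearMap.fst ℝ E (E →L[ℝ] ℝ)).comp ((ContinuousLinearMap.proj (lB i)).comp
          (T y)))) ϑ' z ∧
      ∀ a b, -(ϑ' a b - ϑ' b a) =
        (leafCov gμ (Φ z) (T z a) (lB i)).1
            (decSharp (conjMap gμ s (Φ z)) (leafCov gμ (Φ z) (T z b)) (lB i)).1
          + (decSharp (conjMap gμ s (Φ z)) (leafCov gμ (Φ z) (T z b)) (lB i)).2
            (leafCov gμ (Φ z) (T z a) (lB i)).2 := by
  have h := hT.self_of_nhds (lB i)
  obtain ⟨ϑ', h1, h2⟩ := curl_clm_comp (h.1.coAd h.2) (hT.mono fun y hy => (hy (lB i)).1) hr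
  refine ⟨ϑ', h1, fun a b => ?_⟩
  rw [h2]
  have m : ∀ (k : E →L[ℝ] ℝ) (x y : E), k (ad G x y) = -k (ad G y x) := fun k x y => by
    rw [ad_skew, map_neg]
  have m1 := m (Φ z (lB i)).2 (Ad (Φ z (lB i)).1 (T z a (lB i)).1) (Ad (Φ z (lB i)).1 (T z b (lB i)).1)
  simp [decSharp, leafCov, conjMap, coAd_apply, Ad_mul_apply, Ad_inv_Ad, Ad_Ad_inv, Ad_ad]
  linarith

/-! The chart at a point of the phase space, and the coordinate expression of the potential. -/

lemma eventually_hasPhaseDerivAt_chart_symm (p : Phase E G n g) :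
    ∀ᶠ z in 𝓝 (extChartAt (phaseModel E n g) p p),
      HasPhaseDerivAt (extChartAt (phaseModel E n g) p).symm
        ((trivInv ((extChartAt (phaseModel E n g) p).symm z)).comp
          (mfderiv 𝓘(ℝ, Vec E n g) (phaseModel E n g) (extChartAt (phaseModel E n g) p).symm z :
            Vec E n g →L[ℝ] Vec E n g)) z := by
  haveI : IsManifold 𝓘(ℝ, E) ∞ G := inferInstance
  filter_upwards [(isOpen_extChartAt_target (I := phaseModel E n g) p).mem_nhds
    (mem_extChartAt_target p)] with z hz
  have h1 : ContMDiffAt 𝓘(ℝ, Vec E n g) (phaseModel E n g) ∞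
      (extChartAt (phaseModel E n g) p).symm z :=
    (contMDiffOn_extChartAt_symm p).contMDiffAt
      ((isOpen_extChartAt_target (I := phaseModel E n g) p).mem_nhds hz)
  let D : Vec E n g →L[ℝ] Vec E n g :=
    mfderiv 𝓘(ℝ, Vec E n g) (phaseModel E n g) (extChartAt (phaseModel E n g) p).symm z
  have h2 : HasMFDerivAt 𝓘(ℝ, Vec E n g) (phaseModel E n g) (extChartAt (phaseModel E n g) p).symm
    z D := (h1.mdifferentiableAt (by simp)).hasMFDerivAt
  refine hasPhaseDerivAt_of_hasMFDerivAt ?_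
  have h3 : (triv ((extChartAt (phaseModel E n g) p).symm z)).comp
      ((trivInv ((extChartAt (phaseModel E n g) p).symm z)).comp D) = D := by
    ext1 v
    exact triv_trivInv _ _
  exact h3.symm ▸ h2

lemma contDiffAt_logC_chart_symm (p : Phase E G n g) (X : Loop n g) :
    ContDiffAt ℝ 2 (fun y => (logC (((extChartAt (phaseModel E n g) p).symm
      (extChartAt (phaseModel E n g) p p) X).1⁻¹ *
        ((extChartAt (phaseModel E n g) p).symm y X).1) : E))
      (extChartAt (phaseModel E n g) p p) := by
  haveI : IsManifold 𝓘(ℝ, E) ∞ G := inferInstance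
  have h1 : ContMDiffAt 𝓘(ℝ, Vec E n g) (phaseModel E n g) ∞
      (extChartAt (phaseModel E n g) p).symm (extChartAt (phaseModel E n g) p p) :=
    (contMDiffOn_extChartAt_symm p).contMDiffAt
      ((isOpen_extChartAt_target (I := phaseModel E n g) p).mem_nhds (mem_extChartAt_target p))
  have h2 := ((contMDiff_phase_fst (E := E) (G := G) X) _).comp _ h1
  have h3 := ((contMDiff_mul_left' (E := E) (((extChartAt (phaseModel E n g) p).symm
      (extChartAt (phaseModel E n g) p p) X).1⁻¹)) _).comp _ h2
  have h4 : ContMDiffAt 𝓘(ℝ, Vec E n g) 𝓘(ℝ, E) ∞ (fun y => (logC (((extChartAt (phaseModel E n g)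
      p).symm (extChartAt (phaseModel E n g) p p) X).1⁻¹ *
        ((extChartAt (phaseModel E n g) p).symm y X).1) : E))
      (extChartAt (phaseModel E n g) p p) := by
    refine ContMDiffAt.comp (extChartAt (phaseModel E n g) p p) (g := (logC : G → E)) ?_ h3
    simpa using contMDiffAt_logC
  exact (contMDiffAt_iff_contDiffAt.1 h4).of_le (by norm_cast)

/-- The symplectic potential as a linear form on the model space. -/
def potentialForm (gμ : Fin n → G) (s : Fin n → (E →L[ℝ] ℝ)) (q : Phase E G n g) :
    Vec E n g →L[ℝ] ℝ :=
  symplecticPotential gμ s q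

/-- Since `dv v⁻¹ = Ad(v) (v⁻¹ dv)`, the potential in a chart is expressed entirely by the
left-trivialised derivative of the inverse chart, the shape treated by the three curl lemmas. -/
lemma potentialForm_comp (gμ : Fin n → G) (s : Fin n → (E →L[ℝ] ℝ)) (q : Phase E G n g)
    (D : Vec E n g →L[ℝ] Vec E n g) :
    (potentialForm gμ s q).comp D =
      -(∑ i : Fin n, (coAd (q (lM i)).1 (conjMap gμ s q (lM i)).2).comp
        ((ContinuousLinearMap.fst ℝ E (E →L[ℝ] ℝ)).comp ((ContinuousLinearMap.proj (lM i)).comp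
          ((trivInv q).comp D))))
      + ∑ i : Fin g, (((q (lA i)).2).comp
        ((ContinuousLinearMap.fst ℝ E (E →L[ℝ] ℝ)).comp ((ContinuousLinearMap.proj (lA i)).comp
          ((trivInv q).comp D)))
        - (coAd (q (lB i)).1 (q (lB i)).2).comp
        ((ContinuousLinearMap.fst ℝ E (E →L[ℝ] ℝ)).comp ((ContinuousLinearMap.proj (lB i)).comp
          ((trivInv q).comp D)))) := by
  let L : Loop n g → Vec E n g →L[ℝ] E := fun X => leftMC X q
  let R : Loop n g → Vec E n g →L[ℝ] E := fun X => rightMC X q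
  have hL : ∀ X v, L X v = (trivInv q v X).1 := fun X v => DFunLike.congr_fun (leftMC_eq X q) v
  have hR : ∀ X v, R X v = Ad (q X).1 (trivInv q v X).1 := fun X v =>
    DFunLike.congr_fun (rightMC_eq X q) v
  have e : potentialForm gμ s q = -(∑ i : Fin n, (conjMap gμ s q (lM i)).2.comp (R (lM i)))
      + ∑ i : Fin g, ((q (lA i)).2.comp (L (lA i)) - (q (lB i)).2.comp (R (lB i))) := rfl
  rw [e]
  ext v
  simp only [add_apply, neg_apply, sub_apply, sum_apply, ContinuousLinearMap.comp_apply, hL, hR]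
  rfl

lemma leafForm_eq_extDeriv (gμ : Fin n → G) (s : Fin n → (E →L[ℝ] ℝ)) (p : Phase E G n g)
    (v w : TangentSpace (phaseModel E n g) p) :
    leafForm (conjMap gμ s p) (mfderiv (phaseModel E n g) (phaseModel E n g) (conjMap gμ s) p v)
        (mfderiv (phaseModel E n g) (phaseModel E n g) (conjMap gμ s) p w) =
      extDerivOneForm (phaseModel E n g) (symplecticPotential gμ s) p v w := by
  haveI : IsManifold 𝓘(ℝ, E) ∞ G := inferInstance
  haveI : IsManifold (phaseModel E n g) 1 (Phase E G n g) :=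
    IsManifold.of_le (n := ∞) (by norm_cast)
  set z := extChartAt (phaseModel E n g) p p with hz
  set Φ : Vec E n g → Phase E G n g := ⇑(extChartAt (phaseModel E n g) p).symm with hΦ
  have hΦz : Φ z = p := extChartAt_to_inv p
  let D : Vec E n g → Vec E n g →L[ℝ] Vec E n g := fun y =>
    mfderiv 𝓘(ℝ, Vec E n g) (phaseModel E n g) Φ y
  let T : Vec E n g → Vec E n g →L[ℝ] Vec E n g := fun y => (trivInv (Φ y)).comp (D y)
  have hT : ∀ᶠ y in 𝓝 z, HasPhaseDerivAt Φ (T y) y := eventually_hasPhaseDerivAt_chart_symm p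
  let C : Vec E n g →L[ℝ] Vec E n g :=
    mfderiv (phaseModel E n g) 𝓘(ℝ, Vec E n g) (extChartAt (phaseModel E n g) p) p
  -- The chart and its inverse have mutually inverse differentials, so at `p` the trivialised
  -- coordinate vectors are just the trivialisations of `v` and `w`.
  have hDC : ∀ x : Vec E n g, D z (C x) = x := by
    intro x
    have h := mfderivWithin_extChartAt_symm_comp_mfderiv_extChartAt' (I := phaseModel E n g)
      (x := p) (mem_extChartAt_source p)
    rw [ModelWithCorners.range_eq_univ, mfderivWithin_univ] at h
    exact DFunLike.congr_fun h x
  have hTC : ∀ x : Vec E n g, T z (C x) = trivInv p x := fun x => by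
    have h : T z (C x) = trivInv (Φ z) (D z (C x)) := rfl
    rw [h, hDC, hΦz]
  choose ϑM hM1 hM2 using fun i : Fin n =>
    curl_puncture gμ s i hT (contDiffAt_logC_chart_symm p (lM i))
  choose ϑA hA1 hA2 using fun i : Fin g =>
    curl_handle_left gμ s i hT (contDiffAt_logC_chart_symm p (lA i))
  choose ϑB hB1 hB2 using fun i : Fin g =>
    curl_handle_right gμ s i hT (contDiffAt_logC_chart_symm p (lB i))
  have hsum := ((HasFDerivAt.fun_sum (u := Finset.univ) fun i _ => hM1 i).fun_neg).fun_add
    (HasFDerivAt.fun_sum (u := Finset.univ) fun i _ => (hA1 i).fun_sub (hB1 i))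
  have hpot := fun y => potentialForm_comp gμ s (Φ y) (D y)
  have hsum' : HasFDerivAt (fun y => (potentialForm gμ s (Φ y)).comp (D y)) (-(∑ i, ϑM i) + ∑ i, (ϑA i - ϑB i)) z := by
    simp only [hpot]
    exact hsum
  have hext : extDerivOneForm (phaseModel E n g) (symplecticPotential gμ s) p v w = _ :=
    extDeriv_ofSubsingleton hsum' (C v) (C w)
  rw [hext]
  let v' : Vec E n g := trivInv p v
  let w' : Vec E n g := trivInv p w
  have hv : (mfderiv (phaseModel E n g) (phaseModel E n g) (conjMap gμ s) p v : Vec E n g)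
      = triv (conjMap gμ s p) (decSharp (conjMap gμ s p) (leafCov gμ p v')) :=
    (congrArg (fun v : Vec E n g => (mfderiv (phaseModel E n g) (phaseModel E n g)
      (conjMap gμ s) p v : Vec E n g)) (triv_trivInv p v).symm).trans
      (mfderiv_conjMap_triv gμ s p v')
  have hw : (mfderiv (phaseModel E n g) (phaseModel E n g) (conjMap gμ s) p w : Vec E n g)
      = triv (conjMap gμ s p) (decSharp (conjMap gμ s p) (leafCov gμ p w')) :=
    (congrArg (fun v : Vec E n g => (mfderiv (phaseModel E n g) (phaseModel E n g)
      (conjMap gμ s) p v : Vec E n g)) (triv_trivInv p w).symm).trans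
      (mfderiv_conjMap_triv gμ s p w')
  refine (congrArg₂ (fun a b : Vec E n g => leafForm (conjMap gμ s p) a b) hv hw).trans ?_
  rw [leafForm_triv, pair_apply, Fintype.sum_sum_type, Fintype.sum_sum_type,
    ← Finset.sum_add_distrib]
  have hM := fun i => hM2 i (C v) (C w)
  have hA := fun i => hA2 i (C v) (C w)
  have hB := fun i => hB2 i (C v) (C w)
  have ev : T z (C v) = v' := hTC v
  have ew : T z (C w) = w' := hTC w
  rw [ev, ew, hΦz] at hM hA hB
  rw [← Finset.sum_congr rfl fun i _ => hM i,
    ← Finset.sum_congr rfl fun i _ => congrArg₂ (· + ·) (hA i) (hB i)]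
  simp only [add_apply, neg_apply, sub_apply, sum_apply, Finset.sum_add_distrib,
    Finset.sum_sub_distrib, Finset.sum_neg_distrib]
  ring

end Potential

end Flower

end

end

theorem mainTheorem2 {E : Type*} [NormedAddCommGroup E] [NormedSpace ℝ E]
    [FiniteDimensional ℝ E] {G : Type*} [TopologicalSpace G] [ChartedSpace E G] [Group G]
    [LieGroup 𝓘(ℝ, E) ∞ G] [T2Space G] [ConnectedSpace G]
    {ι : Type*} [Fintype ι] (J : Module.Basis ι ℝ E) (n g : ℕ) :
    -- the composite of the pull-backs by `L` and by the decoupling map is a bijection of the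
    -- flower algebra onto itself
    Set.BijOn (fun f : Phase E G n g → ℝ => (f ∘ handleMap) ∘ decouplingMap)
      (flowerAlgebra E G n g) (flowerAlgebra E G n g) ∧
    -- that relates the two Poisson brackets
    (∀ f h : Phase E G n g → ℝ, ContMDiff (phaseModel E n g) 𝓘(ℝ, ℝ) ∞ f →
      ContMDiff (phaseModel E n g) 𝓘(ℝ, ℝ) ∞ h →
      flowerBracket J ((f ∘ handleMap) ∘ decouplingMap) ((h ∘ handleMap) ∘ decouplingMap) =
        (decoupledBracket J f h ∘ handleMap) ∘ decouplingMap) ∧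
    -- elements of the flower algebra are smooth
    (∀ f ∈ flowerAlgebra E G n g, ContMDiff (phaseModel E n g) 𝓘(ℝ, ℝ) ∞ f) ∧
    -- the symplectic leaves
    (∀ S : Set (Phase E G n g),
      IsSymplecticLeaf (phaseModel E n g) (decoupledBracket J) S ↔
        ∃ C : Fin n → ConjClasses (SemiH E G), S = conjProduct C) ∧
    -- the symplectic structure on the leaves
    ∃ σ : (q : Phase E G n g) → TangentSpace (phaseModel E n g) q →
        TangentSpace (phaseModel E n g) q → ℝ,
      IsLeafwiseSymplecticForm (phaseModel E n g) (decoupledBracket J) σ ∧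
      ∀ (gμ : Fin n → G) (s : Fin n → (E →L[ℝ] ℝ)),
        ContMDiff (phaseModel E n g) (phaseModel E n g) ∞
          (conjMap gμ s : Phase E G n g → Phase E G n g) ∧
        Set.range (conjMap gμ s : Phase E G n g → Phase E G n g) =
          conjProduct (fun i => ConjClasses.mk (mkH (gμ i) (-s i))) ∧
        ∀ p : Phase E G n g,
          Set.range (mfderiv (phaseModel E n g) (phaseModel E n g) (conjMap gμ s) p) =
            leafTangent (phaseModel E n g) (decoupledBracket J) (conjMap gμ s p) ∧
          ∀ v w : TangentSpace (phaseModel E n g) p,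
            σ (conjMap gμ s p) (mfderiv (phaseModel E n g) (phaseModel E n g) (conjMap gμ s) p v)
                (mfderiv (phaseModel E n g) (phaseModel E n g) (conjMap gμ s) p w) =
              extDerivOneForm (phaseModel E n g) (symplecticPotential gμ s) p v w := by
  refine ⟨bijOn_decoupling, fun f h hf hh => flowerBracket_decoupling J hf hh,
    fun f hf => contMDiff_of_mem_flowerAlgebra hf, isSymplecticLeaf_iff J,
    leafForm, isLeafwiseSymplecticForm_leafForm J, fun gμ s => ⟨contMDiff_conjMap gμ s,
      range_conjMap gμ s, fun p => ⟨range_mfderiv_conjMap J gμ s p, leafForm_eq_extDeriv gμ s p⟩⟩⟩
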